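/- **Setting.** A *crease pattern* $\Xi$ is a finite straight-line planar graph embedded in $\mathbb R^2$. Its *interior faces* are the bounded components of the complement; an edge is a *crease* if it does not bound the unbounded component, and a *boundary edge* otherwise. All interior faces are assumed convex. A *flat mapping function* $f$ for $\Xi$ is isometric on each closed interior face, and exactly one of any two faces sharing a crease is reflected by $f$. Two faces $A\ne B$ *overlap* if $f(A)\cap f(B)\neq\emptyset$ (faces are open). A *layer ordering graph* $\Lambda$ orients each overlapping pair ($A\to B$: $B$ lies above $A$); it is assumed acyclic, and $\Gamma$ is its transitive reduction. The pair $(\Xi,\Gamma)$ is a *flat folded state* if, whenever a crease $\xi$ joins faces $A,B$ and a third face $C$ satisfies $f(C)\cap f(\xi)\ne\emptyset$, no directed path of $\Gamma$ between $A$ and $B$ visits $C$. It is *non-wrapping* if, whenever $\xi$ joins $A,B$ and $A\to C\to B$ in $\Lambda$, the image under $f$ of no edge of $C$ meets the image of $\xi$ without its end points. Assume also that no face has a straight angle between one of its creases and another of its edges. **Weights.** A *weight assignment* $\omega$ gives every edge of $\Gamma$ a positive weight such that for any faces $A,B$ all paths from $A$ to $B$ in $\Gamma$ have the same weight sum, where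 an edge counts positively when followed upwards and negatively when followed downwards. The *width* $w_\xi>0$ of a crease $\xi$ is the weight sum along a path from its lower to its upper incident face. Let $h$ be heights of the faces with $h(B)-h(A)$ equal to the weight sum of any path from $A$ to $B$ (such heights always exist). **Construction.** For a vertex $v$ of a face $F$ let $R_{F,v}$ be the sector of $F$ at $v$, translated to the origin, minus the points at distance less than $w_\xi/2$ from the line of some crease $\xi\ni v$ of $F$. A *refinement* cuts every $R_{F,v}$ by finitely many half-planes to a set $T_{F,v}$ with $R_{F,v}\setminus T_{F,v}$ bounded, so that at each vertex the local pictures defined below are free of strict intersections. At scale $s>0$ the *reduced face* of $F$ is $F_s=\{x\in\overline F: x\in v+sT_{F,v}\text{ for all vertices } v \text{ of } F\}$. Each crease $\xi$ is replaced by the two parallel *new creases* formed by the points of $F_s$ at distance $s\,w_\xi/2$ from the line of $\xi$, one for each of its two incident faces $F$; the *widened crease* is the convex hull of both. In the *three-dimensional folded state*, $F_s$ is mapped by $x\mapsto(f(x),s\,h(F))$, and the widened crease becomes the convex hull of the images of its two new creases. Two pieces (reduced faces or widened creases) *intersect strictly* if their relative interiors meet. The *local picture* of a piece $Q(s)$ at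 a point $z$ is the set of all $y$ with $z+sy\in Q(s)$ for all sufficiently small $s>0$; in a refinement, for each vertex $v$, the local pictures of distinct pieces do not intersect strictly, neither at $v$ in the plane nor at $(f(v),0)$ in the folded state. **Theorem 1.** Let $(\Xi,\Gamma)$ be a non-wrapping flat folded state as above, $\omega$ a weight assignment and $h$ corresponding heights. Then a refinement of the vertex polygons exists, and for every refinement there is a scale $s>0$ at which all new creases have positive length, all reduced faces have non-empty interior, the pieces of the thickened crease pattern do not intersect strictly in the plane, and no two distinct pieces intersect strictly in the three-dimensional folded state. -/

import Mathlib

open Set Filter Topology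

/-- The Euclidean plane. -/
abbrev Plane : Type := EuclideanSpace ℝ (Fin 2)

/-- Three-dimensional space, written as plane times height.  Only its affine structure and its
topology are used below. -/
abbrev Space : Type := Plane × ℝ

/-- Two (convex) pieces intersect strictly if their relative interiors meet. -/
def StrictlyIntersect {V : Type*} [AddCommGroup V] [Module ℝ V] [TopologicalSpace V]
    (X Y : Set V) : Prop :=
  (intrinsicInterior ℝ X ∩ intrinsicInterior ℝ Y).Nonempty

/-! ### Crease patterns -/

/-- A finite straight-line planar graph embedded in the plane: edges are segments between
vertices, no vertex lies inside an edge, and distinct edges meet in vertices only. -/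
structure CreasePattern where
  vertices : Finset Plane
  Adj : Plane → Plane → Prop
  symm : ∀ a b, Adj a b → Adj b a
  ne_of_adj : ∀ a b, Adj a b → a ≠ b
  mem_of_adj : ∀ a b, Adj a b → a ∈ vertices
  vertex_on_edge : ∀ a b v, Adj a b → v ∈ vertices → v ∈ segment ℝ a b → v = a ∨ v = b
  edges_meet : ∀ a b c d p, Adj a b → Adj c d → p ∈ segment ℝ a b → p ∈ segment ℝ c d →
    p ∈ vertices ∨ segment ℝ a b = segment ℝ c d

namespace CreasePattern

variable (P : CreasePattern)

/-- Edges, as closed segments. -/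
def IsEdge (e : Set Plane) : Prop := ∃ a b, P.Adj a b ∧ e = segment ℝ a b

/-- The drawing of the graph. -/
def skeleton : Set Plane := {x | x ∈ P.vertices ∨ ∃ e, P.IsEdge e ∧ x ∈ e}

/-- The (open) regions cut out by the drawing, including the unbounded one. -/
def IsRegion (F : Set Plane) : Prop :=
  ∃ x ∈ P.skeletonᶜ, F = connectedComponentIn P.skeletonᶜ x

/-- The interior faces: the bounded regions. -/
def Face : Type := {F : Set Plane // P.IsRegion F ∧ Bornology.IsBounded F}

/-- The creases: the edges that do not bound the exterior (unbounded) region. -/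
def Crease : Type :=
  {e : Set Plane // P.IsEdge e ∧
    ∀ F, P.IsRegion F → ¬ Bornology.IsBounded F → ¬ e ⊆ closure F}

variable {P}

/-- The point set of a face (an open set). -/
def Face.carrier (F : P.Face) : Set Plane := F.1

/-- The point set of a crease (a closed segment). -/
def Crease.carrier (e : P.Crease) : Set Plane := e.1

/-- The line through a crease. -/
def Crease.line (e : P.Crease) : Set Plane := (affineSpan ℝ e.carrier : Set Plane)

/-- The edge `e` bounds the face `F`. -/
def Face.BoundedBy (F : P.Face) (e : Set Plane) : Prop := e ⊆ closure F.carrier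

variable (P)

/-- A flat mapping function: an isometry on every closed interior face, exactly one of any two
faces sharing a crease being reflected.  (Being one function on the whole sheet, it maps a shared
edge in the same way from both sides.  The vanishing of the alternating angle sums at interior
vertices is necessary for such a function to exist, so it is not required separately.) -/
def IsFlatMapping (f : Plane → Plane) : Prop :=
  (∀ F : P.Face, ∃ g : Plane ≃ᵃⁱ[ℝ] Plane, EqOn f g (closure F.carrier)) ∧
  ∀ (e : P.Crease) (A B : P.Face), A ≠ B → A.BoundedBy e.carrier → B.BoundedBy e.carrier →
    ∀ gA gB : Plane ≃ᵃⁱ[ℝ] Plane,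
      EqOn f gA (closure A.carrier) → EqOn f gB (closure B.carrier) →
      LinearMap.det (gA.linearIsometryEquiv.toLinearEquiv : Plane →ₗ[ℝ] Plane) *
        LinearMap.det (gB.linearIsometryEquiv.toLinearEquiv : Plane →ₗ[ℝ] Plane) < 0

/-- No face has a straight angle between one of its creases and another of its edges (in
particular no interior vertex merely subdivides a crease). -/
def NoStraightCorner : Prop :=
  ∀ (F : P.Face) (e : P.Crease) (e' : Set Plane), P.IsEdge e' → e' ≠ e.carrier →
    F.BoundedBy e.carrier → F.BoundedBy e' → (affineSpan ℝ e' : Set Plane) ≠ e.line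

end CreasePattern

/-! ### Flat folded states -/

/-- The faces `A` and `B` overlap in the folding. -/
def FaceOverlap {P : CreasePattern} (f : Plane → Plane) (A B : P.Face) : Prop :=
  (f '' A.carrier ∩ f '' B.carrier).Nonempty

/-- A layer ordering graph: an orientation of the overlap graph; `L A B` says that
`B` lies on top of `A`. -/
def IsLayerOrdering {P : CreasePattern} (f : Plane → Plane) (L : P.Face → P.Face → Prop) : Prop :=
  (∀ A B, L A B → A ≠ B ∧ FaceOverlap f A B) ∧
  ∀ A B, A ≠ B → FaceOverlap f A B → Xor (L A B) (L B A)

/-- The reduction of a directed graph: keep the edges `(A, B)` for which no further directed path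
leads from `A` to `B`. -/
def reducedGraph {α : Type*} (L : α → α → Prop) (A B : α) : Prop :=
  L A B ∧ ¬ ∃ C, Relation.TransGen L A C ∧ Relation.TransGen L C B

/-- A flat folded state: a crease pattern with convex interior faces, its flat mapping function
and an acyclic layer ordering, free from self-intersection: if a third face `C` strictly
intersects a crease between `A` and `B` in the folding, then no directed path of the reduced graph
from `A` to `B` visits `C`. -/
structure FlatFoldedState where
  pattern : CreasePattern
  fold : Plane → Plane
  layer : pattern.Face → pattern.Face → Prop
  convex : ∀ F : pattern.Face, Convex ℝ F.carrier
  isFlatMapping : pattern.IsFlatMapping fold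
  isLayerOrdering : IsLayerOrdering fold layer
  acyclic : ∀ A, ¬ Relation.TransGen layer A A
  no_self_intersection : ∀ (e : pattern.Crease) (A B C : pattern.Face),
    A.BoundedBy e.carrier → B.BoundedBy e.carrier → A ≠ B → C ≠ A → C ≠ B →
    (fold '' C.carrier ∩ fold '' e.carrier).Nonempty →
    ¬ (Relation.TransGen (reducedGraph layer) A C ∧ Relation.TransGen (reducedGraph layer) C B)

namespace FlatFoldedState

variable (S : FlatFoldedState)

/-- The reduced layer ordering graph. -/
def graph : S.pattern.Face → S.pattern.Face → Prop := reducedGraph S.layer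

/-- No crease and no boundary edge touches a crease from the inside: if `C` lies over `A` and under
`B`, where `A` and `B` are joined by the crease `e`, then in the folding no edge of `C` has a point
on `e` (ends of `e` excepted). -/
def NonWrapping : Prop :=
  ∀ (e : S.pattern.Crease) (A B C : S.pattern.Face),
    A.BoundedBy e.carrier → B.BoundedBy e.carrier → S.layer A C → S.layer C B →
    ∀ e' : Set Plane, S.pattern.IsEdge e' → C.BoundedBy e' →
      Disjoint (S.fold '' e') (S.fold '' (e.carrier \ S.pattern.vertices))

/-! ### Weights, crease widths and heights -/

/-- `S.PathWeight ω A B t`: some path from `A` to `B` in the reduced graph has weight sum `t`, where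
an edge counts positively when it is followed upwards and negatively when followed downwards. -/
inductive PathWeight (ω : S.pattern.Face → S.pattern.Face → ℝ) (A : S.pattern.Face) :
    S.pattern.Face → ℝ → Prop
  | refl : PathWeight ω A A 0
  | up {B C : S.pattern.Face} {t : ℝ} :
      PathWeight ω A B t → S.graph B C → PathWeight ω A C (t + ω B C)
  | down {B C : S.pattern.Face} {t : ℝ} :
      PathWeight ω A B t → S.graph C B → PathWeight ω A C (t - ω C B)

/-- A positive weight for each edge of the reduced graph such that all paths between
two given faces have the same weight sum. -/
structure WeightAssignment where
  weight : S.pattern.Face → S.pattern.Face → ℝ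
  pos : ∀ A B, S.graph A B → 0 < weight A B
  consistent : ∀ A B t t', S.PathWeight weight A B t → S.PathWeight weight A B t' → t = t'

variable {S}

/-- The width of a crease: the weight sum along a path from the lower one of its two incident faces
to the upper one.  (The set consists of this number, its negative and zero.) -/
noncomputable def WeightAssignment.width (ω : S.WeightAssignment) (e : S.pattern.Crease) : ℝ :=
  sSup {t | ∃ A B : S.pattern.Face, A.BoundedBy e.carrier ∧ B.BoundedBy e.carrier ∧
    S.PathWeight ω.weight A B t}

/-- Heights of the faces at scale one: two faces joined by a path are offset by
the weight sum of that path. -/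
def WeightAssignment.IsHeight (ω : S.WeightAssignment) (h : S.pattern.Face → ℝ) : Prop :=
  ∀ A B t, S.PathWeight ω.weight A B t → h B = h A + t

/-- Heights exist for every weight assignment. -/
theorem WeightAssignment.exists_isHeight (ω : S.WeightAssignment) : ∃ h, ω.IsHeight h := by
  have tr : ∀ A B C t u, S.PathWeight ω.weight A B t → S.PathWeight ω.weight B C u →
      S.PathWeight ω.weight A C (t + u) := by
    intro A B C t u h1 h2
    induction h2 with
    | refl => simpa using h1
    | up _ hg ih => rw [← add_assoc]; exact ih.up hg
    | down _ hg ih => rw [← add_sub_assoc]; exact ih.down hg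
  have sy : ∀ A B t, S.PathWeight ω.weight A B t → S.PathWeight ω.weight B A (-t) := by
    intro A B t h1
    induction h1 with
    | refl => simpa using PathWeight.refl
    | up _ hg ih =>
      have := tr _ _ _ _ _ (PathWeight.refl.down hg) ih
      convert this using 1; ring
    | down _ hg ih =>
      have := tr _ _ _ _ _ (PathWeight.refl.up hg) ih
      convert this using 1; ring
  let st : Setoid S.pattern.Face :=
    { r := fun A B => ∃ t, S.PathWeight ω.weight A B t
      iseqv := ⟨fun _ => ⟨0, .refl⟩, fun ⟨t, h⟩ => ⟨-t, sy _ _ _ h⟩,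
        fun ⟨t, h⟩ ⟨u, k⟩ => ⟨t + u, tr _ _ _ _ _ h k⟩⟩ }
  have key : ∀ A, ∃ t, S.PathWeight ω.weight (Quotient.out (Quotient.mk st A)) A t :=
    fun A => Quotient.mk_out (s := st) A
  choose h hh using key
  refine ⟨h, fun A B t hAB => ?_⟩
  have e : Quotient.mk st A = Quotient.mk st B := Quotient.sound (s := st) ⟨t, hAB⟩
  have hB := hh B
  rw [← e] at hB
  exact ω.consistent _ _ _ _ hB (tr _ _ _ _ _ (hh A) hAB)

/-! ### Vertex polygons -/

/-- The sector that the face `F` has at its vertex `v` (with `v` moved to the origin), cut off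
along the lines at half the crease width from the creases through `v`.  For two creases its apex is
the vertex, in the face `F`, of the vertex polygon at `v`. -/
def WeightAssignment.sector (ω : S.WeightAssignment) (F : S.pattern.Face) (v : Plane) : Set Plane :=
  {y | (∃ t : ℝ, 0 < t ∧ v + t • y ∈ closure F.carrier) ∧
    ∀ e : S.pattern.Crease, v ∈ e.carrier → F.BoundedBy e.carrier →
      ω.width e / 2 ≤ Metric.infDist (v + y) e.line}

variable (S)

/-- Trimming of the sectors: for every face and vertex finitely many half-planes
`{y | c ≤ ⟪n, y⟫}`. -/
abbrev Trimming : Type := S.pattern.Face → Plane → Finset (Plane × ℝ)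

variable {S}

/-- The trimmed sector: what the (refined) vertex polygon at `v` leaves of the sector. -/
def WeightAssignment.trimmedSector (ω : S.WeightAssignment) (c : S.Trimming)
    (F : S.pattern.Face) (v : Plane) : Set Plane :=
  {y ∈ ω.sector F v | ∀ p ∈ c F v, p.2 ≤ inner ℝ p.1 y}

/-! ### The construction at scale `s` -/

/-- The reduced face at scale `s`: at every vertex of the face only the trimmed sector, scaled by
`s`, is kept. -/
def WeightAssignment.reducedFace (ω : S.WeightAssignment) (c : S.Trimming) (s : ℝ)
    (F : S.pattern.Face) : Set Plane :=
  {x ∈ closure F.carrier | ∀ v ∈ S.pattern.vertices, v ∈ closure F.carrier →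
    ∃ y ∈ ω.trimmedSector c F v, x = v + s • y}

/-- The new crease replacing the crease `e` on the side of the incident face `F`: the side of the
reduced face on the line parallel to `e` at distance `s` times half the width. -/
def WeightAssignment.newCrease (ω : S.WeightAssignment) (c : S.Trimming) (s : ℝ)
    (e : S.pattern.Crease) (F : S.pattern.Face) : Set Plane :=
  {x ∈ ω.reducedFace c s F | Metric.infDist x e.line = s * (ω.width e / 2)}

variable (S)

/-- The faces of the thickened pattern: reduced faces and widened creases. -/
abbrev Piece : Type := S.pattern.Face ⊕ S.pattern.Crease

variable {S}

/-- The thickened crease pattern in the plane; a widened crease is spanned by its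
two new creases. -/
def WeightAssignment.flatPiece (ω : S.WeightAssignment) (c : S.Trimming) (s : ℝ) :
    S.Piece → Set Plane
  | Sum.inl F => ω.reducedFace c s F
  | Sum.inr e => convexHull ℝ
      {x | ∃ F : S.pattern.Face, F.BoundedBy e.carrier ∧ x ∈ ω.newCrease c s e F}

/-- The three-dimensional folded state: the reduced face `F` is folded and lifted to the height
`s * h F`; a widened crease becomes the vertical piece spanned by its two lifted new creases. -/
def WeightAssignment.foldedPiece (ω : S.WeightAssignment) (h : S.pattern.Face → ℝ) (c : S.Trimming)
    (s : ℝ) : S.Piece → Set Space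
  | Sum.inl F => (fun x => (S.fold x, s * h F)) '' ω.reducedFace c s F
  | Sum.inr e => convexHull ℝ
      {q | ∃ F : S.pattern.Face, F.BoundedBy e.carrier ∧
        ∃ x ∈ ω.newCrease c s e F, q = (S.fold x, s * h F)}

/-- The local picture of a family of sets at the point `z`: magnify by `1 / s` about `z`
and let `s` tend to zero. -/
def localPicture {V : Type*} [AddCommGroup V] [Module ℝ V] (z : V) (Q : ℝ → Set V) : Set V :=
  {y | ∀ᶠ s : ℝ in 𝓝[>] 0, z + s • y ∈ Q s}

/-- A refinement of the vertex polygons: only bounded parts of the sectors are trimmed away, and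
at every vertex the local picture is free of self-intersection, both in the plane (the
vertex polygons are weakly simple) and in the folded state. -/
structure WeightAssignment.IsRefinement (ω : S.WeightAssignment) (h : S.pattern.Face → ℝ)
    (c : S.Trimming) : Prop where
  bounded : ∀ (F : S.pattern.Face), ∀ v ∈ S.pattern.vertices, v ∈ closure F.carrier →
    Bornology.IsBounded (ω.sector F v \ ω.trimmedSector c F v)
  flat : ∀ v ∈ S.pattern.vertices, ∀ i j : S.Piece, i ≠ j →
    ¬ StrictlyIntersect (localPicture v fun s => ω.flatPiece c s i)
      (localPicture v fun s => ω.flatPiece c s j)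
  folded : ∀ v ∈ S.pattern.vertices, ∀ i j : S.Piece, i ≠ j →
    ¬ StrictlyIntersect (localPicture ((S.fold v, 0) : Space) fun s => ω.foldedPiece h c s i)
      (localPicture ((S.fold v, 0) : Space) fun s => ω.foldedPiece h c s j)

/-- At scale `s` the construction is a thickened crease pattern: every new crease has positive
length (the scaled vertex polygons do not run into each other), every reduced face has interior
points, and the pieces do not overlap in the plane. -/
structure WeightAssignment.IsThickening (ω : S.WeightAssignment) (c : S.Trimming) (s : ℝ) :
    Prop where
  crease : ∀ (e : S.pattern.Crease) (F : S.pattern.Face), F.BoundedBy e.carrier →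
    (ω.newCrease c s e F).Nontrivial
  face : ∀ F : S.pattern.Face, (interior (ω.reducedFace c s F)).Nonempty
  flat : ∀ i j : S.Piece, i ≠ j → ¬ StrictlyIntersect (ω.flatPiece c s i) (ω.flatPiece c s j)

end FlatFoldedState

open FlatFoldedState


/-! ### Relative interiors: prolongation, homothety, horizontal slices. -/

section Relint
variable {V : Type*} [NormedAddCommGroup V] [NormedSpace ℝ V]

/-! Every piece is cut out by data in a fixed position (faces, crease lines, vertices) together with
offsets proportional to the scale `s`. Near a point `z` a change of scale therefore acts as a
homothety: for small `s`, whether `z + s • y` belongs to the piece does not depend on `s`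
(`ConicAt`). A strict intersection near a vertex is then already a strict intersection of local
pictures (`ConicWithin.strictlyIntersect_localPicture`), and a refinement excludes those. It remains
to separate the pieces at a fixed distance from the vertices, uniformly for small `s`.

Away from the vertices the trimming is irrelevant, and the pieces lie in the sets `outFlat` and
`outFolded`. In the plane, the inner parts of distinct creases are disjoint and meet only the
closures of their own two faces; compactness gives a positive distance, which widths of order `s`
cannot bridge. In the folded state, overlapping faces have different heights, and the relative
interior of a widened crease lies strictly between the heights of its two faces. If a face or
another crease stays at positive distance from the inner part of the folded crease, small scales are
harmless. Otherwise a meeting point lies under the images of the faces concerned, so these overlap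
and the heights orient them. Some face then lies strictly between the two faces of a crease, and
flat-foldedness together with non-wrapping forces exactly the disjointness that was assumed to fail
(`disjoint_face`, `disjoint_crease`). Thus `disjoint_outFlat` and `disjoint_outFolded` hold for
small `s`, and `exists_scale_of_localPicture` combines the two regimes.

A refinement is found by reading the same argument backwards (`exists_trimming_scale`). Each sector
incident to a crease is cut by one half-plane so that only points of norm at least `1 / ε` remain
(`exists_farTrimming`). If two local pictures at `z` met strictly at `y`, put `y` back at the scale
`ρ / max (μ y) (1 / ε)`, where `μ` is the norm of the planar part. This scale is at most `ρ * ε`,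
hence small, while on a crease the point lands at parameter distance at least `ρ / 2` from both
ends. Both pieces would then meet in their separated parts.

The absence of straight corners makes the angle of a face at the end of a crease less than `π`
(`exists_cone_bound`) and keeps the other crease lines of the face away from the inner part of the
crease (`exists_infDist_crease_ge`). Hence a new crease is a segment whose ends are displaced
proportionally to `s` (`exists_offset_iff`), and a widened crease is a strip, flat in the plane and
vertical in the folding (`exists_piece_eq_strip`). -/

theorem mem_intrinsicInterior_iff_dist {X : Set V} {x : V} :
    x ∈ intrinsicInterior ℝ X ↔
      x ∈ X ∧ ∃ ε > 0, ∀ y ∈ affineSpan ℝ X, dist y x < ε → y ∈ X := by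
  rw [mem_intrinsicInterior]
  constructor
  · rintro ⟨y, hy, rfl⟩
    refine ⟨(interior_subset hy :), ?_⟩
    rw [mem_interior_iff_mem_nhds, Metric.mem_nhds_iff] at hy
    obtain ⟨ε, hε, hb⟩ := hy
    exact ⟨ε, hε, fun z hz hd => hb (show (⟨z, hz⟩ : affineSpan ℝ X) ∈ Metric.ball y ε from hd)⟩
  · rintro ⟨hx, ε, hε, hb⟩
    refine ⟨⟨x, subset_affineSpan _ _ hx⟩, ?_, rfl⟩
    rw [mem_interior_iff_mem_nhds, Metric.mem_nhds_iff]
    exact ⟨ε, hε, fun z hz => hb z z.2 hz⟩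

theorem exists_extend_of_mem_intrinsicInterior {X : Set V} {x y : V}
    (hx : x ∈ intrinsicInterior ℝ X) (hy : y ∈ X) : ∃ ε > (0 : ℝ), x + ε • (x - y) ∈ X := by
  obtain ⟨hxX, ε, hε, hb⟩ := mem_intrinsicInterior_iff_dist.1 hx
  have hpos : 0 < ‖x - y‖ + 1 := by positivity
  -- The summand `1` covers the case `x = y`.
  refine ⟨ε / (‖x - y‖ + 1), by positivity, hb _ ?_ ?_⟩
  · have := (affineSpan ℝ X).smul_vsub_vadd_mem (ε / (‖x - y‖ + 1))
      (subset_affineSpan ℝ _ hxX) (subset_affineSpan ℝ _ hy) (subset_affineSpan ℝ _ hxX)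
    simpa [add_comm] using this
  · rw [dist_eq_norm, add_sub_cancel_left, norm_smul, Real.norm_of_nonneg (by positivity),
      div_mul_eq_mul_div, div_lt_iff₀ hpos]
    nlinarith

/-- A linear functional does not attain its minimum at a relative interior point. -/
theorem lt_of_mem_intrinsicInterior {X : Set V} {x y : V} (φ : V →ₗ[ℝ] ℝ) {m : ℝ}
    (hx : x ∈ intrinsicInterior ℝ X) (hX : ∀ z ∈ X, m ≤ φ z) (hy : y ∈ X) (hm : m < φ y) :
    m < φ x := by
  obtain ⟨ε, hε, h⟩ := exists_extend_of_mem_intrinsicInterior hx hy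
  have := hX _ h
  simp only [map_add, map_smul, map_sub, smul_eq_mul] at this
  nlinarith

theorem intrinsicInterior_eq_interior_of_nonempty {X : Set V} (h : (interior X).Nonempty) :
    intrinsicInterior ℝ X = interior X := by
  have hs : affineSpan ℝ X = ⊤ := by
    rw [eq_top_iff, ← isOpen_interior.affineSpan_eq_top h]
    exact affineSpan_mono _ interior_subset
  ext x
  rw [mem_intrinsicInterior_iff_dist, mem_interior_iff_mem_nhds, Metric.mem_nhds_iff]
  constructor
  · rintro ⟨_, ε, hε, hb⟩
    exact ⟨ε, hε, fun y hy => hb y (by simp [hs]) hy⟩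
  · rintro ⟨ε, hε, hb⟩
    exact ⟨hb (Metric.mem_ball_self hε), ε, hε, fun y _ hy => hb hy⟩

/-- The two sets are homothetic only inside a ball, yet relative interiors depend on the whole
affine span. Convexity of `Y` bridges this: any point of `Y` can be pulled towards `y₀` into the
ball without changing the line through `y₀`, so the span of `Y` is already visible there. -/
theorem intrinsicInterior_of_homothetic {X Y : Set V} {z y₀ : V} {s r : ℝ} (hs : 0 < s)
    (hY : Convex ℝ Y) (h : ∀ y, ‖s • y‖ < r → (y ∈ Y ↔ z + s • y ∈ X))
    (hx : z + s • y₀ ∈ intrinsicInterior ℝ X) (hr : ‖s • y₀‖ < r) :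
    y₀ ∈ intrinsicInterior ℝ Y := by
  obtain ⟨hxX, ε, hε, hb⟩ := mem_intrinsicInterior_iff_dist.1 hx
  have hyY : y₀ ∈ Y := (h y₀ hr).2 hxX
  have hopen : IsOpen {y : V | ‖s • y‖ < r} := isOpen_lt (by fun_prop) continuous_const
  have hspan : ∀ y ∈ affineSpan ℝ Y, z + s • y ∈ affineSpan ℝ X := by
    let φ : V →ᵃ[ℝ] V := AffineMap.const ℝ V z + (s • (LinearMap.id : V →ₗ[ℝ] V)).toAffineMap
    have hφ : ∀ y, φ y = z + s • y := fun y => by simp [φ]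
    have : affineSpan ℝ Y ≤ (affineSpan ℝ X).comap φ := by
      rw [affineSpan_le]
      intro y hy
      rw [AffineSubspace.coe_comap, mem_preimage, hφ]
      have hcont : Tendsto (fun θ : ℝ => y₀ + θ • (y - y₀)) (𝓝[>] 0) (𝓝 y₀) := by
        have : Continuous (fun θ : ℝ => y₀ + θ • (y - y₀)) := by fun_prop
        simpa using (this.tendsto 0).mono_left nhdsWithin_le_nhds
      have h1 : ∀ᶠ θ : ℝ in 𝓝[>] 0, ‖s • (y₀ + θ • (y - y₀))‖ < r :=
        hcont.eventually (hopen.mem_nhds hr)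
      have h2 : ∀ᶠ θ : ℝ in 𝓝[>] 0, θ ∈ Ioo (0 : ℝ) 1 := Ioo_mem_nhdsGT zero_lt_one
      obtain ⟨θ, hθ1, hθ2⟩ := (h1.and h2).exists
      have hmem : z + s • (y₀ + θ • (y - y₀)) ∈ X :=
        (h _ hθ1).1 (hY.add_smul_sub_mem hyY hy ⟨hθ2.1.le, hθ2.2.le⟩)
      -- Undo the pull: prolonging by `θ⁻¹` within the affine span returns to the image of `y`.
      have := AffineMap.lineMap_mem (Q := affineSpan ℝ X) θ⁻¹ (subset_affineSpan ℝ _ hxX)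
        (subset_affineSpan ℝ _ hmem)
      have hθ : θ ≠ 0 := hθ2.1.ne'
      have he : AffineMap.lineMap (z + s • y₀) (z + s • (y₀ + θ • (y - y₀))) θ⁻¹ = z + s • y := by
        rw [AffineMap.lineMap_apply, vsub_eq_sub, vadd_eq_add]
        match_scalars <;> field_simp <;> ring
      rwa [he] at this
    intro y hy
    have := this hy
    rwa [← SetLike.mem_coe, AffineSubspace.coe_comap, mem_preimage, hφ] at this
  rw [mem_intrinsicInterior_iff_dist]
  refine ⟨hyY, ?_⟩
  obtain ⟨ε', hε', hb'⟩ := Metric.isOpen_iff.1 hopen y₀ hr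
  refine ⟨min ε' (ε / s), by positivity, fun y hy hd => ?_⟩
  rw [h y (hb' (hd.trans_le (min_le_left _ _)))]
  refine hb _ (hspan y hy) ?_
  rw [dist_add_left, dist_eq_norm, ← smul_sub, norm_smul, Real.norm_of_nonneg hs.le,
    ← dist_eq_norm, mul_comm, ← lt_div_iff₀ hs]
  exact hd.trans_le (min_le_right _ _)

/-- The relative interior of a fat horizontal slice. -/
theorem mem_interior_of_mem_intrinsicInterior_slice {X : Set V} {k : ℝ} {q : V × ℝ}
    (hX : (interior X).Nonempty) (hq : q ∈ intrinsicInterior ℝ (X ×ˢ {k})) :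
    q.1 ∈ interior X ∧ q.2 = k := by
  obtain ⟨hqX, ε, hε, hb⟩ := mem_intrinsicInterior_iff_dist.1 hq
  have hk : q.2 = k := hqX.2
  refine ⟨?_, hk⟩
  have hs : affineSpan ℝ X = ⊤ := by
    rw [eq_top_iff, ← isOpen_interior.affineSpan_eq_top hX]
    exact affineSpan_mono _ interior_subset
  let φ : V →ᵃ[ℝ] V × ℝ := AffineMap.prod (AffineMap.id ℝ V) (AffineMap.const ℝ V k)
  have hle : affineSpan ℝ X ≤ (affineSpan ℝ (X ×ˢ {k})).comap φ := by
    rw [affineSpan_le]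
    intro x hx
    exact subset_affineSpan ℝ _ (show (x, k) ∈ X ×ˢ {k} from ⟨hx, rfl⟩)
  rw [mem_interior_iff_mem_nhds, Metric.mem_nhds_iff]
  refine ⟨ε, hε, fun y hy => ?_⟩
  have h1 : (y, k) ∈ affineSpan ℝ (X ×ˢ {k}) := hle (show y ∈ affineSpan ℝ X by simp [hs])
  have h2 : dist (y, k) q < ε := by
    rw [Prod.dist_eq, hk, dist_self]; exact max_lt hy hε
  exact (hb _ h1 h2).1

end Relint

/-! ### Conic families and their local pictures. -/

section Conic
variable {V : Type*} [NormedAddCommGroup V] [NormedSpace ℝ V]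

/-- Up to the radius `r`, the family `Q` is its own magnification about `z`. -/
def ConicWithin (r : ℝ) (z : V) (Q : ℝ → Set V) : Prop :=
  ∀ s s' y, 0 < s → s < r → 0 < s' → s' < r → ‖s • y‖ < r → ‖s' • y‖ < r →
    z + s • y ∈ Q s → z + s' • y ∈ Q s'

/-- The family `Q` is its own magnification near `z`. -/
def ConicAt (z : V) (Q : ℝ → Set V) : Prop := ∃ r > 0, ConicWithin r z Q

theorem ConicWithin.mono {r r' : ℝ} {z : V} {Q : ℝ → Set V} (h : ConicWithin r z Q)
    (hr : r' ≤ r) : ConicWithin r' z Q :=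
  fun s s' y h1 h2 h3 h4 h5 h6 =>
    h s s' y h1 (h2.trans_le hr) h3 (h4.trans_le hr) (h5.trans_le hr) (h6.trans_le hr)

theorem ConicAt.inter {z : V} {Q R : ℝ → Set V} (hQ : ConicAt z Q) (hR : ConicAt z R) :
    ConicAt z fun s => Q s ∩ R s := by
  obtain ⟨r, hr, h⟩ := hQ
  obtain ⟨r', hr', h'⟩ := hR
  refine ⟨min r r', lt_min hr hr', fun s s' y h1 h2 h3 h4 h5 h6 hy => ⟨?_, ?_⟩⟩
  · exact h.mono (min_le_left _ _) s s' y h1 h2 h3 h4 h5 h6 hy.1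
  · exact h'.mono (min_le_right _ _) s s' y h1 h2 h3 h4 h5 h6 hy.2

/-- Thresholds that may be lowered have a common positive value when there are finitely many. All
uniform choices of radius, scale and distance are made in this way. -/
theorem exists_pos_forall_of_finite {ι : Type*} [Finite ι] {p : ι → ℝ → Prop}
    (hp : ∀ i r r', r' ≤ r → p i r → p i r') (h : ∀ i, ∃ r > 0, p i r) :
    ∃ r > 0, ∀ i, p i r := by
  cases nonempty_fintype ι
  choose r hr hpr using h
  rcases isEmpty_or_nonempty ι with he | he
  · exact ⟨1, one_pos, fun i => he.elim i⟩
  · refine ⟨Finset.univ.inf' Finset.univ_nonempty r, ?_, fun i => ?_⟩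
    · simpa [Finset.lt_inf'_iff] using hr
    · exact hp i _ _ (Finset.inf'_le _ (Finset.mem_univ i)) (hpr i)

theorem ConicAt.iInter {ι : Type*} [Finite ι] {z : V} {Q : ι → ℝ → Set V}
    (hQ : ∀ i, ConicAt z (Q i)) : ConicAt z fun s => {x | ∀ i, x ∈ Q i s} := by
  obtain ⟨r, hr, h⟩ := exists_pos_forall_of_finite
    (p := fun i r => ConicWithin r z (Q i)) (fun i r r' hle h => h.mono hle) hQ
  exact ⟨r, hr, fun s s' y h1 h2 h3 h4 h5 h6 hy i => h i s s' y h1 h2 h3 h4 h5 h6 (hy i)⟩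

theorem ConicAt.congr {z : V} {Q R : ℝ → Set V} {r : ℝ} (hr : 0 < r) (hQ : ConicAt z Q)
    (h : ∀ s, 0 < s → s < r → Q s = R s) : ConicAt z R := by
  obtain ⟨r', hr', hc⟩ := hQ
  refine ⟨min r r', lt_min hr hr', fun s s' y h1 h2 h3 h4 h5 h6 hy => ?_⟩
  rw [← h s h1 (h2.trans_le (min_le_left _ _))] at hy
  rw [← h s' h3 (h4.trans_le (min_le_left _ _))]
  exact hc.mono (min_le_right _ _) s s' y h1 h2 h3 h4 h5 h6 hy

theorem ConicAt.of_eventually_notMem {z : V} {Q : ℝ → Set V} {r : ℝ} (hr : 0 < r)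
    (h : ∀ s x, 0 < s → s < r → ‖x - z‖ < r → x ∉ Q s) : ConicAt z Q :=
  ⟨r, hr, fun s _ y h1 h2 _ _ h5 _ hy => (h s _ h1 h2 (by simpa using h5) hy).elim⟩

theorem ConicAt.of_eventually_mem {z : V} {Q : ℝ → Set V} {r : ℝ} (hr : 0 < r)
    (h : ∀ s x, 0 < s → s < r → ‖x - z‖ < r → x ∈ Q s) : ConicAt z Q :=
  ⟨r, hr, fun _ s' y _ _ h3 h4 _ h6 _ => h s' _ h3 h4 (by simpa using h6)⟩

theorem eventually_small (y : V) {r : ℝ} (hr : 0 < r) :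
    ∀ᶠ s : ℝ in 𝓝[>] 0, 0 < s ∧ s < r ∧ ‖s • y‖ < r := by
  have h1 : ∀ᶠ t : ℝ in 𝓝[>] 0, t ∈ Ioo 0 r := Ioo_mem_nhdsGT hr
  have hc : Continuous fun t : ℝ => ‖t • y‖ := by fun_prop
  have h2 : Tendsto (fun t : ℝ => ‖t • y‖) (𝓝[>] 0) (𝓝 0) := by
    simpa using (hc.tendsto 0).mono_left nhdsWithin_le_nhds
  filter_upwards [h1, h2.eventually_lt_const hr] with t ht1 ht2 using ⟨ht1.1, ht1.2, ht2⟩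

/-- Local pictures are defined by an eventual condition; for a conic family any single small scale
already decides it. -/
theorem ConicWithin.mem_localPicture_iff {r s : ℝ} {z y : V} {Q : ℝ → Set V}
    (h : ConicWithin r z Q) (hs : 0 < s) (hsr : s < r) (hy : ‖s • y‖ < r) :
    y ∈ localPicture z Q ↔ z + s • y ∈ Q s := by
  have hr : 0 < r := hs.trans hsr
  have hev := eventually_small y hr
  constructor
  · intro hy'
    have hy'' : ∀ᶠ t : ℝ in 𝓝[>] 0, z + t • y ∈ Q t := hy'
    obtain ⟨t, ht, h1, h2, h3⟩ := (hy''.and hev).exists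
    exact h t s y h1 h2 hs hsr h3 hy ht
  · intro hm
    exact hev.mono fun t ht => h s t y hs hsr ht.1 ht.2.1 hy ht.2.2 hm

theorem convex_localPicture {z : V} {Q : ℝ → Set V} {r : ℝ} (hr : 0 < r)
    (h : ∀ s, 0 < s → s < r → Convex ℝ (Q s)) : Convex ℝ (localPicture z Q) := by
  intro x hx y hy a b ha hb hab
  have hI : ∀ᶠ t : ℝ in 𝓝[>] 0, t ∈ Ioo 0 r := Ioo_mem_nhdsGT hr
  filter_upwards [hx, hy, hI] with t h1 h2 h3
  have := h t h3.1 h3.2 h1 h2 ha hb hab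
  convert this using 1
  have hz : z = a • z + b • z := by rw [← add_smul, hab, one_smul]
  nth_rewrite 1 [hz]
  module

theorem localPicture_mono {z : V} {Q R : ℝ → Set V} {r : ℝ} (hr : 0 < r)
    (h : ∀ s, 0 < s → s < r → Q s ⊆ R s) : localPicture z Q ⊆ localPicture z R := by
  intro y hy
  have hI : ∀ᶠ t : ℝ in 𝓝[>] 0, t ∈ Ioo 0 r := Ioo_mem_nhdsGT hr
  filter_upwards [hy, hI] with t h1 h3 using h t h3.1 h3.2 h1

/-- Near `z`, strict intersections are visible in the local pictures. -/
theorem ConicWithin.strictlyIntersect_localPicture {r s : ℝ} {z x : V} {Q R : ℝ → Set V}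
    (hQ : ConicWithin r z Q) (hR : ConicWithin r z R)
    (cQ : ∀ s, 0 < s → s < r → Convex ℝ (Q s)) (cR : ∀ s, 0 < s → s < r → Convex ℝ (R s))
    (hs : 0 < s) (hsr : s < r) (hxQ : x ∈ intrinsicInterior ℝ (Q s))
    (hxR : x ∈ intrinsicInterior ℝ (R s)) (hx : ‖x - z‖ < r) :
    StrictlyIntersect (localPicture z Q) (localPicture z R) := by
  have hr : 0 < r := hs.trans hsr
  have he : x = z + s • (s⁻¹ • (x - z)) := by
    rw [smul_smul, mul_inv_cancel₀ hs.ne', one_smul, add_sub_cancel]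
  have hn : ‖s • (s⁻¹ • (x - z))‖ < r := by
    rwa [smul_smul, mul_inv_cancel₀ hs.ne', one_smul]
  rw [he] at hxQ hxR
  exact ⟨s⁻¹ • (x - z),
    intrinsicInterior_of_homothetic hs (convex_localPicture hr cQ)
      (fun y hy => hQ.mem_localPicture_iff hs hsr hy) hxQ hn,
    intrinsicInterior_of_homothetic hs (convex_localPicture hr cR)
      (fun y hy => hR.mem_localPicture_iff hs hsr hy) hxR hn⟩

end Conic


/-! ### Orthonormal frames and coordinates along an edge. -/

/-- An orthonormal frame of the plane. -/
structure IsFrame (d n : Plane) : Prop where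
  dd : inner ℝ d d = (1 : ℝ)
  nn : inner ℝ n n = (1 : ℝ)
  dn : inner ℝ d n = (0 : ℝ)
  decomp : ∀ y : Plane, y = (inner ℝ d y : ℝ) • d + (inner ℝ n y : ℝ) • n

namespace IsFrame
variable {d n : Plane} (h : IsFrame d n)
include h

theorem nd : inner ℝ n d = (0 : ℝ) := by rw [real_inner_comm, h.dn]

theorem neg_left : IsFrame (-d) n where
  dd := by rw [inner_neg_neg, h.dd]
  nn := h.nn
  dn := by simp [h.dn]
  decomp y := by simpa using h.decomp y

theorem neg_right : IsFrame d (-n) where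
  dd := h.dd
  nn := by rw [inner_neg_neg, h.nn]
  dn := by simp [h.dn]
  decomp y := by simpa using h.decomp y

theorem inner_d (a b : ℝ) : inner ℝ d (a • d + b • n) = a := by
  rw [inner_add_right, inner_smul_right, inner_smul_right, h.dn, h.dd]; ring

theorem inner_n (a b : ℝ) : inner ℝ n (a • d + b • n) = b := by
  rw [inner_add_right, inner_smul_right, inner_smul_right, h.nd, h.nn]; ring

theorem norm_d : ‖d‖ = 1 := by
  have := real_inner_self_eq_norm_sq d
  rw [h.dd] at this
  nlinarith [norm_nonneg d]

theorem norm_n : ‖n‖ = 1 := by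
  have := real_inner_self_eq_norm_sq n
  rw [h.nn] at this
  nlinarith [norm_nonneg n]

theorem abs_le_norm (a b : ℝ) : |a| ≤ ‖a • d + b • n‖ := by
  have := abs_real_inner_le_norm d (a • d + b • n)
  rwa [h.inner_d, h.norm_d, one_mul] at this

theorem abs_le_norm' (a b : ℝ) : |b| ≤ ‖a • d + b • n‖ := by
  have := abs_real_inner_le_norm n (a • d + b • n)
  rwa [h.inner_n, h.norm_n, one_mul] at this

theorem norm_le (a b : ℝ) : ‖a • d + b • n‖ ≤ |a| + |b| := by
  refine (norm_add_le _ _).trans ?_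
  simp [norm_smul, h.norm_d, h.norm_n]

theorem ext {a b a' b' : ℝ} (he : a • d + b • n = a' • d + b' • n) : a = a' ∧ b = b' :=
  ⟨by rw [← h.inner_d a b, he, h.inner_d], by rw [← h.inner_n a b, he, h.inner_n]⟩

theorem exists_coord (u x : Plane) : ∃ a b : ℝ, x = u + a • d + b • n :=
  ⟨_, _, by rw [add_assoc, ← h.decomp (x - u), add_sub_cancel]⟩

theorem inner_coord (u : Plane) (a b : ℝ) : inner ℝ n (u + a • d + b • n - u) = b := by
  rw [show u + a • d + b • n - u = a • d + b • n by module, h.inner_n]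

end IsFrame

theorem exists_isFrame {d : Plane} (hd : ‖d‖ = 1) : ∃ n, IsFrame d n := by
  have h1 : d 0 ^ 2 + d 1 ^ 2 = 1 := by
    have := real_inner_self_eq_norm_sq d
    rw [hd, PiLp.inner_apply, Fin.sum_univ_two] at this
    simpa using this
  refine ⟨!₂[-d 1, d 0], ?_, ?_, ?_, fun y => ?_⟩
  · rw [PiLp.inner_apply, Fin.sum_univ_two]; simpa using h1
  · rw [PiLp.inner_apply, Fin.sum_univ_two]; simp; linarith
  · rw [PiLp.inner_apply, Fin.sum_univ_two]; simp; ring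
  · ext i
    fin_cases i
    · simp [PiLp.inner_apply, Fin.sum_univ_two]
      linear_combination (-y 0) * h1
    · simp [PiLp.inner_apply, Fin.sum_univ_two]
      linear_combination (-y 1) * h1

/-- An edge in coordinates, with a set on its positive side. -/
structure SideFrame (e F : Set Plane) (u d n : Plane) (L : ℝ) : Prop extends IsFrame d n where
  posL : 0 < L
  carrier : e = segment ℝ u (u + L • d)
  pos : ∀ x ∈ F, (0 : ℝ) < inner ℝ n (x - u)

theorem mem_segment_iff_coord {u d x : Plane} {L : ℝ} (hL : 0 < L) :
    x ∈ segment ℝ u (u + L • d) ↔ ∃ t, 0 ≤ t ∧ t ≤ L ∧ x = u + t • d := by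
  rw [segment_eq_image']
  constructor
  · rintro ⟨θ, ⟨h0, h1⟩, rfl⟩
    refine ⟨θ * L, by positivity, by nlinarith, by simp [smul_smul]⟩
  · rintro ⟨t, h0, h1, rfl⟩
    refine ⟨t / L, ⟨by positivity, (div_le_one hL).2 h1⟩, ?_⟩
    simp [smul_smul, div_mul_cancel₀ _ hL.ne']

theorem exists_dir {a b : Plane} (h : a ≠ b) : ∃ (d : Plane) (L : ℝ), ‖d‖ = 1 ∧ 0 < L ∧ b = a + L • d := by
  have h0 : 0 < ‖b - a‖ := norm_pos_iff.2 (sub_ne_zero.2 h.symm)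
  refine ⟨‖b - a‖⁻¹ • (b - a), ‖b - a‖, ?_, h0, ?_⟩
  · rw [norm_smul, norm_inv, norm_norm, inv_mul_cancel₀ h0.ne']
  · rw [smul_smul, mul_inv_cancel₀ h0.ne', one_smul, add_sub_cancel]

theorem mem_affineSpan_segment_iff {u d x : Plane} {L : ℝ} (hL : 0 < L) :
    x ∈ affineSpan ℝ (segment ℝ u (u + L • d)) ↔ ∃ t : ℝ, x = u + t • d := by
  rw [← convexHull_pair, affineSpan_convexHull, mem_affineSpan_pair_iff_exists_lineMap_eq]
  constructor
  · rintro ⟨r, rfl⟩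
    exact ⟨r * L, by simp [AffineMap.lineMap_apply, smul_smul, add_comm]⟩
  · rintro ⟨t, rfl⟩
    exact ⟨t / L, by simp [AffineMap.lineMap_apply, smul_smul, add_comm, div_mul_cancel₀ _ hL.ne']⟩

theorem IsFrame.mem_affineSpan_iff {u d n x : Plane} {L : ℝ} (h : IsFrame d n) (hL : 0 < L) :
    x ∈ affineSpan ℝ (segment ℝ u (u + L • d)) ↔ inner ℝ n (x - u) = (0 : ℝ) := by
  rw [mem_affineSpan_segment_iff hL]
  constructor
  · rintro ⟨t, rfl⟩
    simp [inner_smul_right, h.nd]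
  · intro hx
    obtain ⟨a, b, rfl⟩ := h.exists_coord u x
    rw [h.inner_coord] at hx
    exact ⟨a, by simp [hx]⟩

theorem IsFrame.infDist_eq {u d n : Plane} {L : ℝ} (h : IsFrame d n) (hL : 0 < L) (x : Plane) :
    Metric.infDist x (affineSpan ℝ (segment ℝ u (u + L • d)) : Set Plane) =
      |(inner ℝ n (x - u) : ℝ)| := by
  obtain ⟨a, b, rfl⟩ := h.exists_coord u x
  rw [h.inner_coord]
  have hmem : u + a • d ∈ (affineSpan ℝ (segment ℝ u (u + L • d)) : Set Plane) :=
    (mem_affineSpan_segment_iff hL).2 ⟨a, rfl⟩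
  apply le_antisymm
  · refine (Metric.infDist_le_dist_of_mem hmem).trans ?_
    rw [dist_eq_norm, add_sub_cancel_left, norm_smul, h.norm_n, mul_one, Real.norm_eq_abs]
  · rw [Metric.le_infDist ⟨_, hmem⟩]
    intro y hy
    obtain ⟨t, rfl⟩ := (mem_affineSpan_segment_iff hL).1 hy
    rw [dist_eq_norm, show u + a • d + b • n - (u + t • d) = (a - t) • d + b • n by module]
    exact h.abs_le_norm' _ _

namespace SideFrame
variable {e F : Set Plane} {u d n : Plane} {L : ℝ} (h : SideFrame e F u d n L)
include h

/-- Exchanging the two ends keeps the normal and the side, so statements about the start `u`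
transfer to the other end. -/
theorem reverse : SideFrame e F (u + L • d) (-d) n L where
  toIsFrame := h.toIsFrame.neg_left
  posL := h.posL
  carrier := by rw [h.carrier, segment_symm]; simp
  pos x hx := by
    have := h.pos x hx
    rwa [show x - (u + L • d) = (x - u) - L • d by module, inner_sub_right, inner_smul_right,
      h.nd, mul_zero, sub_zero]

theorem mem_iff {x : Plane} : x ∈ e ↔ ∃ t, 0 ≤ t ∧ t ≤ L ∧ x = u + t • d := by
  rw [h.carrier, mem_segment_iff_coord h.posL]

theorem infDist_line (x : Plane) :
    Metric.infDist x (affineSpan ℝ e : Set Plane) = |(inner ℝ n (x - u) : ℝ)| := by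
  rw [h.carrier, h.infDist_eq h.posL]

theorem mem_line_iff {x : Plane} :
    x ∈ (affineSpan ℝ e : Set Plane) ↔ inner ℝ n (x - u) = (0 : ℝ) := by
  rw [h.carrier]; exact h.mem_affineSpan_iff h.posL

theorem closure_nonneg {x : Plane} (hx : x ∈ closure F) : (0 : ℝ) ≤ inner ℝ n (x - u) := by
  have hc : IsClosed {x : Plane | (0 : ℝ) ≤ inner ℝ n (x - u)} :=
    isClosed_le continuous_const (by fun_prop)
  exact closure_minimal (fun x hx => (h.pos x hx).le) hc hx

theorem infDist_of_mem_closure {x : Plane} (hx : x ∈ closure F) :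
    Metric.infDist x (affineSpan ℝ e : Set Plane) = inner ℝ n (x - u) := by
  rw [h.infDist_line, abs_of_nonneg (h.closure_nonneg hx)]

theorem start_mem : u ∈ e := h.mem_iff.2 ⟨0, le_rfl, h.posL.le, by simp⟩

theorem end_mem : u + L • d ∈ e := h.mem_iff.2 ⟨L, h.posL.le, le_rfl, rfl⟩

end SideFrame


/-! ### Sets that are conic at every point: closures and segments. -/

section ConicSets
variable {V : Type*} [NormedAddCommGroup V] [NormedSpace ℝ V]

theorem ConicAt.iUnion {ι : Type*} [Finite ι] {z : V} {Q : ι → ℝ → Set V}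
    (hQ : ∀ i, ConicAt z (Q i)) : ConicAt z fun s => {x | ∃ i, x ∈ Q i s} := by
  obtain ⟨r, hr, h⟩ := exists_pos_forall_of_finite
    (p := fun i r => ConicWithin r z (Q i)) (fun i r r' hle h => h.mono hle) hQ
  exact ⟨r, hr, fun s s' y h1 h2 h3 h4 h5 h6 ⟨i, hy⟩ => ⟨i, h i s s' y h1 h2 h3 h4 h5 h6 hy⟩⟩

/-- The homothety about `z` with ratio `s' / s` is continuous and sends the part of `X` near `z`
into `X`; points of the closure follow by continuity, after restriction to the open set where both
radii are below `r`. -/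
theorem ConicAt.closure {z : V} {X : Set V} (h : ConicAt z fun _ => X) :
    ConicAt z fun _ => closure X := by
  obtain ⟨r, hr, hc⟩ := h
  refine ⟨r, hr, fun s s' y h1 h2 h3 h4 h5 h6 hy => ?_⟩
  let φ : V → V := fun x => z + (s' / s) • (x - z)
  have hφ : Continuous φ := by fun_prop
  have hO1 : IsOpen {x : V | ‖x - z‖ < r} := isOpen_lt (by fun_prop) continuous_const
  have hO2 : IsOpen {x : V | ‖φ x - z‖ < r} := isOpen_lt (by fun_prop) continuous_const
  have hO : IsOpen {x : V | ‖x - z‖ < r ∧ ‖φ x - z‖ < r} := hO1.inter hO2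
  have e1 : φ (z + s • y) = z + s' • y := by
    simp only [φ, add_sub_cancel_left, smul_smul, div_mul_cancel₀ _ h1.ne']
  have hmem : z + s • y ∈ {x : V | ‖x - z‖ < r ∧ ‖φ x - z‖ < r} := by
    refine ⟨by simpa using h5, ?_⟩
    rw [e1]; simpa using h6
  have hcl : z + s • y ∈ _root_.closure ({x : V | ‖x - z‖ < r ∧ ‖φ x - z‖ < r} ∩ X) :=
    hO.inter_closure ⟨hmem, hy⟩
  rw [← e1]
  refine map_mem_closure hφ hcl ?_
  rintro x ⟨⟨hx1, hx2⟩, hxX⟩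
  have e2 : s • (s⁻¹ • (x - z)) = x - z := by
    rw [smul_smul, mul_inv_cancel₀ h1.ne', one_smul]
  have e3 : s' • (s⁻¹ • (x - z)) = φ x - z := by
    simp only [φ, add_sub_cancel_left, smul_smul, div_eq_mul_inv]
  have := hc s s' (s⁻¹ • (x - z)) h1 h2 h3 h4 (by rwa [e2]) (by rwa [e3])
    (by rw [e2]; simpa using hxX)
  rw [e3] at this
  simpa using this

end ConicSets

theorem conicAt_segment (a b z : Plane) : ConicAt z fun _ => segment ℝ a b := by
  by_cases hz : z ∈ segment ℝ a b
  swap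
  · have hcl : IsClosed (segment ℝ a b) := by
      rw [← convexHull_pair]
      exact (Set.toFinite {a, b}).isClosed_convexHull ℝ
    obtain ⟨r, hr, hb⟩ := Metric.isOpen_iff.1 hcl.isOpen_compl z hz
    exact ConicAt.of_eventually_notMem hr fun s x _ _ hx => hb (by simpa [dist_eq_norm] using hx)
  rcases eq_or_ne a b with rfl | hab
  · simp only [segment_same, mem_singleton_iff] at hz ⊢
    subst hz
    refine ⟨1, one_pos, fun s s' y h1 _ _ _ _ _ hy => ?_⟩
    have : y = 0 := by
      have hy' : z + s • y = z := hy
      simpa [h1.ne'] using hy'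
    simp [this]
  obtain ⟨d, L, hd, hL, rfl⟩ := exists_dir hab
  obtain ⟨t, ht0, htL, rfl⟩ := (mem_segment_iff_coord hL).1 hz
  -- One end of the segment at a time: if `t = 0` the constraint is a sign condition and hence
  -- invariant under scaling; if `t > 0` it is slack for small displacements.
  have key : ∀ t : ℝ, 0 ≤ t → ∃ r > 0, ∀ c t' k : ℝ, |c| < r → 0 < k → c = k * (t' - t) → 0 ≤ t' →
      0 ≤ t + c := by
    intro t ht
    rcases ht.eq_or_lt with rfl | ht
    · refine ⟨1, one_pos, fun c t' k _ hk hc ht' => ?_⟩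
      rw [hc]; simp; positivity
    · exact ⟨t, ht, fun c t' k hr _ _ _ => by linarith [(abs_lt.1 hr).1]⟩
  obtain ⟨r, hr, H⟩ := key t ht0
  obtain ⟨r', hr', H'⟩ := key (L - t) (by linarith)
  refine ⟨min r r', lt_min hr hr', fun s s' y h1 h2 h3 h4 h5 h6 hy => ?_⟩
  obtain ⟨t', ht0', htL', he⟩ := (mem_segment_iff_coord hL).1 hy
  have hsy : s • y = (t' - t) • d := by
    rw [sub_smul, eq_sub_iff_add_eq, ← add_right_inj a, ← he]; module
  have hs'y : s' • y = (s' / s * (t' - t)) • d := by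
    rw [mul_smul, ← hsy, smul_smul, div_mul_cancel₀ _ h1.ne']
  rw [hs'y, norm_smul, hd, mul_one, Real.norm_eq_abs] at h6
  have g1 := H _ t' (s' / s) (h6.trans_le (min_le_left _ _)) (by positivity) rfl ht0'
  have g2 := H' (-(s' / s * (t' - t))) (L - t') (s' / s)
    (by rw [abs_neg]; exact h6.trans_le (min_le_right _ _)) (by positivity) (by ring) (by linarith)
  refine (mem_segment_iff_coord hL).2 ⟨t + s' / s * (t' - t), g1, by linarith, ?_⟩
  rw [hs'y]; module

/-! ### The drawing, its regions and its edges. -/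

namespace CreasePattern
variable (P : CreasePattern)

theorem finite_edges : {e | P.IsEdge e}.Finite := by
  refine ((P.vertices.finite_toSet.image2 (segment ℝ) P.vertices.finite_toSet)).subset ?_
  rintro e ⟨a, b, hab, rfl⟩
  exact ⟨a, P.mem_of_adj _ _ hab, b, P.mem_of_adj _ _ (P.symm _ _ hab), rfl⟩

variable {P}

theorem IsEdge.isCompact {e : Set Plane} (he : P.IsEdge e) : IsCompact e := by
  obtain ⟨a, b, -, rfl⟩ := he
  rw [← convexHull_pair]
  exact (Set.toFinite {a, b}).isCompact_convexHull ℝ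

variable (P)

theorem isClosed_skeleton : IsClosed P.skeleton := by
  have : P.skeleton = (P.vertices : Set Plane) ∪ ⋃ e ∈ {e | P.IsEdge e}, e := by
    ext x
    simp [skeleton]
  rw [this]
  exact P.vertices.finite_toSet.isClosed.union
    (P.finite_edges.isClosed_biUnion fun e he => IsEdge.isCompact he |>.isClosed)

theorem conicAt_skeleton (z : Plane) : ConicAt z fun _ => P.skeleton := by
  have hfin : Finite {e // P.IsEdge e} := P.finite_edges.to_subtype
  -- Vertices enter as degenerate segments, so that isolated vertices are included.
  have h1 : ConicAt z fun _ =>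
      {x | ∃ i : P.vertices ⊕ {e // P.IsEdge e}, x ∈ Sum.elim
        (fun v : P.vertices => segment ℝ v.1 v.1) (fun e : {e // P.IsEdge e} => e.1) i} :=
    ConicAt.iUnion (Q := fun i _ => Sum.elim (fun v : P.vertices => segment ℝ v.1 v.1)
      (fun e : {e // P.IsEdge e} => e.1) i) fun i => by
      rcases i with v | ⟨e, a, b, -, rfl⟩
      · exact conicAt_segment _ _ _
      · exact conicAt_segment _ _ _
  refine h1.congr one_pos fun s _ _ => ?_
  ext x
  simp [skeleton]

variable {P}

section Region
variable {G : Set Plane} (hG : P.IsRegion G)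
include hG

theorem IsRegion.isOpen : IsOpen G := by
  obtain ⟨x, hx, rfl⟩ := hG
  exact P.isClosed_skeleton.isOpen_compl.connectedComponentIn

theorem IsRegion.nonempty : G.Nonempty := by
  obtain ⟨x, hx, rfl⟩ := hG
  exact ⟨x, mem_connectedComponentIn hx⟩

theorem IsRegion.notMem_skeleton {x : Plane} (hx : x ∈ G) : x ∉ P.skeleton := by
  obtain ⟨y, hy, rfl⟩ := hG
  exact connectedComponentIn_subset _ _ hx

theorem IsRegion.subset_of_isPreconnected {T : Set Plane} (hT : IsPreconnected T)
    (hTs : ∀ x ∈ T, x ∉ P.skeleton) {x : Plane} (hx : x ∈ T) (hxG : x ∈ G) : T ⊆ G := by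
  obtain ⟨y, hy, rfl⟩ := hG
  rw [connectedComponentIn_eq hxG]
  exact hT.subset_connectedComponentIn hx hTs

theorem IsRegion.eq_of_mem {G' : Set Plane} (hG' : P.IsRegion G') {x : Plane} (hx : x ∈ G)
    (hx' : x ∈ G') : G = G' := by
  obtain ⟨y, hy, rfl⟩ := hG
  obtain ⟨y', hy', rfl⟩ := hG'
  rw [connectedComponentIn_eq hx, connectedComponentIn_eq hx']

/-- The component of `x` is open, so it meets `G` and therefore equals it. -/
theorem IsRegion.mem_of_mem_closure {x : Plane} (hx : x ∈ closure G) (hxs : x ∉ P.skeleton) :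
    x ∈ G := by
  have hreg : P.IsRegion (connectedComponentIn P.skeletonᶜ x) := ⟨x, hxs, rfl⟩
  obtain ⟨y, hy1, hy2⟩ := mem_closure_iff.1 hx _ hreg.isOpen (mem_connectedComponentIn hxs)
  rw [hG.eq_of_mem hreg hy2 hy1]
  exact mem_connectedComponentIn hxs

/-- The drawing is conic at `z`, so the path from `z + s • y` to `z + s' • y` along the ray avoids
it and stays in one component. -/
theorem IsRegion.conicAt (z : Plane) : ConicAt z fun _ => G := by
  obtain ⟨r, hr, h⟩ := P.conicAt_skeleton z
  refine ⟨r, hr, fun s s' y h1 h2 h3 h4 h5 h6 hy => ?_⟩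
  have hcont : Continuous fun σ : ℝ => z + σ • y := by fun_prop
  have hpre : IsPreconnected ((fun σ : ℝ => z + σ • y) '' uIcc s s') :=
    isPreconnected_uIcc.image _ hcont.continuousOn
  refine hG.subset_of_isPreconnected hpre ?_ (mem_image_of_mem _ left_mem_uIcc) hy
    (mem_image_of_mem _ right_mem_uIcc)
  rintro _ ⟨σ, hσ, rfl⟩ hsk
  have hσ' : min s s' ≤ σ ∧ σ ≤ max s s' := hσ
  have hσ0 : 0 < σ := (lt_min h1 h3).trans_le hσ'.1
  have hσr : σ < r := hσ'.2.trans_lt (max_lt h2 h4)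
  have hn : ‖σ • y‖ < r := by
    rw [norm_smul, Real.norm_of_nonneg hσ0.le]
    rw [norm_smul, Real.norm_of_nonneg h1.le] at h5
    rw [norm_smul, Real.norm_of_nonneg h3.le] at h6
    rcases le_max_iff.1 hσ'.2 with hh | hh
    · exact (mul_le_mul_of_nonneg_right hh (norm_nonneg _)).trans_lt h5
    · exact (mul_le_mul_of_nonneg_right hh (norm_nonneg _)).trans_lt h6
  exact hG.notMem_skeleton hy (h σ s y hσ0 hσr h1 h2 hn h5 hsk)

end Region

/-- An edge of the pattern in coordinates, with a set on its positive side. -/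
structure EdgeFrame (P : CreasePattern) (e F : Set Plane) (u d n : Plane) (L : ℝ) : Prop
    extends SideFrame e F u d n L where
  isEdge : P.IsEdge e
  start_vertex : u ∈ P.vertices
  end_vertex : u + L • d ∈ P.vertices
  inner_notMem : ∀ t, 0 < t → t < L → u + t • d ∉ P.vertices

theorem IsEdge.exists_edgeFrame {e : Set Plane} (he : P.IsEdge e) :
    ∃ u d n L, P.EdgeFrame e ∅ u d n L := by
  have he' := he
  obtain ⟨a, b, hab, rfl⟩ := he
  obtain ⟨d, L, hd, hL, rfl⟩ := exists_dir (P.ne_of_adj _ _ hab)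
  obtain ⟨n, hn⟩ := exists_isFrame hd
  have hd0 : d ≠ 0 := by rintro rfl; simp at hd
  refine ⟨a, d, n, L, ⟨⟨hn, hL, rfl, by simp⟩, he', P.mem_of_adj _ _ hab,
    P.mem_of_adj _ _ (P.symm _ _ hab), fun t h0 h1 hv => ?_⟩⟩
  rcases P.vertex_on_edge _ _ _ hab hv ((mem_segment_iff_coord hL).2 ⟨t, h0.le, h1.le, rfl⟩)
    with h | h
  · simp [hd0, h0.ne'] at h
  · rw [add_right_inj] at h
    exact h1.ne (smul_left_injective ℝ hd0 h)

namespace EdgeFrame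
variable {e F : Set Plane} {u d n : Plane} {L : ℝ} (h : P.EdgeFrame e F u d n L)
include h

theorem reverse : P.EdgeFrame e F (u + L • d) (-d) n L where
  toSideFrame := h.toSideFrame.reverse
  isEdge := h.isEdge
  start_vertex := h.end_vertex
  end_vertex := by simpa using h.start_vertex
  inner_notMem t h0 h1 := by
    have := h.inner_notMem (L - t) (by linarith) (by linarith)
    rwa [show u + L • d + t • -d = u + (L - t) • d by module]

theorem change {F' : Set Plane} (hF : ∀ x ∈ F', (0 : ℝ) < inner ℝ n (x - u)) :
    P.EdgeFrame e F' u d n L where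
  toIsFrame := h.toIsFrame
  posL := h.posL
  carrier := h.carrier
  pos := hF
  isEdge := h.isEdge
  start_vertex := h.start_vertex
  end_vertex := h.end_vertex
  inner_notMem := h.inner_notMem

theorem neg : P.EdgeFrame e ∅ u d (-n) L where
  toIsFrame := h.toIsFrame.neg_right
  posL := h.posL
  carrier := h.carrier
  pos := by simp
  isEdge := h.isEdge
  start_vertex := h.start_vertex
  end_vertex := h.end_vertex
  inner_notMem := h.inner_notMem

theorem edge_subset_skeleton : e ⊆ P.skeleton := fun _ hx => Or.inr ⟨e, h.isEdge, hx⟩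

/-- Around an inner point of an edge the drawing is a straight line. -/
theorem exists_ball {t : ℝ} (h0 : 0 < t) (h1 : t < L) :
    ∃ r > 0, ∀ x, dist x (u + t • d) < r → (x ∈ P.skeleton ↔ inner ℝ n (x - u) = (0 : ℝ)) := by
  have hpe : u + t • d ∈ e := h.mem_iff.2 ⟨t, h0.le, h1.le, rfl⟩
  have hcl : IsClosed ((P.vertices : Set Plane) ∪ ⋃ e' ∈ {e' | P.IsEdge e' ∧ e' ≠ e}, e') :=
    P.vertices.finite_toSet.isClosed.union
      ((P.finite_edges.subset fun _ hx => hx.1).isClosed_biUnion fun e' he' =>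
        IsEdge.isCompact he'.1 |>.isClosed)
  have hp : u + t • d ∉ (P.vertices : Set Plane) ∪ ⋃ e' ∈ {e' | P.IsEdge e' ∧ e' ≠ e}, e' := by
    rintro (hv | hv)
    · exact h.inner_notMem t h0 h1 hv
    · simp only [mem_iUnion] at hv
      obtain ⟨e', ⟨⟨c, d', hcd, rfl⟩, hne⟩, hv⟩ := hv
      obtain ⟨a, b, hab, rfl⟩ := h.isEdge
      rcases P.edges_meet _ _ _ _ _ hab hcd hpe hv with h' | h'
      · exact h.inner_notMem t h0 h1 h'
      · exact hne h'.symm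
  obtain ⟨r, hr, hb⟩ := Metric.isOpen_iff.1 hcl.isOpen_compl _ hp
  refine ⟨min r (min t (L - t)), by simp [hr, h0, h1], fun x hx => ⟨fun hs => ?_, fun hs => ?_⟩⟩
  · have hx' := hb (show x ∈ Metric.ball _ r from hx.trans_le (min_le_left _ _))
    rcases hs with hs | ⟨e', he', hs⟩
    · exact (hx' (Or.inl hs)).elim
    · by_cases hee : e' = e
      · subst hee
        obtain ⟨t', -, -, rfl⟩ := h.mem_iff.1 hs
        simp [inner_smul_right, h.nd]
      · exact (hx' (Or.inr (mem_biUnion (show e' ∈ {e' | P.IsEdge e' ∧ e' ≠ e} from ⟨he', hee⟩)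
          hs))).elim
  · obtain ⟨a, b, rfl⟩ := h.exists_coord u x
    rw [h.inner_coord] at hs
    subst hs
    rw [dist_eq_norm, show u + a • d + (0 : ℝ) • n - (u + t • d) = (a - t) • d + (0 : ℝ) • n by
      module] at hx
    have := (h.abs_le_norm _ _).trans_lt hx
    rw [lt_min_iff, lt_min_iff, abs_lt, abs_lt, abs_lt] at this
    refine h.edge_subset_skeleton (h.mem_iff.2 ⟨a, by linarith, by linarith, by simp⟩)

/-- A region touching an inner point of an edge contains one of the two half discs there. -/
theorem exists_half_ball {G : Set Plane} (hG : P.IsRegion G) {t : ℝ} (h0 : 0 < t) (h1 : t < L)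
    (hp : u + t • d ∈ closure G) :
    ∃ r > 0, (∀ x, dist x (u + t • d) < r → (0 : ℝ) < inner ℝ n (x - u) → x ∈ G) ∨
      (∀ x, dist x (u + t • d) < r → inner ℝ n (x - u) < (0 : ℝ) → x ∈ G) := by
  obtain ⟨r, hr, hb⟩ := h.exists_ball h0 h1
  refine ⟨r, hr, ?_⟩
  obtain ⟨x, hx1, hx2⟩ := mem_closure_iff.1 hp _ Metric.isOpen_ball (Metric.mem_ball_self hr)
  have hx0 : inner ℝ n (x - u) ≠ (0 : ℝ) := fun h' => hG.notMem_skeleton hx2 ((hb x hx1).2 h')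
  have hlin : ∀ x : Plane, inner ℝ n (x - u) = (innerSL ℝ n x : ℝ) - inner ℝ n u := fun x => by
    simp [inner_sub_right]
  rcases lt_or_gt_of_ne hx0 with hneg | hpos
  · right
    have hc : Convex ℝ (Metric.ball (u + t • d) r ∩ {x | inner ℝ n (x - u) < (0 : ℝ)}) := by
      refine (convex_ball _ _).inter ?_
      simp only [hlin, sub_lt_zero]
      exact convex_halfSpace_lt (innerSL ℝ n).toLinearMap.isLinear _
    intro y hy1 hy2
    refine hG.subset_of_isPreconnected hc.isPreconnected ?_ ⟨hx1, hneg⟩ hx2 ⟨hy1, hy2⟩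
    rintro w ⟨hw1, hw2⟩ hws
    exact (show inner ℝ n (w - u) < (0 : ℝ) from hw2).ne ((hb w hw1).1 hws)
  · left
    have hc : Convex ℝ (Metric.ball (u + t • d) r ∩ {x | (0 : ℝ) < inner ℝ n (x - u)}) := by
      refine (convex_ball _ _).inter ?_
      simp only [hlin, sub_pos]
      exact convex_halfSpace_gt (innerSL ℝ n).toLinearMap.isLinear _
    intro y hy1 hy2
    refine hG.subset_of_isPreconnected hc.isPreconnected ?_ ⟨hx1, hpos⟩ hx2 ⟨hy1, hy2⟩
    rintro w ⟨hw1, hw2⟩ hws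
    exact (show (0 : ℝ) < inner ℝ n (w - u) from hw2).ne' ((hb w hw1).1 hws)

/-- The parameters whose points lie in `closure G` form a closed set, and by the half discs they
also form an open set inside `(0, L)`. Since the interval is connected, one inner point yields the
whole edge. -/
theorem subset_closure_region {G : Set Plane} (hG : P.IsRegion G) {t : ℝ} (h0 : 0 < t) (h1 : t < L)
    (hp : u + t • d ∈ closure G) : e ⊆ closure G := by
  set T : Set ℝ := {t | u + t • d ∈ closure G} with hT
  have hcont : Continuous fun t : ℝ => u + t • d := by fun_prop
  have hTc : IsClosed T := isClosed_closure.preimage hcont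
  have hnhds : ∀ t', 0 < t' → t' < L → t' ∈ T → t' ∈ interior T := by
    intro t' h0' h1' ht'
    obtain ⟨r, hr, hb⟩ := h.exists_half_ball hG h0' h1' ht'
    rw [mem_interior_iff_mem_nhds, Metric.mem_nhds_iff]
    refine ⟨r, hr, fun t'' ht'' => ?_⟩
    have hd : dist (u + t'' • d) (u + t' • d) < r := by
      rw [dist_add_left, dist_eq_norm, ← sub_smul, norm_smul, h.norm_d, mul_one]
      exact ht''
    -- Approach a neighbouring point of the edge from the side on which the half disc lies; `σ` is
    -- `1` or `-1`.
    have hlim : ∀ σ : ℝ, Tendsto (fun ε : ℝ => u + t'' • d + (σ * ε) • n) (𝓝[>] 0)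
        (𝓝 (u + t'' • d)) := fun σ => by
      have : Continuous fun ε : ℝ => u + t'' • d + (σ * ε) • n := by fun_prop
      simpa using (this.tendsto 0).mono_left nhdsWithin_le_nhds
    have hball : ∀ σ : ℝ, ∀ᶠ ε : ℝ in 𝓝[>] 0,
        dist (u + t'' • d + (σ * ε) • n) (u + t' • d) < r ∧ 0 < ε := fun σ =>
      ((hlim σ).eventually (Metric.isOpen_ball.mem_nhds hd)).and self_mem_nhdsWithin
    rcases hb with hb | hb
    · refine mem_closure_of_tendsto (hlim 1) ((hball 1).mono fun ε hε => hb _ hε.1 ?_)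
      rw [h.inner_coord, one_mul]; exact hε.2
    · refine mem_closure_of_tendsto (hlim (-1)) ((hball (-1)).mono fun ε hε => hb _ hε.1 ?_)
      rw [h.inner_coord]; linarith [hε.2]
  have hsub : Ioo 0 L ⊆ interior T := by
    refine isPreconnected_Ioo.subset_of_closure_inter_subset isOpen_interior
      ⟨t, ⟨h0, h1⟩, hnhds t h0 h1 hp⟩ ?_
    rintro t' ⟨ht', h0', h1'⟩
    exact hnhds t' h0' h1' (closure_minimal interior_subset hTc ht')
  have hsub' : Icc 0 L ⊆ T := by
    rw [← closure_Ioo h.posL.ne]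
    exact closure_minimal (hsub.trans interior_subset) hTc
  intro x hx
  obtain ⟨t', h0', h1', rfl⟩ := h.mem_iff.1 hx
  exact hsub' ⟨h0', h1'⟩

end EdgeFrame
end CreasePattern


/-! ### Convex faces and the edges bounding them. -/

namespace CreasePattern
variable {P : CreasePattern}

namespace EdgeFrame
variable {e F : Set Plane} {u d n : Plane} {L : ℝ} (h : P.EdgeFrame e F u d n L)
include h

/-- A convex region containing a half disc on the positive side can have no point on the other side:
the edge point at the centre of the disc would lie between two points of the region, although it
belongs to the drawing. -/
theorem pos_of_half_ball {G : Set Plane} (hG : P.IsRegion G) (hc : Convex ℝ G) {t r : ℝ}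
    (h0 : 0 ≤ t) (h1 : t ≤ L) (hr : 0 < r)
    (hb : ∀ x, dist x (u + t • d) < r → (0 : ℝ) < inner ℝ n (x - u) → x ∈ G) :
    ∀ x ∈ G, (0 : ℝ) < inner ℝ n (x - u) := by
  intro x hx
  by_contra hneg
  rw [not_lt] at hneg
  -- move `x` strictly to the negative side
  obtain ⟨y, hyG, hy⟩ : ∃ y ∈ G, inner ℝ n (y - u) < (0 : ℝ) := by
    have hlim : Tendsto (fun ε : ℝ => x + (-ε) • n) (𝓝[>] 0) (𝓝 x) := by
      have : Continuous fun ε : ℝ => x + (-ε) • n := by fun_prop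
      simpa using (this.tendsto 0).mono_left nhdsWithin_le_nhds
    obtain ⟨ε, hε, hε0⟩ := ((hlim.eventually (hG.isOpen.mem_nhds hx)).and
      (self_mem_nhdsWithin : ∀ᶠ ε : ℝ in 𝓝[>] 0, ε ∈ Ioi (0 : ℝ))).exists
    refine ⟨_, hε, ?_⟩
    rw [add_sub_right_comm, inner_add_right, inner_smul_right, h.nn]
    linarith [show (0 : ℝ) < ε from hε0]
  set p := u + t • d with hp
  -- Prolonging the segment from `y` beyond `p` enters the half disc.
  have hlim : Tendsto (fun ε : ℝ => p + ε • (p - y)) (𝓝[>] 0) (𝓝 p) := by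
    have : Continuous fun ε : ℝ => p + ε • (p - y) := by fun_prop
    simpa using (this.tendsto 0).mono_left nhdsWithin_le_nhds
  obtain ⟨ε, hε, hε0⟩ := ((hlim.eventually (Metric.isOpen_ball.mem_nhds
    (Metric.mem_ball_self hr))).and
      (self_mem_nhdsWithin : ∀ᶠ ε : ℝ in 𝓝[>] 0, ε ∈ Ioi (0 : ℝ))).exists
  have hε0 : 0 < ε := hε0
  have hpu : inner ℝ n (p - u) = (0 : ℝ) := by simp [hp, inner_smul_right, h.nd]
  have hz : p + ε • (p - y) ∈ G := by
    refine hb _ hε ?_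
    rw [show p + ε • (p - y) - u = (1 + ε) • (p - u) - ε • (y - u) by module, inner_sub_right,
      inner_smul_right, inner_smul_right, hpu]
    nlinarith
  have hpG : p ∈ G := by
    have := hc hz hyG (a := 1 / (1 + ε)) (b := ε / (1 + ε)) (by positivity) (by positivity)
      (by field_simp)
    convert this using 1
    match_scalars <;> field_simp
    ring
  exact hG.notMem_skeleton hpG (h.edge_subset_skeleton (h.mem_iff.2 ⟨t, h0, h1, rfl⟩))

theorem of_half_ball {G : Set Plane} (hG : P.IsRegion G) (hc : Convex ℝ G) {t r : ℝ}
    (h0 : 0 ≤ t) (h1 : t ≤ L) (hr : 0 < r)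
    (hb : ∀ x, dist x (u + t • d) < r → (0 : ℝ) < inner ℝ n (x - u) → x ∈ G) :
    P.EdgeFrame e G u d n L :=
  h.change (h.pos_of_half_ball hG hc h0 h1 hr hb)

theorem exists_side {G : Set Plane} (hG : P.IsRegion G) (hc : Convex ℝ G) (he : e ⊆ closure G) :
    P.EdgeFrame e G u d n L ∨ P.EdgeFrame e G u d (-n) L := by
  have hL := h.posL
  obtain ⟨r, hr, hb | hb⟩ := h.exists_half_ball hG (t := L / 2) (by linarith) (by linarith)
    (he (h.mem_iff.2 ⟨L / 2, by linarith, by linarith, rfl⟩))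
  · exact Or.inl (h.of_half_ball hG hc (by linarith) (by linarith) hr hb)
  · refine Or.inr (h.neg.of_half_ball hG hc (t := L / 2) (by linarith) (by linarith) hr
      fun x hx hx' => hb x hx ?_)
    rwa [inner_neg_left, neg_pos] at hx'

theorem half_ball (hF : P.IsRegion F) (he : e ⊆ closure F) {t : ℝ} (h0 : 0 < t) (h1 : t < L) :
    ∃ r > 0, ∀ x, dist x (u + t • d) < r → (0 : ℝ) < inner ℝ n (x - u) → x ∈ F := by
  obtain ⟨r, hr, hb | hb⟩ := h.exists_half_ball hF h0 h1
    (he (h.mem_iff.2 ⟨t, h0.le, h1.le, rfl⟩))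
  · exact ⟨r, hr, hb⟩
  · exfalso
    have hmem : u + t • d + (-(r / 2)) • n ∈ F := by
      refine hb _ ?_ ?_
      · rw [dist_eq_norm, add_sub_cancel_left, norm_smul, h.norm_n, mul_one, norm_neg,
          Real.norm_of_nonneg (by positivity)]
        linarith
      · rw [h.inner_coord]; linarith
    have := h.pos _ hmem
    rw [h.inner_coord] at this
    linarith

/-- Both regions contain a half disc on the same side of the midpoint of the edge, so they share a
point. Hence an edge bounds at most one convex face on each side. -/
theorem eq_of_frame {G : Set Plane} (hF : P.IsRegion F) (heF : e ⊆ closure F)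
    (hG : P.IsRegion G) (heG : e ⊆ closure G) (h' : P.EdgeFrame e G u d n L) : F = G := by
  have hL := h.posL
  obtain ⟨r, hr, hb⟩ := h.half_ball hF heF (t := L / 2) (by linarith) (by linarith)
  obtain ⟨r', hr', hb'⟩ := h'.half_ball hG heG (t := L / 2) (by linarith) (by linarith)
  have h0 : 0 < min r r' := lt_min hr hr'
  have hd : dist (u + (L / 2) • d + (min r r' / 2) • n) (u + (L / 2) • d) < min r r' := by
    rw [dist_eq_norm, add_sub_cancel_left, norm_smul, h.norm_n, mul_one,
      Real.norm_of_nonneg (by positivity)]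
    linarith
  have hp : (0 : ℝ) < inner ℝ n (u + (L / 2) • d + (min r r' / 2) • n - u) := by
    rw [h.inner_coord]; positivity
  exact hF.eq_of_mem hG (hb _ (hd.trans_le (min_le_left _ _)) hp)
    (hb' _ (hd.trans_le (min_le_right _ _)) hp)

/-- A region on the positive side of an edge. -/
theorem exists_region : ∃ G, P.IsRegion G ∧ e ⊆ closure G ∧
    (Convex ℝ G → P.EdgeFrame e G u d n L) := by
  have hL := h.posL
  obtain ⟨r, hr, hb⟩ := h.exists_ball (t := L / 2) (by linarith) (by linarith)
  have hmem : ∀ ε, 0 < ε → ε < r → u + (L / 2) • d + ε • n ∉ P.skeleton := by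
    intro ε h0 h1 hs
    have := (hb _ ?_).1 hs
    · rw [h.inner_coord] at this
      exact h0.ne' this
    · rw [dist_eq_norm, add_sub_cancel_left, norm_smul, h.norm_n, mul_one,
        Real.norm_of_nonneg h0.le]
      exact h1
  have hG : P.IsRegion (connectedComponentIn P.skeletonᶜ (u + (L / 2) • d + (r / 2) • n)) :=
    ⟨_, hmem _ (by linarith) (by linarith), rfl⟩
  have hx0 : u + (L / 2) • d + (r / 2) • n ∈
      connectedComponentIn P.skeletonᶜ (u + (L / 2) • d + (r / 2) • n) :=
    mem_connectedComponentIn (hmem _ (by linarith) (by linarith))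
  have hseg : ∀ ε, 0 < ε → ε < r → u + (L / 2) • d + ε • n ∈
      connectedComponentIn P.skeletonᶜ (u + (L / 2) • d + (r / 2) • n) := by
    intro ε h0 h1
    have hc : Continuous fun ε : ℝ => u + (L / 2) • d + ε • n := by fun_prop
    refine hG.subset_of_isPreconnected (isPreconnected_Ioo.image _ hc.continuousOn
      (s := Ioo 0 r)) ?_ (mem_image_of_mem _ ⟨by linarith, by linarith⟩) hx0
      (mem_image_of_mem _ ⟨h0, h1⟩)
    rintro _ ⟨σ, hσ, rfl⟩
    exact hmem σ hσ.1 hσ.2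
  have hcl : u + (L / 2) • d ∈
      closure (connectedComponentIn P.skeletonᶜ (u + (L / 2) • d + (r / 2) • n)) := by
    have hlim : Tendsto (fun ε : ℝ => u + (L / 2) • d + ε • n) (𝓝[>] 0)
        (𝓝 (u + (L / 2) • d)) := by
      have : Continuous fun ε : ℝ => u + (L / 2) • d + ε • n := by fun_prop
      simpa using (this.tendsto 0).mono_left nhdsWithin_le_nhds
    refine mem_closure_of_tendsto hlim ?_
    filter_upwards [Ioo_mem_nhdsGT hr] with ε hε using hseg ε hε.1 hε.2
  have hsub := h.subset_closure_region hG (t := L / 2) (by linarith) (by linarith) hcl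
  refine ⟨_, hG, hsub, fun hconv => ?_⟩
  rcases h.exists_side hG hconv hsub with h' | h'
  · exact h'
  · have h1 := h'.pos _ hx0
    rw [inner_neg_left, h.inner_coord] at h1
    linarith

end EdgeFrame

theorem Face.isRegion (F : P.Face) : P.IsRegion F.carrier := F.2.1

theorem Face.isBounded (F : P.Face) : Bornology.IsBounded F.carrier := F.2.2

theorem Face.isOpen (F : P.Face) : IsOpen F.carrier := F.isRegion.isOpen

theorem Face.eq_of_mem {F G : P.Face} {x : Plane} (hF : x ∈ F.carrier) (hG : x ∈ G.carrier) :
    F = G :=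
  Subtype.ext (F.isRegion.eq_of_mem G.isRegion hF hG)

theorem Face.isCompact_closure (F : P.Face) : IsCompact (closure F.carrier) :=
  F.isBounded.isCompact_closure

theorem Crease.isEdge (e : P.Crease) : P.IsEdge e.carrier := e.2.1

theorem boundedBy_of_mem {F : P.Face} {e : Set Plane} (he : P.IsEdge e) {x : Plane} (hxe : x ∈ e)
    (hxv : x ∉ P.vertices) (hxF : x ∈ closure F.carrier) : F.BoundedBy e := by
  obtain ⟨u, d, n, L, h⟩ := he.exists_edgeFrame
  obtain ⟨t, h0, h1, rfl⟩ := h.mem_iff.1 hxe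
  refine h.subset_closure_region F.isRegion (h0.lt_of_ne ?_) (h1.lt_of_ne ?_) hxF
  · rintro rfl
    exact hxv (by simpa using h.start_vertex)
  · rintro rfl
    exact hxv h.end_vertex

theorem Face.mem_skeleton {F : P.Face} {x : Plane} (hx : x ∈ closure F.carrier)
    (hxF : x ∉ F.carrier) : x ∈ P.skeleton := by
  by_contra hxs
  exact hxF (F.isRegion.mem_of_mem_closure hx hxs)

theorem Face.exists_edge_of_notMem_vertices {F : P.Face} {x : Plane}
    (hx : x ∈ closure F.carrier) (hxF : x ∉ F.carrier) (hxv : x ∉ P.vertices) :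
    ∃ e, P.IsEdge e ∧ x ∈ e ∧ F.BoundedBy e := by
  rcases Face.mem_skeleton hx hxF with h | ⟨e, he, hxe⟩
  · exact (hxv h).elim
  · exact ⟨e, he, hxe, boundedBy_of_mem he hxe hxv hx⟩

section ConvexFace
variable {F : P.Face} (hF : Convex ℝ F.carrier)
include hF

theorem Face.interior_closure : interior (closure F.carrier) = F.carrier := by
  rw [hF.interior_closure_eq_interior_of_nonempty_interior, F.isOpen.interior_eq]
  rw [F.isOpen.interior_eq]; exact F.isRegion.nonempty

/-- The boundary of a convex face is covered by the edges bounding it. -/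
theorem Face.exists_edge {x : Plane} (hx : x ∈ closure F.carrier) (hxF : x ∉ F.carrier) :
    ∃ e, P.IsEdge e ∧ x ∈ e ∧ F.BoundedBy e := by
  by_contra hcon
  -- Everything from which `x` would have to keep a positive distance if no bounding edge passed
  -- through it.
  set K : Set Plane := ((P.vertices : Set Plane) \ {x}) ∪
    ⋃ e ∈ {e | P.IsEdge e ∧ F.BoundedBy e}, e with hK
  have hcl : IsClosed K :=
    (P.vertices.finite_toSet.sdiff).isClosed.union
      ((P.finite_edges.subset fun _ hx => hx.1).isClosed_biUnion fun e he =>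
        IsEdge.isCompact he.1 |>.isClosed)
  have hxK : x ∉ K := by
    rintro (hv | hv)
    · exact hv.2 rfl
    · simp only [mem_iUnion] at hv
      obtain ⟨e, he, hxe⟩ := hv
      exact hcon ⟨e, he.1, hxe, he.2⟩
  obtain ⟨r, hr, hb⟩ := Metric.isOpen_iff.1 hcl.isOpen_compl x hxK
  obtain ⟨p₀, hp₀b, hp₀⟩ := mem_closure_iff.1 hx _ Metric.isOpen_ball (Metric.mem_ball_self hr)
  obtain ⟨y, hyb, hy⟩ : ∃ y ∈ Metric.ball x r, y ∉ closure F.carrier := by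
    by_contra hall
    push Not at hall
    apply hxF
    rw [← Face.interior_closure hF, mem_interior_iff_mem_nhds, Metric.mem_nhds_iff]
    exact ⟨r, hr, hall⟩
  have hxy : x ≠ y := by rintro rfl; exact hy hx
  obtain ⟨d, ℓ, hd, hℓ, hyd⟩ := exists_dir hxy
  obtain ⟨n, hn⟩ := exists_isFrame hd
  -- A point of the face off the line through `x` and `y`: the segment from `p` to `y` leaves the
  -- face inside the ball, at a frontier point different from `x`. That point is no vertex, so it
  -- lies on a bounding edge, which the ball was chosen to avoid.
  obtain ⟨p, hpb, hp, hpn⟩ : ∃ p ∈ Metric.ball x r, p ∈ F.carrier ∧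
      inner ℝ n (p - x) ≠ (0 : ℝ) := by
    by_cases h0 : inner ℝ n (p₀ - x) = (0 : ℝ)
    · have hlim : Tendsto (fun ε : ℝ => p₀ + ε • n) (𝓝[>] 0) (𝓝 p₀) := by
        have : Continuous fun ε : ℝ => p₀ + ε • n := by fun_prop
        simpa using (this.tendsto 0).mono_left nhdsWithin_le_nhds
      obtain ⟨ε, ⟨hε1, hε2⟩, hε0⟩ := (((hlim.eventually (F.isOpen.mem_nhds hp₀)).and
        (hlim.eventually (Metric.isOpen_ball.mem_nhds hp₀b))).and
        (self_mem_nhdsWithin : ∀ᶠ ε : ℝ in 𝓝[>] 0, ε ∈ Ioi (0 : ℝ))).exists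
      refine ⟨_, hε2, hε1, ?_⟩
      rw [add_sub_right_comm, inner_add_right, h0, inner_smul_right, hn.nn]
      have : (0 : ℝ) < ε := hε0
      simpa using this.ne'
    · exact ⟨p₀, hp₀b, hp₀, h0⟩
  have hseg : IsPreconnected (segment ℝ p y) := (convex_segment p y).isPreconnected
  obtain ⟨z, hz1, hz2⟩ : (segment ℝ p y ∩ frontier F.carrier).Nonempty := by
    by_contra hne
    have := hseg.subset_of_closure_inter_subset F.isOpen ⟨p, left_mem_segment ℝ p y, hp⟩
      (by
        rintro w ⟨hw1, hw2⟩
        by_contra hwF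
        exact hne ⟨w, hw2, by rw [frontier, F.isOpen.interior_eq]; exact ⟨hw1, hwF⟩⟩)
    exact hy (subset_closure (this (right_mem_segment ℝ p y)))
  rw [frontier, F.isOpen.interior_eq] at hz2
  have hzb : z ∈ Metric.ball x r := (convex_ball x r).segment_subset hpb hyb hz1
  have hzK : z ∉ K := hb hzb
  have hzx : z ≠ x := by
    rintro rfl
    obtain ⟨a, b, ha, hb', hab, hzz⟩ := hz1
    have h1 : inner ℝ n (a • (p - z) + b • (y - z)) = (0 : ℝ) := by
      rw [show a • (p - z) + b • (y - z) = (a • p + b • y) - (a + b) • z by module, hzz, hab]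
      simp
    rw [hyd, add_sub_cancel_left, inner_add_right, inner_smul_right, inner_smul_right,
      inner_smul_right, hn.nd] at h1
    have ha0 : a = 0 := by simpa [hpn] using h1
    subst ha0
    rw [zero_add] at hab
    subst hab
    exact hxy (by simpa using hzz.symm)
  have hzv : z ∉ P.vertices := fun hv => hzK (Or.inl ⟨hv, hzx⟩)
  obtain ⟨e, he1, he2, he3⟩ := Face.exists_edge_of_notMem_vertices hz2.1 hz2.2 hzv
  exact hzK (Or.inr (mem_biUnion (show e ∈ {e | P.IsEdge e ∧ F.BoundedBy e} from ⟨he1, he3⟩) he2))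

end ConvexFace

theorem finite_crease : Finite P.Crease := by
  have : Finite {e | P.IsEdge e} := P.finite_edges.to_subtype
  exact Finite.of_injective (fun e : P.Crease => (⟨e.carrier, e.isEdge⟩ : {e | P.IsEdge e}))
    fun e e' h => Subtype.ext (congrArg (fun x : {e | P.IsEdge e} => (x : Set Plane)) h)

section ConvexPattern
variable (hP : ∀ F : P.Face, Convex ℝ F.carrier)
include hP

/-- Every bounded face has a bounding edge, there are finitely many edges, and each bounds at most
one face per side. -/
theorem finite_face : Finite P.Face := by
  have hone : ∀ e, P.IsEdge e → {F : P.Face | F.BoundedBy e}.Finite := by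
    intro e he
    obtain ⟨u, d, n, L, h⟩ := he.exists_edgeFrame
    have h1 : {F : P.Face | F.BoundedBy e ∧ P.EdgeFrame e F.carrier u d n L}.Subsingleton :=
      fun F hF G hG => Subtype.ext (hF.2.eq_of_frame F.isRegion hF.1 G.isRegion hG.1 hG.2)
    have h2 : {F : P.Face | F.BoundedBy e ∧ P.EdgeFrame e F.carrier u d (-n) L}.Subsingleton :=
      fun F hF G hG => Subtype.ext (hF.2.eq_of_frame F.isRegion hF.1 G.isRegion hG.1 hG.2)
    refine (h1.finite.union h2.finite).subset fun F hF => ?_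
    rcases h.exists_side F.isRegion (hP F) hF with h' | h'
    · exact Or.inl ⟨hF, h'⟩
    · exact Or.inr ⟨hF, h'⟩
  rw [← Set.finite_univ_iff]
  refine (P.finite_edges.biUnion hone).subset fun F _ => ?_
  have hne : (frontier F.carrier).Nonempty := by
    rw [Set.nonempty_iff_ne_empty, Ne, frontier_eq_empty_iff, not_or]
    refine ⟨F.isRegion.nonempty.ne_empty, fun hu => ?_⟩
    have := F.isBounded
    rw [hu] at this
    exact NormedSpace.unbounded_univ ℝ Plane this
  obtain ⟨x, hx⟩ := hne
  rw [frontier, F.isOpen.interior_eq] at hx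
  obtain ⟨e, he, -, hFe⟩ := Face.exists_edge (hP F) hx.1 hx.2
  exact mem_biUnion (show e ∈ {e | P.IsEdge e} from he) hFe

/-- A crease joins exactly two faces, which lie on different sides of it. -/
theorem Crease.exists_faces (e : P.Crease) : ∃ (A B : P.Face) (u d n : Plane) (L : ℝ),
    A ≠ B ∧ A.BoundedBy e.carrier ∧ B.BoundedBy e.carrier ∧
    P.EdgeFrame e.carrier A.carrier u d n L ∧ P.EdgeFrame e.carrier B.carrier u d (-n) L ∧
    ∀ F : P.Face, F.BoundedBy e.carrier → F = A ∨ F = B := by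
  obtain ⟨u, d, n, L, h⟩ := e.isEdge.exists_edgeFrame
  obtain ⟨GA, hGA, hA, hA'⟩ := h.exists_region
  obtain ⟨GB, hGB, hB, hB'⟩ := h.neg.exists_region
  -- An unbounded region along `e` would make it a boundary edge.
  have bA : Bornology.IsBounded GA := by
    by_contra hb; exact e.2.2 GA hGA hb hA
  have bB : Bornology.IsBounded GB := by
    by_contra hb; exact e.2.2 GB hGB hb hB
  let A : P.Face := ⟨GA, hGA, bA⟩
  let B : P.Face := ⟨GB, hGB, bB⟩
  have fA : P.EdgeFrame e.carrier A.carrier u d n L := hA' (hP A)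
  have fB : P.EdgeFrame e.carrier B.carrier u d (-n) L := hB' (hP B)
  refine ⟨A, B, u, d, n, L, ?_, hA, hB, fA, fB, fun F hF => ?_⟩
  · intro hAB
    obtain ⟨x, hx⟩ := A.isRegion.nonempty
    have h1 := fA.pos x hx
    have h2 := fB.pos x (hAB ▸ hx)
    rw [inner_neg_left] at h2
    linarith
  · rcases h.exists_side F.isRegion (hP F) hF with h' | h'
    · exact Or.inl (Subtype.ext (h'.eq_of_frame F.isRegion hF A.isRegion hA fA))
    · exact Or.inr (Subtype.ext (h'.eq_of_frame F.isRegion hF B.isRegion hB fB))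

end ConvexPattern
end CreasePattern


/-! ### A convex face along one of its creases and at its corners. -/

namespace CreasePattern
variable {P : CreasePattern}

namespace EdgeFrame
variable {e : Set Plane} {F : P.Face} {u d n : Plane} {L : ℝ}
  (h : P.EdgeFrame e F.carrier u d n L)
include h

theorem eq_end_of_mem_vertices {x : Plane} (hx : x ∈ e) (hxv : x ∈ P.vertices) :
    x = u ∨ x = u + L • d := by
  obtain ⟨t, h0, h1, rfl⟩ := h.mem_iff.1 hx
  rcases h0.eq_or_lt with rfl | h0
  · left; simp
  rcases h1.eq_or_lt with rfl | h1
  · right; rfl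
  · exact (h.inner_notMem t h0 h1 hxv).elim

/-- The triangle spanned by the edge and a point `x` of the face lies in the face, apart from its
base; below a tent of slope `κ` over the edge one stays inside it. -/
theorem mem_of_le (hF : Convex ℝ F.carrier) (he : F.BoundedBy e) :
    ∃ κ > 0, ∀ t k, 0 < k → k ≤ κ * t → k ≤ κ * (L - t) → u + t • d + k • n ∈ F.carrier := by
  have hL := h.posL
  obtain ⟨x, hx⟩ := F.isRegion.nonempty
  obtain ⟨t₀, k₀, rfl⟩ := h.exists_coord u x
  have hk₀ := h.pos _ hx
  rw [h.inner_coord] at hk₀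
  have hD : 0 < |t₀| + L + 1 := by positivity
  -- The wanted point is the combination of `x` with weight `lam = k / k₀` and a point on the line
  -- of the edge. The slope `k₀ / (|t₀| + L + 1)` ensures that `lam < 1` and that this second point
  -- lies on the edge.
  refine ⟨k₀ / (|t₀| + L + 1), by positivity, fun t k hk h1 h2 => ?_⟩
  rw [div_mul_eq_mul_div, le_div_iff₀ hD] at h1 h2
  have hlam : 0 < k / k₀ := by positivity
  set lam := k / k₀ with hlam'
  have hkl : k = lam * k₀ := by rw [hlam']; field_simp
  have h1' : lam * (|t₀| + L + 1) ≤ t := by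
    rw [hkl] at h1
    have : k₀ * (lam * (|t₀| + L + 1)) ≤ k₀ * t := by linarith
    exact le_of_mul_le_mul_left this hk₀
  have h2' : lam * (|t₀| + L + 1) ≤ L - t := by
    rw [hkl] at h2
    have : k₀ * (lam * (|t₀| + L + 1)) ≤ k₀ * (L - t) := by linarith
    exact le_of_mul_le_mul_left this hk₀
  have hlt : lam < 1 := by
    by_contra hge
    rw [not_lt] at hge
    nlinarith [abs_nonneg t₀]
  have e1 := le_abs_self t₀
  have e2 := neg_abs_le t₀
  have hmem : u + ((t - lam * t₀) / (1 - lam)) • d ∈ closure F.carrier := by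
    refine he (h.mem_iff.2 ⟨_, ?_, ?_, rfl⟩)
    · exact div_nonneg (by nlinarith) (by linarith)
    · rw [div_le_iff₀ (by linarith)]
      nlinarith
  have := hF.combo_interior_closure_mem_interior (a := lam) (b := 1 - lam)
    (by rwa [F.isOpen.interior_eq]) hmem hlam (by linarith) (by ring)
  rw [F.isOpen.interior_eq] at this
  convert this using 1
  have hne : (1 - lam) ≠ 0 := by linarith
  rw [hkl]
  match_scalars <;> field_simp <;> ring

theorem exists_le_dist_vertex : ∃ η > 0, ∀ v ∈ P.vertices, v ≠ u → v ≠ u + L • d →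
    ∀ x ∈ e, η ≤ dist x v := by
  have hcl : IsClosed ((P.vertices : Set Plane) \ {u, u + L • d}) :=
    P.vertices.finite_toSet.sdiff.isClosed
  have hcomp : IsCompact e := h.isEdge.isCompact
  have hdisj : Disjoint e ((P.vertices : Set Plane) \ {u, u + L • d}) := by
    rw [Set.disjoint_left]
    intro x hx hx'
    rcases h.eq_end_of_mem_vertices hx hx'.1 with rfl | rfl
    · exact hx'.2 (by simp)
    · exact hx'.2 (by simp)
  obtain ⟨η, hη, hd⟩ := hdisj.exists_thickenings hcomp hcl
  refine ⟨η, hη, fun v hv h1 h2 x hx => ?_⟩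
  by_contra hlt
  rw [not_le] at hlt
  refine Set.disjoint_left.1 hd (Metric.mem_thickening_iff.2 ⟨x, hx, ?_⟩)
    (Metric.self_subset_thickening hη _ (show v ∈ _ from ⟨hv, by simp [h1, h2]⟩))
  rwa [dist_comm]

end EdgeFrame

section Corner
variable (hP : ∀ F : P.Face, Convex ℝ F.carrier) (hcor : P.NoStraightCorner)
variable {e : P.Crease} {F : P.Face} {u d n : Plane} {L : ℝ}
include hP hcor

/-- A point of the closed face on the line of the crease before its start would put a whole segment
of that line into the boundary of the face. A bounding edge through an inner point of that segment
must be collinear with the crease, which is a straight corner. -/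
theorem nonneg_of_mem_closure_line (h : P.EdgeFrame e.carrier F.carrier u d n L)
    (he : F.BoundedBy e.carrier) {t : ℝ} (ht : u + t • d ∈ closure F.carrier) : 0 ≤ t := by
  by_contra hneg
  rw [not_le] at hneg
  -- Infinitely many points against finitely many vertices.
  obtain ⟨t', ⟨ht1, ht2⟩, ht'v⟩ : ∃ t' ∈ Ioo t 0, u + t' • d ∉ P.vertices := by
    have hd0 : d ≠ 0 := by
      intro h0; have := h.norm_d; rw [h0] at this; simp at this
    have hinf : ((fun t : ℝ => u + t • d) '' Ioo t 0).Infinite :=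
      (Ioo_infinite hneg).image fun a _ b _ hab =>
        smul_left_injective ℝ hd0 (by simpa using hab)
    obtain ⟨y, hy, hyv⟩ := hinf.exists_notMem_finset P.vertices
    obtain ⟨t', ht', rfl⟩ := hy
    exact ⟨t', ht', hyv⟩
  have hu : u ∈ closure F.carrier := he h.start_mem
  have hy : u + t' • d ∈ closure F.carrier := by
    have := (hP F).closure hu ht (a := 1 - t' / t) (b := t' / t)
      (by rw [sub_nonneg, div_le_one_of_neg hneg]; exact ht1.le)
      (div_nonneg_of_nonpos ht2.le hneg.le) (by ring)
    convert this using 1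
    have hne : t ≠ 0 := hneg.ne
    rw [smul_add, smul_smul, div_mul_cancel₀ _ hne]
    module
  have hyF : u + t' • d ∉ F.carrier := fun hF => by
    have := h.pos _ hF
    simp [inner_smul_right, h.nd] at this
  obtain ⟨e', he', hye', hFe'⟩ := Face.exists_edge_of_notMem_vertices hy hyF ht'v
  obtain ⟨u', d', n', L', h'⟩ := he'.exists_edgeFrame
  have hL' := h'.posL
  obtain ⟨τ, hτ0, hτ1, hτ⟩ := h'.mem_iff.1 hye'
  have hτ0 : 0 < τ := hτ0.lt_of_ne fun h0 => ht'v (by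
    rw [hτ, ← h0]; simpa using h'.start_vertex)
  have hτ1 : τ < L' := hτ1.lt_of_ne fun h0 => ht'v (by rw [hτ, h0]; exact h'.end_vertex)
  have hα := h.closure_nonneg (hFe' h'.start_mem)
  have hβ := h.closure_nonneg (hFe' h'.end_mem)
  have hγ : inner ℝ n (u' + τ • d' - u) = (0 : ℝ) := by
    rw [← hτ]; simp [inner_smul_right, h.nd]
  rw [add_sub_right_comm, inner_add_right, inner_smul_right] at hβ hγ
  -- The distance from the line of the crease is affine on `e'`, nonnegative at both ends and zero
  -- at an inner point, hence constant.
  have hd' : inner ℝ n d' = (0 : ℝ) := by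
    rcases lt_trichotomy (inner ℝ n d' : ℝ) 0 with hlt | heq | hgt
    · nlinarith
    · exact heq
    · nlinarith
  have hu' : inner ℝ n (u' - u) = (0 : ℝ) := by rw [hd'] at hγ; linarith
  have hdd : d' = (inner ℝ d d' : ℝ) • d := by
    have := h.decomp d'
    rwa [hd', zero_smul, add_zero] at this
  have huu : u' = u + (inner ℝ d (u' - u) : ℝ) • d := by
    have := h.decomp (u' - u)
    rw [hu', zero_smul, add_zero] at this
    rw [← this, add_sub_cancel]
  have hg0 : (inner ℝ d d' : ℝ) ≠ 0 := by
    intro h0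
    rw [h0, zero_smul] at hdd
    have := h'.norm_d
    rw [hdd] at this
    simp at this
  refine hcor F e e' he' ?_ he hFe' ?_
  · rintro rfl
    obtain ⟨s, hs0, -, hs⟩ := h.mem_iff.1 hye'
    have := h.ext (a := t') (b := 0) (a' := s) (b' := 0) (by
      rw [add_right_inj] at hs; simp [hs])
    linarith [this.1]
  · ext x
    rw [show e.line = (affineSpan ℝ e.carrier : Set Plane) from rfl, h.mem_line_iff, h'.carrier,
      SetLike.mem_coe, mem_affineSpan_segment_iff hL']
    constructor
    · rintro ⟨s, rfl⟩
      rw [add_sub_right_comm, inner_add_right, inner_smul_right, hu', hd']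
      simp
    · intro hx
      obtain ⟨a, b, rfl⟩ := h.exists_coord u x
      rw [h.inner_coord] at hx
      refine ⟨(a - inner ℝ d (u' - u)) / inner ℝ d d', ?_⟩
      have e1 : ((a - inner ℝ d (u' - u)) / inner ℝ d d') • d' =
          (a - inner ℝ d (u' - u)) • d := by
        calc _ = ((a - inner ℝ d (u' - u)) / inner ℝ d d') • ((inner ℝ d d' : ℝ) • d) := by
              rw [← hdd]
          _ = _ := by rw [smul_smul, div_mul_cancel₀ _ hg0]
      calc u + a • d + b • n
          = (u + (inner ℝ d (u' - u) : ℝ) • d) + (a - inner ℝ d (u' - u)) • d := by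
            rw [hx]; module
        _ = _ := by rw [← huu, e1]

theorem mem_crease_of_mem_line (h : P.EdgeFrame e.carrier F.carrier u d n L)
    (he : F.BoundedBy e.carrier) {x : Plane} (hx : x ∈ closure F.carrier)
    (hxl : x ∈ e.line) : x ∈ e.carrier := by
  obtain ⟨a, b, rfl⟩ := h.exists_coord u x
  have hb := h.mem_line_iff.1 hxl
  rw [h.inner_coord] at hb
  subst hb
  rw [zero_smul, add_zero] at hx ⊢
  have h1 := nonneg_of_mem_closure_line hP hcor h he hx
  have h2 := nonneg_of_mem_closure_line hP hcor h.reverse he (t := L - a) (by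
    convert hx using 1; module)
  exact h.mem_iff.2 ⟨a, h1, by linarith, rfl⟩

/-- The corner of a face at the end of a crease has an angle less than `π`. -/
theorem exists_cone_bound (h : P.EdgeFrame e.carrier F.carrier u d n L)
    (he : F.BoundedBy e.carrier) : ∃ m : ℝ, 0 ≤ m ∧ ∀ a b τ : ℝ, 0 < τ →
      u + τ • (a • d + b • n) ∈ closure F.carrier → 0 ≤ b ∧ -(m * b) ≤ a := by
  obtain ⟨r, hr, hc⟩ := (F.isRegion.conicAt u).closure
  -- The backward direction leaves the closed face, hence so does a ball of some radius `η` around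
  -- this point. A direction too close to it would enter the ball after rescaling to length about `r
  -- / 4`.
  have hout : u + (-(r / 4)) • d ∉ closure F.carrier := fun hmem => by
    have := nonneg_of_mem_closure_line hP hcor h he hmem
    linarith
  obtain ⟨η, hη, hb⟩ := Metric.isOpen_iff.1 isClosed_closure.isOpen_compl _ hout
  -- The bound `1` keeps the rescaled vector shorter than `r`, so that conicity applies; the bound
  -- `r / η` puts the rescaled point within `η` of the excluded one.
  refine ⟨max 1 (r / η), by positivity, fun a b τ hτ hmem => ?_⟩
  have hb0 : 0 ≤ b := by
    have := h.closure_nonneg hmem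
    rw [add_sub_cancel_left, inner_smul_right, h.inner_n] at this
    exact nonneg_of_mul_nonneg_right this hτ
  refine ⟨hb0, ?_⟩
  by_contra hlt
  rw [not_le] at hlt
  have ha : 0 < -a := by
    have : 0 ≤ max 1 (r / η) * b := by positivity
    linarith
  have ha0 : a ≠ 0 := by rintro rfl; simp at ha
  have hb1 : b < -a := by
    have : 1 * b ≤ max 1 (r / η) * b := by gcongr; exact le_max_left _ _
    linarith
  have hb2 : r / η * b < -a := by
    have : r / η * b ≤ max 1 (r / η) * b := by gcongr; exact le_max_right _ _
    linarith
  -- scale the point to distance about `r / 4`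
  have hσ : 0 < r / 4 / (-a) := by positivity
  have hcF : Convex ℝ (closure F.carrier) := (hP F).closure
  have hu : u ∈ closure F.carrier := he h.start_mem
  have hny : ‖a • d + b • n‖ ≤ 2 * -a := by
    refine (h.norm_le a b).trans ?_
    rw [abs_of_neg (by linarith), abs_of_nonneg hb0]
    linarith
  have hscale : ∀ σ, 0 < σ → σ ≤ τ → u + σ • (a • d + b • n) ∈ closure F.carrier := by
    intro σ h0 h1
    have := hcF.add_smul_sub_mem hu hmem (t := σ / τ) ⟨by positivity, (div_le_one hτ).2 h1⟩
    rwa [add_sub_cancel_left, smul_smul, div_mul_cancel₀ _ hτ.ne'] at this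
  -- Convexity only shrinks the given vector; conicity then enlarges it to the required length.
  have hlarge : u + (r / 4 / (-a)) • (a • d + b • n) ∈ closure F.carrier := by
    have hsmall : 0 < min τ (min (r / 2) (r / 4 / (-a))) := by positivity
    set σ := min τ (min (r / 2) (r / 4 / (-a)))
    have hσr : σ < r := ((min_le_right _ _).trans (min_le_left _ _)).trans_lt (by linarith)
    have hσ' : σ ≤ r / 4 / (-a) := (min_le_right _ _).trans (min_le_right _ _)
    have hn1 : ‖(r / 4 / (-a)) • (a • d + b • n)‖ < r := by
      rw [norm_smul, Real.norm_of_nonneg hσ.le]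
      calc r / 4 / (-a) * ‖a • d + b • n‖ ≤ r / 4 / (-a) * (2 * -a) := by gcongr
        _ = r / 2 := by field_simp; ring
        _ < r := by linarith
    -- use the parameter `r / 2` for the target, which is below `r`
    have h1 : u + σ • (a • d + b • n) ∈ closure F.carrier := hscale σ hsmall (min_le_left _ _)
    have h2 := hc (σ / (r / 4 / (-a)) * (r / 2)) (r / 2)
      ((r / 4 / (-a) / (r / 2)) • (a • d + b • n)) (by positivity) ?_ (by positivity)
      (by linarith) ?_ ?_ ?_
    · rwa [smul_smul, mul_div_cancel₀ _ (by positivity : r / 2 ≠ 0)] at h2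
    · have : σ / (r / 4 / (-a)) ≤ 1 := (div_le_one hσ).2 hσ'
      nlinarith
    · rw [smul_smul, show σ / (r / 4 / (-a)) * (r / 2) * (r / 4 / (-a) / (r / 2)) = σ by
        field_simp]
      refine lt_of_le_of_lt ?_ hn1
      rw [norm_smul, norm_smul, Real.norm_of_nonneg hsmall.le, Real.norm_of_nonneg hσ.le]
      gcongr
    · rwa [smul_smul, mul_div_cancel₀ _ (by positivity : r / 2 ≠ 0)]
    · rwa [smul_smul, show σ / (r / 4 / (-a)) * (r / 2) * (r / 4 / (-a) / (r / 2)) = σ by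
        field_simp]
  refine hb (show u + (r / 4 / (-a)) • (a • d + b • n) ∈ Metric.ball _ η from ?_) hlarge
  rw [Metric.mem_ball, dist_add_left, dist_eq_norm]
  have e1 : (r / 4 / (-a)) • (a • d + b • n) - (-(r / 4)) • d = (r / 4 / (-a) * b) • n := by
    have : r / 4 / (-a) * a = -(r / 4) := by field_simp
    rw [smul_add, smul_smul, smul_smul, this]
    module
  rw [e1, norm_smul, h.norm_n, mul_one, Real.norm_of_nonneg (by positivity)]
  rw [div_mul_eq_mul_div, div_lt_iff₀ hη] at hb2
  rw [div_mul_eq_mul_div, div_lt_iff₀ ha]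
  nlinarith

/-- On the closed face the distance from another crease line is affine along `e` and nonnegative. It
cannot vanish at both ends, since then the two creases would coincide; so it dominates a multiple of
the distance to the nearer end. -/
theorem exists_infDist_crease_ge (h : P.EdgeFrame e.carrier F.carrier u d n L)
    (he : F.BoundedBy e.carrier) : ∃ κ > 0, ∀ e' : P.Crease, e' ≠ e → F.BoundedBy e'.carrier →
      ∀ t, 0 ≤ t → t ≤ L → κ * t ≤ Metric.infDist (u + t • d) e'.line ∨
        κ * (L - t) ≤ Metric.infDist (u + t • d) e'.line := by
  have hL := h.posL
  have := finite_crease (P := P)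
  refine exists_pos_forall_of_finite (p := fun e' κ => e' ≠ e → F.BoundedBy e'.carrier →
      ∀ t, 0 ≤ t → t ≤ L → κ * t ≤ Metric.infDist (u + t • d) e'.line ∨
        κ * (L - t) ≤ Metric.infDist (u + t • d) e'.line) ?_ fun e' => ?_
  · intro e' r r' hle hr h1 h2 t h3 h4
    rcases hr h1 h2 t h3 h4 with h5 | h5
    · exact Or.inl ((mul_le_mul_of_nonneg_right hle h3).trans h5)
    · exact Or.inr ((mul_le_mul_of_nonneg_right hle (by linarith)).trans h5)
  by_cases hne : e' = e
  · exact ⟨1, one_pos, fun h' => (h' hne).elim⟩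
  by_cases hb : F.BoundedBy e'.carrier
  swap
  · exact ⟨1, one_pos, fun _ h' => (hb h').elim⟩
  obtain ⟨u', d', n', L', h'⟩ : ∃ u' d' n' L', P.EdgeFrame e'.carrier F.carrier u' d' n' L' := by
    obtain ⟨u', d', n', L', h'⟩ := e'.isEdge.exists_edgeFrame
    rcases h'.exists_side F.isRegion (hP F) hb with h' | h'
    · exact ⟨_, _, _, _, h'⟩
    · exact ⟨_, _, _, _, h'⟩
  have hu : u ∈ closure F.carrier := he h.start_mem
  have hv : u + L • d ∈ closure F.carrier := he h.end_mem
  have hα := h'.closure_nonneg hu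
  have hβ := h'.closure_nonneg hv
  have hpos : (0 : ℝ) < inner ℝ n' (u - u') + inner ℝ n' (u + L • d - u') := by
    refine (add_nonneg hα hβ).lt_of_ne fun h0 => hne ?_
    have h1 : inner ℝ n' (u - u') = (0 : ℝ) := by linarith
    have h2 : inner ℝ n' (u + L • d - u') = (0 : ℝ) := by linarith
    have m1 := mem_crease_of_mem_line hP hcor h' hb hu (h'.mem_line_iff.2 h1)
    have m2 := mem_crease_of_mem_line hP hcor h' hb hv (h'.mem_line_iff.2 h2)
    have hd0 : u ≠ u + L • d := by
      intro h0
      have : L • d = 0 := by simpa using h0.symm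
      rw [smul_eq_zero] at this
      rcases this with h3 | h3
      · exact hL.ne' h3
      · have := h.norm_d; rw [h3] at this; simp at this
    apply Subtype.ext
    change e'.carrier = e.carrier
    rw [h.carrier, h'.carrier]
    rcases h'.eq_end_of_mem_vertices m1 h.start_vertex with h3 | h3 <;>
      rcases h'.eq_end_of_mem_vertices m2 h.end_vertex with h4 | h4
    · exact (hd0 (h3.trans h4.symm)).elim
    · rw [← h4, h3]
    · rw [← h3, ← h4, segment_symm]
    · exact (hd0 (h3.trans h4.symm)).elim
  -- The slope is the sum of the two end values divided by `L`; each half of the edge is compared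
  -- with its nearer end.
  refine ⟨(inner ℝ n' (u - u') + inner ℝ n' (u + L • d - u')) / L, by positivity,
    fun _ _ t h0 h1 => ?_⟩
  have hmem : u + t • d ∈ closure F.carrier := he (h.mem_iff.2 ⟨t, h0, h1, rfl⟩)
  rw [show e'.line = (affineSpan ℝ e'.carrier : Set Plane) from rfl,
    h'.infDist_of_mem_closure hmem]
  rw [add_sub_right_comm, inner_add_right, inner_smul_right] at hβ hpos ⊢
  rw [add_sub_right_comm u, inner_add_right, inner_smul_right]
  generalize (inner ℝ n' (u - u') : ℝ) = α at *
  generalize (inner ℝ n' d : ℝ) = β at *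
  rcases le_total t (L - t) with ht | ht
  · left
    rw [div_mul_eq_mul_div, div_le_iff₀ hL]
    nlinarith [mul_nonneg hα (by linarith : 0 ≤ L - 2 * t), mul_nonneg h0 hβ]
  · right
    rw [div_mul_eq_mul_div, div_le_iff₀ hL]
    nlinarith [mul_nonneg hβ (by linarith : 0 ≤ 2 * t - L), mul_nonneg (sub_nonneg.2 h1) hα]

end Corner
end CreasePattern


/-! ### Layer order, heights and the folding at a crease. -/

/-- In a finite acyclic graph the reduced graph has the same paths up to refinement. -/
theorem transGen_reducedGraph {α : Type*} [Finite α] {L : α → α → Prop}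
    (hL : ∀ A, ¬ Relation.TransGen L A A) {A B : α} (h : Relation.TransGen L A B) :
    Relation.TransGen (reducedGraph L) A B := by
  -- Induction on the number of nodes between `A` and `B`; acyclicity makes it drop when a path is
  -- split at an intermediate node.
  suffices H : ∀ (k : ℕ) (A B : α), {C | Relation.TransGen L A C ∧
      Relation.TransGen L C B}.ncard = k → Relation.TransGen L A B →
      Relation.TransGen (reducedGraph L) A B from H _ A B rfl h
  intro k
  induction k using Nat.strong_induction_on with
  | _ k ih =>
    intro A B hk hAB
    by_cases hC : ∃ C, Relation.TransGen L A C ∧ Relation.TransGen L C B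
    · obtain ⟨C, h1, h2⟩ := hC
      have l1 : {D | Relation.TransGen L A D ∧ Relation.TransGen L D C}.ncard < k := by
        rw [← hk]
        refine Set.ncard_lt_ncard ⟨fun D hD => ⟨hD.1, hD.2.trans h2⟩, fun hsub => ?_⟩ (Set.toFinite _)
        exact hL C (hsub (show C ∈ {D | _ ∧ _} from ⟨h1, h2⟩)).2
      have l2 : {D | Relation.TransGen L C D ∧ Relation.TransGen L D B}.ncard < k := by
        rw [← hk]
        refine Set.ncard_lt_ncard ⟨fun D hD => ⟨h1.trans hD.1, hD.2⟩, fun hsub => ?_⟩ (Set.toFinite _)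
        exact hL C (hsub (show C ∈ {D | _ ∧ _} from ⟨h1, h2⟩)).1
      exact (ih _ l1 A C rfl h1).trans (ih _ l2 C B rfl h2)
    · refine Relation.TransGen.single ⟨?_, hC⟩
      cases hAB with
      | single h => exact h
      | tail h1 h2 => exact (hC ⟨_, h1, .single h2⟩).elim

theorem IsFrame.map {d n : Plane} (h : IsFrame d n) (a : Plane ≃ₗᵢ[ℝ] Plane) :
    IsFrame (a d) (a n) where
  dd := by rw [a.inner_map_map, h.dd]
  nn := by rw [a.inner_map_map, h.nn]
  dn := by rw [a.inner_map_map, h.dn]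
  decomp y := by
    have := congrArg a (h.decomp (a.symm y))
    simp only [map_add, map_smul, LinearIsometryEquiv.apply_symm_apply] at this
    have e : ∀ x, inner ℝ x (a.symm y) = (inner ℝ (a x) y : ℝ) := fun x => by
      rw [← a.inner_map_map, a.apply_symm_apply]
    rwa [e, e] at this

theorem AffineIsometryEquiv.map_coord (g : Plane ≃ᵃⁱ[ℝ] Plane) (u d n : Plane) (t k : ℝ) :
    g (u + t • d + k • n) =
      g u + t • g.linearIsometryEquiv d + k • g.linearIsometryEquiv n := by
  have h : ∀ y, g (u + y) = g u + g.linearIsometryEquiv y := fun y => by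
    have := g.map_vadd u y
    rwa [vadd_eq_add, vadd_eq_add, add_comm, add_comm _ (g u)] at this
  rw [add_assoc, h, map_add, map_smul, map_smul, add_assoc]

/-- Two isometries with determinants of opposite signs that agree on a segment differ by the
reflection in its line. -/
theorem AffineIsometryEquiv.eq_reflect {a b : Plane ≃ᵃⁱ[ℝ] Plane} {u d n : Plane} {L : ℝ}
    (h : IsFrame d n) (hL : 0 < L) (h0 : a u = b u) (h1 : a (u + L • d) = b (u + L • d))
    (hdet : LinearMap.det (a.linearIsometryEquiv.toLinearEquiv : Plane →ₗ[ℝ] Plane) *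
      LinearMap.det (b.linearIsometryEquiv.toLinearEquiv : Plane →ₗ[ℝ] Plane) < 0) (t k : ℝ) :
    b (u + t • d - k • n) = a (u + t • d + k • n) := by
  have hd : a.linearIsometryEquiv d = b.linearIsometryEquiv d := by
    have ha := a.map_coord u d n L 0
    have hb := b.map_coord u d n L 0
    simp only [zero_smul, add_zero] at ha hb
    rw [ha, hb, h0, add_right_inj] at h1
    exact smul_right_injective Plane hL.ne' h1
  have fa := h.map a.linearIsometryEquiv
  have fb := h.map b.linearIsometryEquiv
  -- The linear parts agree on `d`, so both images of `n` are unit normals to the same direction.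
  -- Equal signs would make the linear parts equal and the product of determinants a square.
  have hn : b.linearIsometryEquiv n =
      (inner ℝ (a.linearIsometryEquiv n) (b.linearIsometryEquiv n) : ℝ) •
        a.linearIsometryEquiv n := by
    have := fa.decomp (b.linearIsometryEquiv n)
    rwa [hd, fb.dn, zero_smul, zero_add] at this
  set c : ℝ := inner ℝ (a.linearIsometryEquiv n) (b.linearIsometryEquiv n)
  have hc : |c| = 1 := by
    have := congrArg norm hn
    rwa [norm_smul, fa.norm_n, fb.norm_n, mul_one, Real.norm_eq_abs, eq_comm] at this
  rcases (abs_eq zero_le_one).1 hc with hc | hc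
  · exfalso
    have heq : (a.linearIsometryEquiv.toLinearEquiv : Plane →ₗ[ℝ] Plane) =
        (b.linearIsometryEquiv.toLinearEquiv : Plane →ₗ[ℝ] Plane) := by
      ext1 y
      change a.linearIsometryEquiv y = b.linearIsometryEquiv y
      rw [h.decomp y, map_add, map_add, map_smul, map_smul, map_smul, map_smul, hn, hc, hd,
        one_smul]
    rw [heq] at hdet
    exact absurd hdet (not_lt.2 (mul_self_nonneg _))
  · rw [sub_eq_add_neg, ← neg_smul, a.map_coord, b.map_coord, hn, hc, h0, hd]
    module

namespace FlatFoldedState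
variable {S : FlatFoldedState}

theorem finite_face : Finite S.pattern.Face := CreasePattern.finite_face S.convex

theorem exists_isometry (F : S.pattern.Face) :
    ∃ g : Plane ≃ᵃⁱ[ℝ] Plane, ∀ x ∈ closure F.carrier, S.fold x = g x :=
  S.isFlatMapping.1 F

theorem exists_pathWeight_of_transGen (ω : S.WeightAssignment) {A B : S.pattern.Face}
    (h : Relation.TransGen S.graph A B) : ∃ t, 0 < t ∧ S.PathWeight ω.weight A B t := by
  induction h with
  | single h => exact ⟨_, by simpa using ω.pos _ _ h, PathWeight.refl.up h⟩
  | tail _ h ih =>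
    obtain ⟨t, ht, hp⟩ := ih
    exact ⟨_, add_pos ht (ω.pos _ _ h), hp.up h⟩

theorem transGen_of_layer {A B : S.pattern.Face} (h : S.layer A B) :
    Relation.TransGen S.graph A B := by
  have := S.finite_face
  exact transGen_reducedGraph S.acyclic (.single h)

section Heights
variable {ω : S.WeightAssignment} {h : S.pattern.Face → ℝ} (hh : ω.IsHeight h)
include hh

theorem exists_pathWeight_of_layer {A B : S.pattern.Face} (hl : S.layer A B) :
    S.PathWeight ω.weight A B (h B - h A) ∧ h A < h B := by
  obtain ⟨t, ht, hp⟩ := exists_pathWeight_of_transGen ω (transGen_of_layer hl)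
  have := hh A B t hp
  constructor
  · rwa [this, add_sub_cancel_left]
  · linarith

/-- Overlapping faces are always comparable, and weights are positive along upward paths; so heights
recover the orientation. This turns a geometric meeting in the folding into a statement about the
layer order. -/
theorem layer_of_lt {A B : S.pattern.Face} (ho : FaceOverlap S.fold A B) (hlt : h A < h B) :
    S.layer A B := by
  have hne : A ≠ B := by rintro rfl; exact hlt.false
  rcases (S.isLayerOrdering.2 A B hne ho) with h1 | h1
  · exact h1.1
  · exact absurd (exists_pathWeight_of_layer hh h1.1).2 hlt.not_gt

theorem height_ne {A B : S.pattern.Face} (hne : A ≠ B) (ho : FaceOverlap S.fold A B) :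
    h A ≠ h B := by
  rcases (S.isLayerOrdering.2 A B hne ho) with h1 | h1
  · exact (exists_pathWeight_of_layer hh h1.1).2.ne
  · exact (exists_pathWeight_of_layer hh h1.1).2.ne'

end Heights

/-- A crease in coordinates, with its lower and its upper face and the isometry which folds
the lower one. -/
structure CreaseFrame (ω : S.WeightAssignment) (h : S.pattern.Face → ℝ) (e : S.pattern.Crease)
    (A B : S.pattern.Face) (u d n : Plane) (L : ℝ) (g : Plane ≃ᵃⁱ[ℝ] Plane) : Prop where
  lower : S.pattern.EdgeFrame e.carrier A.carrier u d n L
  upper : S.pattern.EdgeFrame e.carrier B.carrier u d (-n) L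
  boundedBy_lower : A.BoundedBy e.carrier
  boundedBy_upper : B.BoundedBy e.carrier
  eq_or_eq : ∀ F : S.pattern.Face, F.BoundedBy e.carrier → F = A ∨ F = B
  ne : A ≠ B
  lt : h A < h B
  width_eq : ω.width e = h B - h A
  fold_lower : ∀ x ∈ closure A.carrier, S.fold x = g x
  fold_upper : ∀ t k : ℝ, u + t • d - k • n ∈ closure B.carrier →
    S.fold (u + t • d - k • n) = g (u + t • d + k • n)

/-- The two faces at a crease are folded to the same side of it, so they overlap and the layer order
decides which one is lower; the width is then their difference in height. -/
theorem exists_creaseFrame {ω : S.WeightAssignment} {h : S.pattern.Face → ℝ}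
    (hh : ω.IsHeight h) (e : S.pattern.Crease) :
    ∃ A B u d n L g, CreaseFrame ω h e A B u d n L g := by
  obtain ⟨A, B, u, d, n, L, hAB, hA, hB, fA, fB, only⟩ := e.exists_faces S.convex
  have hL := fA.posL
  -- both faces are folded to the same side
  have hrefl : ∀ gA gB : Plane ≃ᵃⁱ[ℝ] Plane, (∀ x ∈ closure A.carrier, S.fold x = gA x) →
      (∀ x ∈ closure B.carrier, S.fold x = gB x) →
      ∀ t k : ℝ, gB (u + t • d - k • n) = gA (u + t • d + k • n) := by
    intro gA gB h1 h2
    refine AffineIsometryEquiv.eq_reflect fA.toIsFrame hL ?_ ?_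
      (S.isFlatMapping.2 e A B hAB hA hB gA gB h1 h2)
    · rw [← h1 _ (hA fA.start_mem), ← h2 _ (hB fA.start_mem)]
    · rw [← h1 _ (hA fA.end_mem), ← h2 _ (hB fA.end_mem)]
  obtain ⟨gA, hgA⟩ := exists_isometry A
  obtain ⟨gB, hgB⟩ := exists_isometry B
  -- Points at equal offset on both sides of the midpoint of the crease fold onto each other; the
  -- offset fits under the tents of both faces.
  have hover : FaceOverlap S.fold A B := by
    obtain ⟨κ, hκ, H⟩ := fA.mem_of_le (S.convex A) hA
    obtain ⟨κ', hκ', H'⟩ := fB.mem_of_le (S.convex B) hB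
    have hk : 0 < min κ κ' * (L / 2) := by positivity
    have h1 := H (L / 2) _ hk (by gcongr; exact min_le_left _ _) (by
      rw [sub_half]; gcongr; exact min_le_left _ _)
    have h2 := H' (L / 2) _ hk (by gcongr; exact min_le_right _ _) (by
      rw [sub_half]; gcongr; exact min_le_right _ _)
    refine ⟨_, ⟨_, h1, rfl⟩, ⟨_, h2, ?_⟩⟩
    rw [hgA _ (subset_closure h1), hgB _ (subset_closure h2), smul_neg, ← sub_eq_add_neg]
    exact hrefl gA gB hgA hgB _ _
  have hwidth : ∀ A B : S.pattern.Face, A.BoundedBy e.carrier → B.BoundedBy e.carrier →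
      (∀ F : S.pattern.Face, F.BoundedBy e.carrier → F = A ∨ F = B) → S.layer A B →
      ω.width e = h B - h A := by
    intro A B hA hB only hl
    obtain ⟨hp, hlt⟩ := exists_pathWeight_of_layer hh hl
    have hg : IsGreatest {t | ∃ A B : S.pattern.Face, A.BoundedBy e.carrier ∧
        B.BoundedBy e.carrier ∧ S.PathWeight ω.weight A B t} (h B - h A) := by
      refine ⟨⟨A, B, hA, hB, hp⟩, ?_⟩
      rintro t ⟨C, D, hC, hD, ht⟩
      have := hh C D t ht
      rcases only C hC with rfl | rfl <;> rcases only D hD with rfl | rfl <;> linarith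
    exact hg.csSup_eq
  rcases S.isLayerOrdering.2 A B hAB hover with hl | hl
  · refine ⟨A, B, u, d, n, L, gA, fA, fB, hA, hB, only, hAB,
      (exists_pathWeight_of_layer hh hl.1).2, hwidth A B hA hB only hl.1, hgA, fun t k hm => ?_⟩
    rw [hgB _ hm, hrefl gA gB hgA hgB]
  -- If `B` is the lower face the roles are exchanged and the normal is reversed.
  · have only' : ∀ F : S.pattern.Face, F.BoundedBy e.carrier → F = B ∨ F = A :=
      fun F hF => (only F hF).symm
    refine ⟨B, A, u, d, -n, L, gB, fB, by rwa [neg_neg], hB, hA, only', hAB.symm,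
      (exists_pathWeight_of_layer hh hl.1).2, hwidth B A hB hA only' hl.1, hgB,
      fun t k hm => ?_⟩
    rw [smul_neg, sub_neg_eq_add] at hm ⊢
    rw [hgA _ hm, ← sub_eq_add_neg, hrefl gA gB hgA hgB]

end FlatFoldedState


/-! ### Scaled half-planes -/

/-- Off the limit line `⟪p, z - v⟫ = 0` the shift `s * k` is too small to matter near `z`; on it the
condition on `z + s • y` is `k ≤ ⟪p, y⟫` multiplied by `s`. -/
theorem conicAt_halfPlane (p v z : Plane) (k : ℝ) :
    ConicAt z fun s => {x : Plane | s * k ≤ inner ℝ p (x - v)} := by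
  have hbound : ∀ x : Plane, |(inner ℝ p (x - v) : ℝ) - inner ℝ p (z - v)| ≤ ‖p‖ * ‖x - z‖ := by
    intro x
    rw [← inner_sub_right, sub_sub_sub_cancel_right]
    exact abs_real_inner_le_norm _ _
  have hC : 0 < ‖p‖ + |k| + 1 := by positivity
  rcases lt_trichotomy (inner ℝ p (z - v) : ℝ) 0 with hlt | heq | hgt
  · refine ConicAt.of_eventually_notMem (r := -(inner ℝ p (z - v) : ℝ) / (‖p‖ + |k| + 1))
      (div_pos (by linarith) hC) fun s x hs hsr hx hmem => ?_
    have hmem : s * k ≤ inner ℝ p (x - v) := hmem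
    rw [lt_div_iff₀ hC] at hsr hx
    have h1 := (abs_le.1 (hbound x)).2
    have h2 : s * -|k| ≤ s * k := by gcongr; exact neg_abs_le k
    rcases le_total s ‖x - z‖ with h3 | h3
    · nlinarith [abs_nonneg k, norm_nonneg p, norm_nonneg (x - z)]
    · nlinarith [abs_nonneg k, norm_nonneg p, norm_nonneg (x - z)]
  · refine ⟨1, one_pos, fun s s' y h1 _ h3 _ _ _ hy => ?_⟩
    have hy : s * k ≤ inner ℝ p (z + s • y - v) := hy
    change s' * k ≤ inner ℝ p (z + s' • y - v)
    rw [add_sub_right_comm, inner_add_right, heq, inner_smul_right, zero_add] at hy ⊢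
    exact mul_le_mul_of_nonneg_left (le_of_mul_le_mul_left hy h1) h3.le
  · refine ConicAt.of_eventually_mem (r := (inner ℝ p (z - v) : ℝ) / (‖p‖ + |k| + 1))
      (div_pos hgt hC) fun s x hs hsr hx => ?_
    change s * k ≤ inner ℝ p (x - v)
    rw [lt_div_iff₀ hC] at hsr hx
    have h1 := (abs_le.1 (hbound x)).1
    have h2 : s * k ≤ s * |k| := by gcongr; exact le_abs_self k
    rcases le_total s ‖x - z‖ with h3 | h3
    · nlinarith [abs_nonneg k, norm_nonneg p, norm_nonneg (x - z)]
    · nlinarith [abs_nonneg k, norm_nonneg p, norm_nonneg (x - z)]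

theorem convex_halfPlane (p v : Plane) (k : ℝ) :
    Convex ℝ {x : Plane | k ≤ inner ℝ p (x - v)} := by
  have : {x : Plane | k ≤ inner ℝ p (x - v)} = {x | k + inner ℝ p v ≤ (innerSL ℝ p).toLinearMap x} := by
    ext x
    simp [inner_sub_right, le_sub_iff_add_le]
  rw [this]
  exact convex_halfSpace_ge (innerSL ℝ p).toLinearMap.isLinear _

theorem isClosed_halfPlane (p v : Plane) (k : ℝ) :
    IsClosed {x : Plane | k ≤ inner ℝ p (x - v)} :=
  isClosed_le continuous_const (by fun_prop)

/-! ### Reduced faces as intersections of scaled half-planes. -/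

namespace FlatFoldedState
variable {S : FlatFoldedState}

theorem exists_edgeFrame {F : S.pattern.Face} {e : S.pattern.Crease}
    (he : F.BoundedBy e.carrier) :
    ∃ u d n L, S.pattern.EdgeFrame e.carrier F.carrier u d n L := by
  obtain ⟨u, d, n, L, h⟩ := e.isEdge.exists_edgeFrame
  rcases h.exists_side F.isRegion (S.convex F) he with h' | h'
  · exact ⟨_, _, _, _, h'⟩
  · exact ⟨_, _, _, _, h'⟩

/-- A face cut off at half the widths of its creases, without trimming. -/
def untrimmedFace (ω : S.WeightAssignment) (s : ℝ) (F : S.pattern.Face) : Set Plane :=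
  {x ∈ closure F.carrier | ∀ e : S.pattern.Crease, F.BoundedBy e.carrier →
    s * (ω.width e / 2) ≤ Metric.infDist x e.line}

/-- The line passes through `v`, so distance from it is homogeneous about `v`. -/
theorem infDist_line_smul {e : S.pattern.Crease} {v : Plane} (hv : v ∈ e.carrier) {s : ℝ}
    (hs : 0 < s) (y : Plane) :
    Metric.infDist (v + s • y) e.line = s * Metric.infDist (v + y) e.line := by
  obtain ⟨u, d, n, L, h⟩ := e.isEdge.exists_edgeFrame
  have h0 : inner ℝ n (v - u) = (0 : ℝ) := h.mem_line_iff.1 (subset_affineSpan ℝ _ hv)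
  rw [show e.line = (affineSpan ℝ e.carrier : Set Plane) from rfl, h.infDist_line, h.infDist_line,
    add_sub_right_comm, add_sub_right_comm, inner_add_right, inner_add_right, h0,
    inner_smul_right, zero_add, zero_add, abs_mul, abs_of_pos hs]

variable {ω : S.WeightAssignment}

theorem mem_sector_of_mem_untrimmedFace {s : ℝ} (hs : 0 < s) {F : S.pattern.Face} {v y : Plane}
    (hx : v + s • y ∈ untrimmedFace ω s F) : y ∈ ω.sector F v := by
  refine ⟨⟨s, hs, hx.1⟩, fun e hve he => ?_⟩
  have := hx.2 e he
  rw [infDist_line_smul hve hs] at this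
  exact le_of_mul_le_mul_left this hs

/-- The sector conditions at the various vertices, scaled back, merge into conditions on the crease
lines alone, since every crease of the face starts at a vertex. Only the trimming half-planes still
depend on the vertex. -/
theorem mem_reducedFace_iff {c : S.Trimming} {s : ℝ} (hs : 0 < s) {F : S.pattern.Face}
    {x : Plane} : x ∈ ω.reducedFace c s F ↔ x ∈ untrimmedFace ω s F ∧
      ∀ v ∈ S.pattern.vertices, v ∈ closure F.carrier → ∀ p ∈ c F v,
        s * p.2 ≤ inner ℝ p.1 (x - v) := by
  constructor
  · rintro ⟨hxF, hx⟩
    refine ⟨⟨hxF, fun e he => ?_⟩, fun v hv hvF p hp => ?_⟩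
    · obtain ⟨u, d, n, L, h⟩ := exists_edgeFrame he
      obtain ⟨y, hy, rfl⟩ := hx u h.start_vertex (he h.start_mem)
      rw [infDist_line_smul h.start_mem hs]
      exact mul_le_mul_of_nonneg_left (hy.1.2 e h.start_mem he) hs.le
    · obtain ⟨y, hy, rfl⟩ := hx v hv hvF
      rw [add_sub_cancel_left, inner_smul_right]
      exact mul_le_mul_of_nonneg_left (hy.2 p hp) hs.le
  · rintro ⟨hx, hx'⟩
    refine ⟨hx.1, fun v hv hvF => ?_⟩
    have hy : x = v + s • (s⁻¹ • (x - v)) := by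
      rw [smul_smul, mul_inv_cancel₀ hs.ne', one_smul, add_sub_cancel]
    refine ⟨s⁻¹ • (x - v), ⟨mem_sector_of_mem_untrimmedFace hs (hy ▸ hx), fun p hp => ?_⟩, hy⟩
    have := hx' v hv hvF p hp
    rw [inner_smul_right, inv_mul_eq_div, le_div_iff₀ hs, mul_comm]
    exact this

/-- On one side of a line the distance from it is a linear function, so the cut along each bounding
crease is a half-plane. For other creases the trivial half-plane serves as a filler. -/
theorem untrimmedFace_eq (ω : S.WeightAssignment) (F : S.pattern.Face) :
    ∃ (n u : S.pattern.Crease → Plane) (k : S.pattern.Crease → ℝ), ∀ s,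
      untrimmedFace ω s F =
        closure F.carrier ∩ {x | ∀ e, x ∈ {x : Plane | s * k e ≤ inner ℝ (n e) (x - u e)}} := by
  have : ∀ e : S.pattern.Crease, ∃ (n u : Plane) (k : ℝ), ∀ s, ∀ x ∈ closure F.carrier,
      (F.BoundedBy e.carrier → s * (ω.width e / 2) ≤ Metric.infDist x e.line) ↔
        s * k ≤ inner ℝ n (x - u) := by
    intro e
    by_cases he : F.BoundedBy e.carrier
    · obtain ⟨u, d, n, L, h⟩ := exists_edgeFrame he
      refine ⟨n, u, ω.width e / 2, fun s x hx => ?_⟩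
      rw [show e.line = (affineSpan ℝ e.carrier : Set Plane) from rfl, h.infDist_of_mem_closure hx]
      simp [he]
    · exact ⟨0, 0, 0, fun s x _ => by simp [he]⟩
  choose n u k H using this
  refine ⟨n, u, k, fun s => Set.ext fun x => ⟨fun hx => ⟨hx.1, fun e => ?_⟩,
    fun hx => ⟨hx.1, fun e => ?_⟩⟩⟩
  · exact (H e s x hx.1).1 (hx.2 e)
  · exact (H e s x hx.1).2 (hx.2 e)

theorem conicAt_untrimmedFace (ω : S.WeightAssignment) (F : S.pattern.Face) (z : Plane) :
    ConicAt z fun s => untrimmedFace ω s F := by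
  obtain ⟨n, u, k, H⟩ := untrimmedFace_eq ω F
  simp only [H]
  have := CreasePattern.finite_crease (P := S.pattern)
  exact (F.isRegion.conicAt z).closure.inter
    (ConicAt.iInter (Q := fun e s => {x : Plane | s * k e ≤ inner ℝ (n e) (x - u e)}) fun e =>
      conicAt_halfPlane _ _ _ _)

theorem convex_untrimmedFace (ω : S.WeightAssignment) (F : S.pattern.Face) (s : ℝ) :
    Convex ℝ (untrimmedFace ω s F) := by
  obtain ⟨n, u, k, H⟩ := untrimmedFace_eq ω F
  rw [H]
  refine (S.convex F).closure.inter ?_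
  rw [show {x : Plane | ∀ e, x ∈ {x : Plane | s * k e ≤ inner ℝ (n e) (x - u e)}} =
    ⋂ e, {x : Plane | s * k e ≤ inner ℝ (n e) (x - u e)} by ext; simp]
  exact convex_iInter fun e => convex_halfPlane _ _ _

theorem isClosed_untrimmedFace (ω : S.WeightAssignment) (F : S.pattern.Face) (s : ℝ) :
    IsClosed (untrimmedFace ω s F) := by
  obtain ⟨n, u, k, H⟩ := untrimmedFace_eq ω F
  rw [H]
  refine isClosed_closure.inter ?_
  rw [show {x : Plane | ∀ e, x ∈ {x : Plane | s * k e ≤ inner ℝ (n e) (x - u e)}} =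
    ⋂ e, {x : Plane | s * k e ≤ inner ℝ (n e) (x - u e)} by ext; simp]
  exact isClosed_iInter fun e => isClosed_halfPlane _ _ _

/-- The scaled half-planes trimming the face `F`. -/
abbrev TrimIndex (c : S.Trimming) (F : S.pattern.Face) : Type :=
  Σ v : {v : S.pattern.vertices // (v : Plane) ∈ closure F.carrier}, {p // p ∈ c F v.1.1}

theorem reducedFace_eq (ω : S.WeightAssignment) (c : S.Trimming) (F : S.pattern.Face) {s : ℝ}
    (hs : 0 < s) : ω.reducedFace c s F = untrimmedFace ω s F ∩
      {x | ∀ i : TrimIndex c F,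
        x ∈ {x : Plane | s * i.2.1.2 ≤ inner ℝ i.2.1.1 (x - i.1.1.1)}} := by
  ext x
  rw [mem_reducedFace_iff hs]
  exact ⟨fun h => ⟨h.1, fun i => h.2 _ i.1.1.2 i.1.2 _ i.2.2⟩,
    fun h => ⟨h.1, fun v hv hvF p hp => h.2 ⟨⟨⟨v, hv⟩, hvF⟩, ⟨p, hp⟩⟩⟩⟩

theorem conicAt_reducedFace (ω : S.WeightAssignment) (c : S.Trimming) (F : S.pattern.Face)
    (z : Plane) : ConicAt z fun s => ω.reducedFace c s F := by
  refine ConicAt.congr one_pos ((conicAt_untrimmedFace ω F z).inter (ConicAt.iInter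
    (Q := fun (i : TrimIndex c F) s =>
      {x : Plane | s * i.2.1.2 ≤ inner ℝ i.2.1.1 (x - i.1.1.1)}) fun i =>
        conicAt_halfPlane _ _ _ _)) fun s hs _ => (reducedFace_eq ω c F hs).symm

theorem convex_reducedFace (ω : S.WeightAssignment) (c : S.Trimming) (F : S.pattern.Face) {s : ℝ}
    (hs : 0 < s) : Convex ℝ (ω.reducedFace c s F) := by
  rw [reducedFace_eq ω c F hs]
  refine (convex_untrimmedFace ω F s).inter ?_
  rw [show {x : Plane | ∀ i : TrimIndex c F,
        x ∈ {x : Plane | s * i.2.1.2 ≤ inner ℝ i.2.1.1 (x - i.1.1.1)}} =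
    ⋂ i : TrimIndex c F, {x : Plane | s * i.2.1.2 ≤ inner ℝ i.2.1.1 (x - i.1.1.1)} by ext; simp]
  exact convex_iInter fun e => convex_halfPlane _ _ _

theorem isClosed_reducedFace (ω : S.WeightAssignment) (c : S.Trimming) (F : S.pattern.Face) {s : ℝ}
    (hs : 0 < s) : IsClosed (ω.reducedFace c s F) := by
  rw [reducedFace_eq ω c F hs]
  refine (isClosed_untrimmedFace ω F s).inter ?_
  rw [show {x : Plane | ∀ i : TrimIndex c F,
        x ∈ {x : Plane | s * i.2.1.2 ≤ inner ℝ i.2.1.1 (x - i.1.1.1)}} =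
    ⋂ i : TrimIndex c F, {x : Plane | s * i.2.1.2 ≤ inner ℝ i.2.1.1 (x - i.1.1.1)} by ext; simp]
  exact isClosed_iInter fun e => isClosed_halfPlane _ _ _

theorem reducedFace_subset_untrimmedFace (ω : S.WeightAssignment) (c : S.Trimming)
    (F : S.pattern.Face) {s : ℝ} (hs : 0 < s) : ω.reducedFace c s F ⊆ untrimmedFace ω s F :=
  fun _ hx => ((mem_reducedFace_iff hs).1 hx).1

/-- Only bounded parts of the sectors are trimmed away. -/
def IsBoundedTrimming (ω : S.WeightAssignment) (c : S.Trimming) : Prop :=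
  ∀ (F : S.pattern.Face), ∀ v ∈ S.pattern.vertices, v ∈ closure F.carrier →
    Bornology.IsBounded (ω.sector F v \ ω.trimmedSector c F v)

section BoundedTrimming
variable {c : S.Trimming} (hc : IsBoundedTrimming ω c)
include hc

/-- The trimmed parts are finitely many bounded sets, so at scale `s` they lie within `s * K` of the
vertices; farther out, trimming has no effect. -/
theorem exists_mem_reducedFace_of_far (F : S.pattern.Face) : ∃ K > 0, ∀ s x, 0 < s →
    x ∈ untrimmedFace ω s F →
    (∀ v ∈ S.pattern.vertices, v ∈ closure F.carrier → s * K ≤ dist x v) →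
    x ∈ ω.reducedFace c s F := by
  have hb : Bornology.IsBounded (⋃ v ∈ {v ∈ (S.pattern.vertices : Set Plane) |
      v ∈ closure F.carrier}, ω.sector F v \ ω.trimmedSector c F v) := by
    rw [Bornology.isBounded_biUnion (S.pattern.vertices.finite_toSet.subset fun v hv => hv.1)]
    exact fun v hv => hc F v hv.1 hv.2
  obtain ⟨K, hK⟩ := hb.exists_norm_le
  refine ⟨|K| + 1, by positivity, fun s x hs hx hfar => ⟨hx.1, fun v hv hvF => ?_⟩⟩
  have hy : x = v + s • (s⁻¹ • (x - v)) := by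
    rw [smul_smul, mul_inv_cancel₀ hs.ne', one_smul, add_sub_cancel]
  refine ⟨s⁻¹ • (x - v), ?_, hy⟩
  by_contra hnot
  have hsec : s⁻¹ • (x - v) ∈ ω.sector F v := mem_sector_of_mem_untrimmedFace hs (hy ▸ hx)
  have h1 := hK _ (mem_biUnion (show v ∈ {v ∈ (S.pattern.vertices : Set Plane) |
      v ∈ closure F.carrier} from ⟨hv, hvF⟩) ⟨hsec, hnot⟩)
  rw [norm_smul, norm_inv, Real.norm_of_nonneg hs.le, inv_mul_le_iff₀ hs, ← dist_eq_norm] at h1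
  have h2 := hfar v hv hvF
  nlinarith [le_abs_self K]

/-- An inner point has positive distance from all bounding crease lines and all vertices, while
every cut reaches only to distance of order `s`. -/
theorem exists_ball_subset_reducedFace {F : S.pattern.Face} {p : Plane} (hp : p ∈ F.carrier) :
    ∃ ρ > 0, ∀ s, 0 < s → s < ρ → Metric.ball p ρ ⊆ ω.reducedFace c s F := by
  obtain ⟨ρ, hρ, hb⟩ := Metric.isOpen_iff.1 F.isOpen p hp
  obtain ⟨K, hK, H⟩ := exists_mem_reducedFace_of_far hc F
  have := CreasePattern.finite_crease (P := S.pattern)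
  obtain ⟨σ, hσ, Hσ⟩ := exists_pos_forall_of_finite
    (p := fun (e : S.pattern.Crease) r => r * (|ω.width e| / 2) ≤ ρ / 2)
    (fun e r r' hle h => (mul_le_mul_of_nonneg_right hle (by positivity)).trans h)
    (fun e => ⟨ρ / (|ω.width e| + 1), by positivity, by
      rw [div_mul_div_comm, div_le_div_iff₀ (by positivity) (by positivity)]
      nlinarith [abs_nonneg (ω.width e)]⟩)
  refine ⟨min (ρ / 2) (min σ (ρ / 2 / K)), by positivity, fun s hs hsr x hx => ?_⟩
  have hsσ : s ≤ σ := hsr.le.trans ((min_le_right _ _).trans (min_le_left _ _))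
  have hsK : s ≤ ρ / 2 / K := hsr.le.trans ((min_le_right _ _).trans (min_le_right _ _))
  rw [le_div_iff₀ hK] at hsK
  have hxp : dist x p < ρ / 2 := lt_of_lt_of_le hx (min_le_left _ _)
  have hball : ∀ y, dist x y < ρ / 2 → y ∈ F.carrier := fun y hy => hb (by
    rw [Metric.mem_ball]
    linarith [dist_triangle_left y p x])
  have hxF : x ∈ F.carrier := hball x (by simpa using hρ)
  refine H s x hs ⟨subset_closure hxF, fun e he => ?_⟩ fun v hv hvF => ?_
  · obtain ⟨u, d, n, L, h⟩ := exists_edgeFrame he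
    have h1 : ρ / 2 ≤ Metric.infDist x e.line := by
      refine (Metric.le_infDist (s := e.line) ⟨u, subset_affineSpan ℝ _ h.start_mem⟩).2
        fun {y} hy => ?_
      by_contra hlt
      rw [not_le] at hlt
      have h2 := h.pos y (hball y hlt)
      have h3 : inner ℝ n (y - u) = (0 : ℝ) := h.mem_line_iff.1 hy
      linarith
    calc s * (ω.width e / 2) ≤ s * (|ω.width e| / 2) := by gcongr; exact le_abs_self _
      _ ≤ σ * (|ω.width e| / 2) := by gcongr
      _ ≤ ρ / 2 := Hσ e
      _ ≤ _ := h1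
  · by_contra hlt
    rw [not_le] at hlt
    exact F.isRegion.notMem_skeleton (hball v (by linarith)) (Or.inl hv)

/-- The local pictures of a reduced face at the points of the closed face are fat. -/
theorem nonempty_interior_localPicture_reducedFace {F : S.pattern.Face} {z : Plane}
    (hz : z ∈ closure F.carrier) :
    (interior (localPicture z fun s => ω.reducedFace c s F)).Nonempty := by
  obtain ⟨r, hr, hcon⟩ := conicAt_reducedFace ω c F z
  obtain ⟨p, hpb, hp⟩ := mem_closure_iff.1 hz _ Metric.isOpen_ball
    (Metric.mem_ball_self (half_pos hr))
  obtain ⟨ρ, hρ, H⟩ := exists_ball_subset_reducedFace hc hp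
  have hs : 0 < min r ρ / 2 := by positivity
  set s := min r ρ / 2
  have hsr : s < r := by
    have := min_le_left r ρ
    simp only [s]; linarith [lt_min hr hρ]
  have hsρ : s < ρ := by
    have := min_le_right r ρ
    simp only [s]; linarith [lt_min hr hρ]
  refine ⟨s⁻¹ • (p - z), mem_interior.2 ⟨(fun y => z + s • y) ⁻¹'
    (Metric.ball p ρ ∩ Metric.ball z r), fun y hy => ?_, ?_, ?_⟩⟩
  · refine (hcon.mem_localPicture_iff hs hsr ?_).2 (H s hs hsρ hy.1)
    have := hy.2
    rwa [Metric.mem_ball, dist_eq_norm, add_sub_cancel_left] at this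
  · exact (Metric.isOpen_ball.inter Metric.isOpen_ball).preimage (by fun_prop)
  · have : z + s • s⁻¹ • (p - z) = p := by
      rw [smul_smul, mul_inv_cancel₀ hs.ne', one_smul, add_sub_cancel]
    rw [mem_preimage, this]
    exact ⟨Metric.mem_ball_self hρ, Metric.mem_ball.2 (lt_trans hpb (by linarith))⟩

end BoundedTrimming
end FlatFoldedState


/-! ### New creases as segments with ends displaced proportionally to the scale. -/

namespace FlatFoldedState
variable {S : FlatFoldedState} {ω : S.WeightAssignment}

theorem exists_width_le (ω : S.WeightAssignment) :
    ∃ W, 0 < W ∧ ∀ e : S.pattern.Crease, ω.width e ≤ W := by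
  have := CreasePattern.finite_crease (P := S.pattern)
  obtain ⟨W, hW⟩ := (Set.finite_range ω.width).bddAbove
  exact ⟨max W 1, by positivity, fun e => (hW (mem_range_self e)).trans (le_max_left _ _)⟩

section NewCrease
variable (hcor : S.pattern.NoStraightCorner)
  {e : S.pattern.Crease} {F : S.pattern.Face} {u d n : Plane} {L : ℝ}
  (h : S.pattern.EdgeFrame e.carrier F.carrier u d n L) (he : F.BoundedBy e.carrier)
include h

theorem mem_newCrease_iff {c : S.Trimming} {s : ℝ} {x : Plane} :
    x ∈ ω.newCrease c s e F ↔ ∃ t : ℝ, x = u + t • d + (s * (ω.width e / 2)) • n ∧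
      u + t • d + (s * (ω.width e / 2)) • n ∈ ω.reducedFace c s F := by
  constructor
  · rintro ⟨hx, hd⟩
    rw [show e.line = (affineSpan ℝ e.carrier : Set Plane) from rfl,
      h.infDist_of_mem_closure hx.1] at hd
    obtain ⟨t, k, rfl⟩ := h.exists_coord u x
    rw [h.inner_coord] at hd
    subst hd
    exact ⟨t, rfl, hx⟩
  · rintro ⟨t, rfl, hx⟩
    refine ⟨hx, ?_⟩
    rw [show e.line = (affineSpan ℝ e.carrier : Set Plane) from rfl,
      h.infDist_of_mem_closure hx.1, h.inner_coord]

include he hcor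

/-- Three things could remove a point of the parallel at distance `s * w / 2`: leaving the face,
coming too close to another crease, or being trimmed near a vertex. At parameter distance `K * s`
from both ends none of them happens. -/
theorem exists_offset_mem_reducedFace {c : S.Trimming} (hc : IsBoundedTrimming ω c)
    (hw : 0 < ω.width e) : ∃ K > 0, ∃ s₀ > 0, ∀ s t : ℝ, 0 < s → s < s₀ → K * s ≤ t →
      t ≤ L - K * s → u + t • d + (s * (ω.width e / 2)) • n ∈ ω.reducedFace c s F := by
  obtain ⟨κ, hκ, H⟩ := h.mem_of_le (S.convex F) he
  obtain ⟨κ', hκ', H'⟩ := CreasePattern.exists_infDist_crease_ge S.convex hcor h he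
  obtain ⟨W, hW, HW⟩ := exists_width_le ω
  obtain ⟨η, hη, Hη⟩ := h.exists_le_dist_vertex
  obtain ⟨M, hM, HM⟩ := exists_mem_reducedFace_of_far hc F
  set w := ω.width e with hwdef
  -- `M` clears the trimming at the two ends, `w / κ` keeps the point under the tent inside the
  -- face, and `W / κ'` gives the base point distance at least `s * W` from the other crease lines,
  -- half of which survives the offset. The bound on `s` handles the remaining vertices.
  refine ⟨max M (max (w / κ) (W / κ')), by positivity, η / (M + w), by positivity,
    fun s t hs hs0 h1 h2 => ?_⟩
  set K := max M (max (w / κ) (W / κ')) with hK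
  have hKM : M ≤ K := le_max_left _ _
  have hKκ : w ≤ κ * K := by
    have : w / κ ≤ K := (le_max_left _ _).trans (le_max_right _ _)
    rw [div_le_iff₀ hκ] at this; linarith
  have hKκ' : W ≤ κ' * K := by
    have : W / κ' ≤ K := (le_max_right _ _).trans (le_max_right _ _)
    rw [div_le_iff₀ hκ'] at this; linarith
  have hK0 : 0 < K := hM.trans_le hKM
  have ht0 : 0 < t := (by positivity : 0 < K * s).trans_le h1
  have htL : t < L := by linarith [(by positivity : 0 < K * s)]
  rw [lt_div_iff₀ (by positivity)] at hs0
  have hsw : 0 < s * w := by positivity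
  have hwM : w * s ≤ κ * (K * s) := by nlinarith
  have hmem : u + t • d + (s * (w / 2)) • n ∈ F.carrier := by
    refine H t _ (by positivity) ?_ ?_
    · nlinarith [mul_le_mul_of_nonneg_left h1 hκ.le]
    · nlinarith [mul_le_mul_of_nonneg_left (show K * s ≤ L - t by linarith) hκ.le]
  have hpe : u + t • d ∈ e.carrier := h.mem_iff.2 ⟨t, ht0.le, htL.le, rfl⟩
  have hdist : dist (u + t • d + (s * (w / 2)) • n) (u + t • d) = s * (w / 2) := by
    rw [dist_eq_norm, add_sub_cancel_left, norm_smul, h.norm_n, mul_one,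
      Real.norm_of_nonneg (by positivity)]
  refine HM s _ hs ⟨subset_closure hmem, fun e' he' => ?_⟩ fun v hv hvF => ?_
  · by_cases hee : e' = e
    · subst hee
      rw [show e'.line = (affineSpan ℝ e'.carrier : Set Plane) from rfl,
        h.infDist_of_mem_closure (subset_closure hmem), h.inner_coord]
    · have h3 : κ' * (K * s) ≤ Metric.infDist (u + t • d) e'.line := by
        rcases H' e' hee he' t ht0.le htL.le with h4 | h4
        · exact (mul_le_mul_of_nonneg_left h1 hκ'.le).trans h4
        · exact (mul_le_mul_of_nonneg_left (by linarith) hκ'.le).trans h4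
      have h4 := Metric.infDist_le_infDist_add_dist (s := e'.line) (x := u + t • d)
        (y := u + t • d + (s * (w / 2)) • n)
      rw [dist_comm, hdist] at h4
      have h5 := mul_le_mul_of_nonneg_left hKκ' hs.le
      have h6 := mul_le_mul_of_nonneg_left (HW e') hs.le
      have h7 := mul_le_mul_of_nonneg_left (HW e) hs.le
      rw [← hwdef] at h7
      nlinarith
  · have hKs : s * M ≤ K * s := by nlinarith
    by_cases hvu : v = u
    · subst hvu
      rw [dist_eq_norm, show v + t • d + (s * (w / 2)) • n - v = t • d + (s * (w / 2)) • n by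
        module]
      have := (le_abs_self t).trans (h.abs_le_norm t (s * (w / 2)))
      linarith
    by_cases hvu' : v = u + L • d
    · subst hvu'
      rw [dist_eq_norm, show u + t • d + (s * (w / 2)) • n - (u + L • d) =
        (t - L) • d + (s * (w / 2)) • n by module]
      have := (neg_abs_le (t - L)).trans' (neg_le_neg (h.abs_le_norm (t - L) (s * (w / 2))))
      linarith
    · have h3 := Hη v hv hvu hvu' _ hpe
      have h4 := dist_triangle_left (u + t • d) v (u + t • d + (s * (w / 2)) • n)
      rw [hdist] at h4
      nlinarith

/-- Conicity at `u` makes the set `P` of admissible rescaled parameters independent of the scale. It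
is nonempty by `exists_offset_mem_reducedFace`, bounded below because the corner is less than `π`,
and contains its infimum `lo` because reduced faces are closed. -/
theorem exists_start {c : S.Trimming} (hc : IsBoundedTrimming ω c) (hw : 0 < ω.width e) :
    ∃ lo : ℝ, lo • d + (ω.width e / 2) • n ∈ ω.trimmedSector c F u ∧ ∃ s₀ > 0, ∀ s, 0 < s → s < s₀ →
      u + (s * lo) • d + (s * (ω.width e / 2)) • n ∈ ω.reducedFace c s F ∧
      ∀ t : ℝ, u + t • d + (s * (ω.width e / 2)) • n ∈ ω.reducedFace c s F → s * lo ≤ t := by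
  obtain ⟨r, hr, hcon⟩ := conicAt_reducedFace ω c F u
  obtain ⟨m, hm, Hm⟩ := CreasePattern.exists_cone_bound S.convex hcor h he
  obtain ⟨K, hK, s₁, hs₁, HK⟩ := exists_offset_mem_reducedFace hcor h he hc hw
  have hL := h.posL
  set w := ω.width e with hwdef
  set P : Set ℝ := {t | t • d + (w / 2) • n ∈ localPicture u fun s => ω.reducedFace c s F} with hP
  have key : ∀ s t : ℝ, 0 < s → s < r → ‖s • (t • d + (w / 2) • n)‖ < r →
      (t ∈ P ↔ u + (s * t) • d + (s * (w / 2)) • n ∈ ω.reducedFace c s F) := by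
    intro s t hs hsr hn
    have := hcon.mem_localPicture_iff hs hsr hn
    rw [smul_add, smul_smul, smul_smul, ← add_assoc] at this
    exact this
  have hsmall : ∀ t : ℝ, ∃ s₂ > 0, ∀ s, 0 < s → s < s₂ →
      s < r ∧ ‖s • (t • d + (w / 2) • n)‖ < r := by
    intro t
    refine ⟨min r (r / (‖t • d + (w / 2) • n‖ + 1)), by positivity, fun s hs hs2 =>
      ⟨hs2.trans_le (min_le_left _ _), ?_⟩⟩
    have := hs2.trans_le (min_le_right _ _)
    rw [lt_div_iff₀ (by positivity)] at this
    rw [norm_smul, Real.norm_of_nonneg hs.le]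
    linarith
  have hne : P.Nonempty := by
    refine ⟨K, ?_⟩
    obtain ⟨s₂, hs₂, H₂⟩ := hsmall K
    have h0 : 0 < min s₁ (min s₂ (L / (2 * K))) := by positivity
    set s := min s₁ (min s₂ (L / (2 * K))) / 2 with hs
    have hs0 : 0 < s := by positivity
    have hlt : s < min s₁ (min s₂ (L / (2 * K))) := by linarith
    obtain ⟨h1, h2, h3⟩ : s < s₁ ∧ s < s₂ ∧ s < L / (2 * K) := by
      simpa [lt_min_iff] using hlt
    rw [lt_div_iff₀ (by positivity)] at h3
    rw [key s K hs0 (H₂ s hs0 h2).1 (H₂ s hs0 h2).2]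
    exact HK s _ hs0 h1 (by linarith) (by nlinarith)
  have hlow : ∀ t ∈ P, -(m * (w / 2)) ≤ t := by
    intro t ht
    obtain ⟨s₂, hs₂, H₂⟩ := hsmall t
    have := (key (s₂ / 2) t (by positivity) (H₂ _ (by positivity) (by linarith)).1
      (H₂ _ (by positivity) (by linarith)).2).1 ht
    refine (Hm t (w / 2) (s₂ / 2) (by positivity) ?_).2
    rw [smul_add, smul_smul, smul_smul, ← add_assoc]
    exact this.1
  have hbdd : BddBelow P := ⟨_, hlow⟩
  set lo := sInf P with hlo
  -- Closedness of the reduced face is used at one fixed scale, near `lo`, where `P` is described by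
  -- that scale.
  have hloP : lo ∈ P := by
    have hcl : lo ∈ closure P := csInf_mem_closure hne hbdd
    obtain ⟨s₂, hs₂, H₂⟩ := hsmall lo
    obtain ⟨h1, h2⟩ := H₂ (s₂ / 2) (by positivity) (by linarith)
    rw [key (s₂ / 2) lo (by positivity) h1 h2]
    have hO : IsOpen {t : ℝ | ‖(s₂ / 2) • (t • d + (w / 2) • n)‖ < r} :=
      isOpen_lt (by fun_prop) continuous_const
    have hC : IsClosed {t : ℝ | u + (s₂ / 2 * t) • d + (s₂ / 2 * (w / 2)) • n ∈
        ω.reducedFace c (s₂ / 2) F} :=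
      (isClosed_reducedFace ω c F (by positivity)).preimage (by fun_prop)
    refine hC.closure_subset_iff.2 ?_ (hO.inter_closure ⟨h2, hcl⟩)
    rintro t ⟨ht1, ht2⟩
    exact (key (s₂ / 2) t (by positivity) h1 ht1).1 ht2
  obtain ⟨s₂, hs₂, H₂⟩ := hsmall lo
  have hstart : ∀ s, 0 < s → s < s₂ →
      u + (s * lo) • d + (s * (w / 2)) • n ∈ ω.reducedFace c s F := fun s hs hs2 =>
    (key s lo hs (H₂ s hs hs2).1 (H₂ s hs hs2).2).1 hloP
  refine ⟨lo, ?_, s₂, hs₂, fun s hs hs2 => ⟨hstart s hs hs2, fun t ht => ?_⟩⟩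
  · obtain ⟨y, hy, hy'⟩ := (hstart (s₂ / 2) (by positivity) (by linarith)).2 u h.start_vertex
      (he h.start_mem)
    have : y = lo • d + (w / 2) • n := by
      rw [add_assoc, add_right_inj, mul_smul, mul_smul, ← smul_add] at hy'
      exact (smul_right_injective Plane (by positivity : s₂ / 2 ≠ 0) hy').symm
    rwa [← this]
  -- A smaller parameter may lie outside the range of conicity; convexity moves it back to `lo - δ`
  -- within range, contradicting minimality.
  · by_contra hlt
    rw [not_le] at hlt
    obtain ⟨hsr, hn⟩ := H₂ s hs hs2
    have hO : IsOpen {t : ℝ | ‖s • (t • d + (w / 2) • n)‖ < r} :=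
      isOpen_lt (by fun_prop) continuous_const
    obtain ⟨ε, hε, hball⟩ := Metric.isOpen_iff.1 hO lo hn
    have hδ : 0 < lo - t / s := by rw [sub_pos, div_lt_iff₀ hs]; linarith
    set δ := min (ε / 2) (lo - t / s) with hδdef
    have hδ0 : 0 < δ := by positivity
    have hδε : δ < ε := (min_le_left _ _).trans_lt (by linarith)
    have hδt : δ ≤ lo - t / s := min_le_right _ _
    have hmem : u + (s * (lo - δ)) • d + (s * (w / 2)) • n ∈ ω.reducedFace c s F := by
      have := convex_reducedFace ω c F hs (hstart s hs hs2) ht (a := 1 - δ / (lo - t / s))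
        (b := δ / (lo - t / s)) (by rw [sub_nonneg]; exact (div_le_one hδ).2 hδt)
        (by positivity) (by ring)
      convert this using 1
      have e1 : s * (lo - δ) = (1 - δ / (lo - t / s)) * (s * lo) + δ / (lo - t / s) * t := by
        have h3 : t = s * (lo - (lo - t / s)) := by field_simp; ring
        generalize lo - t / s = q at *
        rw [h3]
        field_simp
        ring
      rw [e1]
      module
    have hP' : lo - δ ∈ P := by
      refine (key s _ hs hsr (hball ?_)).2 hmem
      rw [Metric.mem_ball, Real.dist_eq, sub_sub_cancel_left, abs_neg, abs_of_pos hδ0]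
      exact hδε
    linarith [csInf_le hbdd hP']

/-- A new crease is a segment whose ends are offset proportionally to the scale. -/
theorem exists_offset_iff {c : S.Trimming} (hc : IsBoundedTrimming ω c) (hw : 0 < ω.width e) :
    ∃ lo hi : ℝ, lo • d + (ω.width e / 2) • n ∈ ω.trimmedSector c F u ∧
      hi • (-d) + (ω.width e / 2) • n ∈ ω.trimmedSector c F (u + L • d) ∧
      ∃ s₀ > 0, ∀ s, 0 < s → s < s₀ → ∀ t : ℝ,
      u + t • d + (s * (ω.width e / 2)) • n ∈ ω.reducedFace c s F ↔
        s * lo ≤ t ∧ t ≤ L - s * hi := by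
  obtain ⟨lo, hlo, s₁, hs₁, H₁⟩ := exists_start hcor h he hc hw
  obtain ⟨hi, hhi, s₂, hs₂, H₂⟩ := exists_start hcor h.reverse he hc hw
  refine ⟨lo, hi, hlo, hhi, min s₁ s₂, by positivity, fun s hs hss t => ?_⟩
  -- Both ends belong to the reduced face and bound it; convexity fills in the points between them.
  obtain ⟨a1, a2⟩ := H₁ s hs (hss.trans_le (min_le_left _ _))
  obtain ⟨b1, b2⟩ := H₂ s hs (hss.trans_le (min_le_right _ _))
  have hrev : ∀ t : ℝ, u + L • d + t • -d + (s * (ω.width e / 2)) • n =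
      u + (L - t) • d + (s * (ω.width e / 2)) • n := fun t => by module
  constructor
  · intro ht
    refine ⟨a2 t ht, ?_⟩
    have := b2 (L - t) (by rw [hrev]; rwa [sub_sub_cancel])
    linarith
  · rintro ⟨h1, h2⟩
    rw [hrev] at b1
    rcases h1.eq_or_lt with h1 | h1
    · rwa [← h1]
    have hpos : 0 < (L - s * hi) - s * lo := by linarith
    have := convex_reducedFace ω c F hs a1 b1
      (a := 1 - (t - s * lo) / ((L - s * hi) - s * lo))
      (b := (t - s * lo) / ((L - s * hi) - s * lo))
      (by rw [sub_nonneg]; exact (div_le_one hpos).2 (by linarith))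
      (div_nonneg (by linarith) hpos.le) (by ring)
    convert this using 1
    have e1 : t = (1 - (t - s * lo) / ((L - s * hi) - s * lo)) * (s * lo) +
        (t - s * lo) / ((L - s * hi) - s * lo) * (L - s * hi) := by
      have hq : t - s * lo = (t - s * lo) / ((L - s * hi) - s * lo) * ((L - s * hi) - s * lo) := by
        rw [div_mul_cancel₀ _ hpos.ne']
      linear_combination hq
    nth_rewrite 1 [e1]
    module

end NewCrease
end FlatFoldedState


/-! ### Strips spanned by two parallel segments. -/

section Strip
variable {V : Type*} [NormedAddCommGroup V] [NormedSpace ℝ V]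

/-- The segment `[s * l, L - s * r]` on the line through `p + s • E` with direction `D`. -/
def offsetSegment (p D E : V) (L l r s : ℝ) : Set V :=
  {x | ∃ t : ℝ, s * l ≤ t ∧ t ≤ L - s * r ∧ x = p + t • D + s • E}

/-- The strip spanned by two parallel segments. -/
def strip (p D E₀ E₁ : V) (L lA lB rA rB s : ℝ) : Set V :=
  {x | ∃ τ t : ℝ, 0 ≤ τ ∧ τ ≤ 1 ∧ s * ((1 - τ) * lA + τ * lB) ≤ t ∧
    t ≤ L - s * ((1 - τ) * rA + τ * rB) ∧ x = p + t • D + s • (E₀ + τ • E₁)}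

theorem convex_offsetSegment (p D E : V) (L l r s : ℝ) :
    Convex ℝ (offsetSegment p D E L l r s) := by
  rintro _ ⟨t, h1, h2, rfl⟩ _ ⟨t', h1', h2', rfl⟩ a b ha hb hab
  refine ⟨a * t + b * t', ?_, ?_, ?_⟩
  · calc s * l = a * (s * l) + b * (s * l) := by rw [← add_mul, hab, one_mul]
      _ ≤ _ := by gcongr
  · calc a * t + b * t' ≤ a * (L - s * r) + b * (L - s * r) := by gcongr
      _ = _ := by rw [← add_mul, hab, one_mul]
  · obtain rfl : a = 1 - b := by linarith
    module

theorem convexHull_union_offsetSegment {p D E₀ E₁ : V} {L lA lB rA rB s : ℝ}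
    (hA : s * lA ≤ L - s * rA) (hB : s * lB ≤ L - s * rB) :
    convexHull ℝ (offsetSegment p D E₀ L lA rA s ∪ offsetSegment p D (E₀ + E₁) L lB rB s) =
      strip p D E₀ E₁ L lA lB rA rB s := by
  rw [(convex_offsetSegment _ _ _ _ _ _ _).convexHull_union (convex_offsetSegment _ _ _ _ _ _ _)
    ⟨_, _, le_rfl, hA, rfl⟩ ⟨_, _, le_rfl, hB, rfl⟩]
  ext x
  rw [mem_convexJoin]
  constructor
  · rintro ⟨_, ⟨t, h1, h2, rfl⟩, _, ⟨t', h1', h2', rfl⟩, a, b, ha, hb, hab, rfl⟩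
    obtain rfl : a = 1 - b := by linarith
    refine ⟨b, (1 - b) * t + b * t', hb, by linarith, ?_, ?_, by module⟩
    · nlinarith [mul_le_mul_of_nonneg_left h1 ha, mul_le_mul_of_nonneg_left h1' hb]
    · nlinarith [mul_le_mul_of_nonneg_left h2 ha, mul_le_mul_of_nonneg_left h2' hb]
  · rintro ⟨τ, t, h0, h1, hl, hr, rfl⟩
    set l := (1 - τ) * (s * lA) + τ * (s * lB) with hldef
    set r := (1 - τ) * (L - s * rA) + τ * (L - s * rB) with hrdef
    have hl' : l ≤ t := by rw [hldef]; linarith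
    have hr' : t ≤ r := by rw [hrdef]; linarith
    -- Dividing both segments in the same ratio `θ` gives the two points whose join passes through
    -- the given point.
    obtain ⟨θ, hθ0, hθ1, hθ⟩ : ∃ θ : ℝ, 0 ≤ θ ∧ θ ≤ 1 ∧ t = (1 - θ) * l + θ * r := by
      rcases hl'.eq_or_lt with h | h
      · exact ⟨0, le_rfl, zero_le_one, by linarith⟩
      · have hp : 0 < r - l := by linarith
        refine ⟨(t - l) / (r - l), div_nonneg (by linarith) hp.le,
          (div_le_one hp).2 (by linarith), ?_⟩
        have := div_mul_cancel₀ (t - l) hp.ne'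
        linear_combination -this
    have hθ1' : 0 ≤ 1 - θ := by linarith
    refine ⟨_, ⟨(1 - θ) * (s * lA) + θ * (L - s * rA), ?_, ?_, rfl⟩, _,
      ⟨(1 - θ) * (s * lB) + θ * (L - s * rB), ?_, ?_, rfl⟩, 1 - τ, τ, by linarith, h0, by ring, ?_⟩
    · nlinarith
    · nlinarith
    · nlinarith
    · nlinarith
    · rw [hθ, hldef, hrdef]
      module

theorem abs_combo_le {τ : ℝ} (h0 : 0 ≤ τ) (h1 : τ ≤ 1) (a b : ℝ) :
    |(1 - τ) * a + τ * b| ≤ |a| + |b| := by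
  refine (abs_add_le _ _).trans ?_
  rw [abs_mul, abs_mul, abs_of_nonneg h0, abs_of_nonneg (by linarith)]
  nlinarith [abs_nonneg a, abs_nonneg b]

theorem norm_offset_le {τ : ℝ} (h0 : 0 ≤ τ) (h1 : τ ≤ 1) (E₀ E₁ : V) :
    ‖E₀ + τ • E₁‖ ≤ ‖E₀‖ + ‖E₁‖ := by
  refine (norm_add_le _ _).trans ?_
  rw [norm_smul, Real.norm_of_nonneg h0]
  nlinarith [norm_nonneg E₁]

/-- The points of a strip near `p + t₀ • D`. -/
theorem exists_mem_strip_iff {p D E₀ E₁ : V} {L lA lB rA rB : ℝ} (hD : ‖D‖ = 1) {t₀ : ℝ}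
    (h0 : 0 ≤ t₀) (h1 : t₀ ≤ L) : ∃ r > 0, ∀ s y, 0 < s → s < r → ‖s • y‖ < r →
      (p + t₀ • D + s • y ∈ strip p D E₀ E₁ L lA lB rA rB s ↔
        ∃ τ t : ℝ, 0 ≤ τ ∧ τ ≤ 1 ∧ (t₀ = 0 → (1 - τ) * lA + τ * lB ≤ t) ∧
          (t₀ = L → t ≤ -((1 - τ) * rA + τ * rB)) ∧ y = t • D + (E₀ + τ • E₁)) := by
  set M := |lA| + |lB| + |rA| + |rB| with hM
  set C := ‖E₀‖ + ‖E₁‖ with hC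
  have hM0 : 0 ≤ M := by positivity
  have hC0 : 0 ≤ C := by positivity
  have hMC : 0 < 1 + C + M := by positivity
  -- An end constraint survives only if `t₀` is that end; otherwise displacements of order `r * (1 +
  -- C + M)` do not reach it.
  obtain ⟨r₁, hr₁, H₁⟩ : ∃ r > 0, t₀ = 0 ∨ r * (1 + C + M) ≤ t₀ := by
    rcases h0.eq_or_lt with h | h
    · exact ⟨1, one_pos, Or.inl h.symm⟩
    · exact ⟨t₀ / (1 + C + M), by positivity, Or.inr (by rw [div_mul_cancel₀ _ hMC.ne'])⟩
  obtain ⟨r₂, hr₂, H₂⟩ : ∃ r > 0, t₀ = L ∨ r * (1 + C + M) ≤ L - t₀ := by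
    rcases h1.eq_or_lt with h | h
    · exact ⟨1, one_pos, Or.inl h⟩
    · have : 0 < L - t₀ := by linarith
      exact ⟨(L - t₀) / (1 + C + M), by positivity, Or.inr (by rw [div_mul_cancel₀ _ hMC.ne'])⟩
  refine ⟨min r₁ r₂, by positivity, fun s y hs hsr hy => ⟨?_, ?_⟩⟩
  · rintro ⟨τ, t, hτ0, hτ1, hl, hr, he⟩
    refine ⟨τ, (t - t₀) / s, hτ0, hτ1, fun h => ?_, fun h => ?_, ?_⟩
    · rw [le_div_iff₀ hs, h]; linarith
    · rw [div_le_iff₀ hs, h]; linarith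
    · have : s • y = (t - t₀) • D + s • (E₀ + τ • E₁) := by
        rw [add_assoc, add_assoc, add_right_inj] at he
        rw [sub_smul, sub_add_eq_add_sub, eq_sub_iff_add_eq', he]
      rw [← smul_right_inj hs.ne', this, smul_add s (((t - t₀) / s) • D), smul_smul,
        mul_div_cancel₀ _ hs.ne']
  · rintro ⟨τ, t, hτ0, hτ1, hl, hr, rfl⟩
    have hst : |s * t| ≤ min r₁ r₂ * (1 + C) := by
      have e1 : (s * t) • D = s • (t • D + (E₀ + τ • E₁)) - s • (E₀ + τ • E₁) := by
        rw [← smul_sub, add_sub_cancel_right, smul_smul]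
      have e2 : ‖(s * t) • D‖ = |s * t| := by rw [norm_smul, hD, mul_one, Real.norm_eq_abs]
      rw [← e2, e1]
      refine (norm_sub_le _ _).trans ?_
      have e3 : ‖s • (E₀ + τ • E₁)‖ ≤ min r₁ r₂ * C := by
        rw [norm_smul, Real.norm_of_nonneg hs.le]
        exact mul_le_mul hsr.le (norm_offset_le hτ0 hτ1 _ _) (norm_nonneg _) (by positivity)
      linarith
    have hcom : ∀ a b : ℝ, |a| + |b| ≤ M → s * |(1 - τ) * a + τ * b| ≤ min r₁ r₂ * M := by
      intro a b hab
      exact mul_le_mul hsr.le ((abs_combo_le hτ0 hτ1 a b).trans hab) (abs_nonneg _) (by positivity)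
    have hlc := hcom lA lB (by rw [hM]; linarith [abs_nonneg rA, abs_nonneg rB])
    have hrc := hcom rA rB (by rw [hM]; linarith [abs_nonneg lA, abs_nonneg lB])
    refine ⟨τ, t₀ + s * t, hτ0, hτ1, ?_, ?_, by module⟩
    · rcases H₁ with h | h
      · rw [h, zero_add]
        exact mul_le_mul_of_nonneg_left (hl h) hs.le
      · have e1 := mul_le_mul_of_nonneg_left (le_abs_self ((1 - τ) * lA + τ * lB)) hs.le
        have e2 := mul_le_mul_of_nonneg_right (min_le_left r₁ r₂) hMC.le
        linarith [neg_abs_le (s * t)]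
    · rcases H₂ with h | h
      · rw [h]
        have := mul_le_mul_of_nonneg_left (hr h) hs.le
        linarith
      · have e1 := mul_le_mul_of_nonneg_left (le_abs_self ((1 - τ) * rA + τ * rB)) hs.le
        have e2 := mul_le_mul_of_nonneg_right (min_le_right r₁ r₂) hMC.le
        linarith [le_abs_self (s * t)]

/-- A strip lies within `s * (C + M)` of its axis, and a point off the axis has positive distance
from it by compactness. -/
theorem strip_notMem_of_far {p D E₀ E₁ z : V} {L lA lB rA rB : ℝ} (hL : 0 < L) (hD : ‖D‖ = 1)
    (hz : ∀ t, 0 ≤ t → t ≤ L → z ≠ p + t • D) :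
    ∃ r > 0, ∀ s x, 0 < s → s < r → ‖x - z‖ < r → x ∉ strip p D E₀ E₁ L lA lB rA rB s := by
  have hcomp : IsCompact ((fun t : ℝ => p + t • D) '' Icc 0 L) :=
    isCompact_Icc.image (by fun_prop)
  have hzn : z ∈ ((fun t : ℝ => p + t • D) '' Icc 0 L)ᶜ := by
    rintro ⟨t, ⟨h0, h1⟩, rfl⟩
    exact hz t h0 h1 rfl
  obtain ⟨η, hη, hb⟩ := Metric.isOpen_iff.1 hcomp.isClosed.isOpen_compl z hzn
  set M := |lA| + |lB| + |rA| + |rB| with hM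
  set C := ‖E₀‖ + ‖E₁‖ with hC
  have hMC : 0 < 1 + C + M := by positivity
  refine ⟨η / (1 + C + M), by positivity, fun s x hs hsr hx hmem => ?_⟩
  rw [lt_div_iff₀ hMC] at hsr hx
  obtain ⟨τ, t, hτ0, hτ1, hl, hr, rfl⟩ := hmem
  have hlc := mul_le_mul_of_nonneg_left
    ((neg_abs_le _).trans' (neg_le_neg (abs_combo_le hτ0 hτ1 lA lB))) hs.le
  have hrc := mul_le_mul_of_nonneg_left
    ((neg_abs_le _).trans' (neg_le_neg (abs_combo_le hτ0 hτ1 rA rB))) hs.le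
  -- the nearest parameter in the segment
  obtain ⟨t', h0, h1, ht'⟩ : ∃ t' : ℝ, 0 ≤ t' ∧ t' ≤ L ∧ |t - t'| ≤ s * M := by
    have hsM : 0 ≤ s * M := by positivity
    have a1 : s * (|lA| + |lB|) ≤ s * M := by
      gcongr; rw [hM]; linarith [abs_nonneg rA, abs_nonneg rB]
    have a2 : s * (|rA| + |rB|) ≤ s * M := by
      gcongr; rw [hM]; linarith [abs_nonneg lA, abs_nonneg lB]
    rcases lt_or_ge t 0 with ht | ht
    · exact ⟨0, le_rfl, hL.le, by rw [sub_zero, abs_of_neg ht]; linarith⟩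
    rcases lt_or_ge L t with ht2 | ht2
    · exact ⟨L, hL.le, le_rfl, by rw [abs_of_nonneg (by linarith)]; linarith⟩
    · exact ⟨t, ht, ht2, by simpa using hsM⟩
  refine hb (show p + t' • D ∈ Metric.ball z η from ?_) ⟨t', ⟨h0, h1⟩, rfl⟩
  rw [Metric.mem_ball, dist_eq_norm]
  have e1 : p + t' • D - z = (p + t • D + s • (E₀ + τ • E₁) - z) - ((t - t') • D +
      s • (E₀ + τ • E₁)) := by module
  have e2 : ‖(t - t') • D + s • (E₀ + τ • E₁)‖ ≤ s * M + s * C := by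
    refine (norm_add_le _ _).trans (add_le_add ?_ ?_)
    · rwa [norm_smul, hD, mul_one]
    · rw [norm_smul, Real.norm_of_nonneg hs.le]
      exact mul_le_mul_of_nonneg_left (norm_offset_le hτ0 hτ1 _ _) hs.le
  rw [e1]
  refine (norm_sub_le _ _).trans_lt ?_
  rcases le_total s ‖p + t • D + s • (E₀ + τ • E₁) - z‖ with h3 | h3
  · have : s * (C + M) ≤ ‖p + t • D + s • (E₀ + τ • E₁) - z‖ * (C + M) := by gcongr
    linarith
  · linarith

theorem conicAt_strip {p D E₀ E₁ z : V} {L lA lB rA rB : ℝ} (hL : 0 < L) (hD : ‖D‖ = 1) :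
    ConicAt z fun s => strip p D E₀ E₁ L lA lB rA rB s := by
  by_cases hz : ∃ t, 0 ≤ t ∧ t ≤ L ∧ z = p + t • D
  · obtain ⟨t, h0, h1, rfl⟩ := hz
    obtain ⟨r, hr, H⟩ := exists_mem_strip_iff (p := p) (E₀ := E₀) (E₁ := E₁) (lA := lA) (lB := lB)
      (rA := rA) (rB := rB) hD h0 h1
    refine ⟨r, hr, fun s s' y a1 a2 a3 a4 a5 a6 hy => ?_⟩
    exact (H s' y a3 a4 a6).2 ((H s y a1 a2 a5).1 hy)
  · push Not at hz
    obtain ⟨r, hr, H⟩ := strip_notMem_of_far (E₀ := E₀) (E₁ := E₁) (lA := lA) (lB := lB)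
      (rA := rA) (rB := rB) hL hD (fun t h0 h1 => hz t h0 h1)
    exact ConicAt.of_eventually_notMem hr H

/-- Away from its two ends, a strip is a product. -/
theorem strip_of_far {p D E₀ E₁ : V} {L lA lB rA rB : ℝ} (hD : ‖D‖ = 1) {r : ℝ} (hr : 0 < r) :
    ∃ s₀ > 0, ∀ s x, 0 < s → s < s₀ → x ∈ strip p D E₀ E₁ L lA lB rA rB s →
      r ≤ ‖x - p‖ → r ≤ ‖x - (p + L • D)‖ → ∃ τ t : ℝ, 0 ≤ τ ∧ τ ≤ 1 ∧ r / 2 ≤ t ∧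
        t ≤ L - r / 2 ∧ x = p + t • D + s • (E₀ + τ • E₁) := by
  set M := |lA| + |lB| + |rA| + |rB| with hM
  set C := ‖E₀‖ + ‖E₁‖ with hC
  have hMC : 0 < 1 + C + M := by positivity
  refine ⟨r / 2 / (1 + C + M), by positivity, ?_⟩
  rintro s x hs hsr ⟨τ, t, hτ0, hτ1, hl, hr', rfl⟩ h1 h2
  rw [lt_div_iff₀ hMC] at hsr
  have hlc := mul_le_mul_of_nonneg_left
    ((neg_abs_le _).trans' (neg_le_neg (abs_combo_le hτ0 hτ1 lA lB))) hs.le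
  have hrc := mul_le_mul_of_nonneg_left
    ((neg_abs_le _).trans' (neg_le_neg (abs_combo_le hτ0 hτ1 rA rB))) hs.le
  have a1 : s * (|lA| + |lB|) ≤ s * M := by
    gcongr; rw [hM]; linarith [abs_nonneg rA, abs_nonneg rB]
  have a2 : s * (|rA| + |rB|) ≤ s * M := by
    gcongr; rw [hM]; linarith [abs_nonneg lA, abs_nonneg lB]
  have hE : ‖s • (E₀ + τ • E₁)‖ ≤ s * C := by
    rw [norm_smul, Real.norm_of_nonneg hs.le]
    exact mul_le_mul_of_nonneg_left (norm_offset_le hτ0 hτ1 _ _) hs.le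
  have b1 : ‖p + t • D + s • (E₀ + τ • E₁) - p‖ ≤ |t| + s * C := by
    rw [show p + t • D + s • (E₀ + τ • E₁) - p = t • D + s • (E₀ + τ • E₁) by module]
    refine (norm_add_le _ _).trans (add_le_add ?_ hE)
    rw [norm_smul, hD, mul_one, Real.norm_eq_abs]
  have b2 : ‖p + t • D + s • (E₀ + τ • E₁) - (p + L • D)‖ ≤ |t - L| + s * C := by
    rw [show p + t • D + s • (E₀ + τ • E₁) - (p + L • D) = (t - L) • D + s • (E₀ + τ • E₁) by
      module]
    refine (norm_add_le _ _).trans (add_le_add ?_ hE)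
    rw [norm_smul, hD, mul_one, Real.norm_eq_abs]
  refine ⟨τ, t, hτ0, hτ1, ?_, ?_, rfl⟩
  · rcases le_total 0 t with ht | ht
    · rw [abs_of_nonneg ht] at b1; nlinarith
    · rw [abs_of_nonpos ht] at b1; nlinarith
  · rcases le_total t L with ht | ht
    · rw [abs_of_nonpos (by linarith)] at b2; nlinarith
    · rw [abs_of_nonneg (by linarith)] at b2; nlinarith

end Strip

/-! ### Widened creases as strips. -/

namespace FlatFoldedState
variable {S : FlatFoldedState} {ω : S.WeightAssignment} {h : S.pattern.Face → ℝ}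
  {e : S.pattern.Crease} {A B : S.pattern.Face} {u d n : Plane} {L : ℝ} {g : Plane ≃ᵃⁱ[ℝ] Plane}

namespace CreaseFrame
variable (f : CreaseFrame ω h e A B u d n L g)
include f

theorem width_pos : 0 < ω.width e := by rw [f.width_eq]; linarith [f.lt]

/-- For small scales the widened creases are strips, in the plane and in the folding. -/
theorem exists_piece_eq_strip (hcor : S.pattern.NoStraightCorner) {c : S.Trimming}
    (hc : IsBoundedTrimming ω c) :
    ∃ lA lB rA rB : ℝ,
      lA • d + (ω.width e / 2) • n ∈ ω.trimmedSector c A u ∧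
      lB • d + (ω.width e / 2) • (-n) ∈ ω.trimmedSector c B u ∧
      rA • (-d) + (ω.width e / 2) • n ∈ ω.trimmedSector c A (u + L • d) ∧
      rB • (-d) + (ω.width e / 2) • (-n) ∈ ω.trimmedSector c B (u + L • d) ∧
      ∃ s₀ > 0, ∀ s, 0 < s → s < s₀ →
        s * lA < L - s * rA ∧ s * lB < L - s * rB ∧
        (∀ t : ℝ, u + t • d + (s * (ω.width e / 2)) • n ∈ ω.newCrease c s e A ↔
          s * lA ≤ t ∧ t ≤ L - s * rA) ∧
        (∀ t : ℝ, u + t • d + (s * (ω.width e / 2)) • (-n) ∈ ω.newCrease c s e B ↔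
          s * lB ≤ t ∧ t ≤ L - s * rB) ∧
        ω.flatPiece c s (Sum.inr e) =
          strip u d ((ω.width e / 2) • n) (-(ω.width e) • n) L lA lB rA rB s ∧
        ω.foldedPiece h c s (Sum.inr e) =
          strip ((g u, 0) : Space) (g.linearIsometryEquiv d, 0)
            ((ω.width e / 2) • g.linearIsometryEquiv n, h A) (0, ω.width e) L lA lB rA rB s := by
  obtain ⟨lA, rA, hlA, hrA, s₁, hs₁, HA⟩ :=
    exists_offset_iff hcor f.lower f.boundedBy_lower hc f.width_pos
  obtain ⟨lB, rB, hlB, hrB, s₂, hs₂, HB⟩ :=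
    exists_offset_iff hcor f.upper f.boundedBy_upper hc f.width_pos
  have hL := f.lower.posL
  have hw := f.width_eq
  refine ⟨lA, lB, rA, rB, hlA, hlB, hrA, hrB,
    -- The last bound prevents the displaced ends from running into each other.
    min (min s₁ s₂) (L / (|lA| + |lB| + |rA| + |rB| + 1)), by positivity, fun s hs hss => ?_⟩
  have hs1 : s < s₁ := hss.trans_le ((min_le_left _ _).trans (min_le_left _ _))
  have hs2 : s < s₂ := hss.trans_le ((min_le_left _ _).trans (min_le_right _ _))
  have hs3 := hss.trans_le (min_le_right _ _)
  rw [lt_div_iff₀ (by positivity)] at hs3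
  have hA : s * lA < L - s * rA := by
    have : s * (lA + rA) ≤ s * (|lA| + |lB| + |rA| + |rB|) :=
      mul_le_mul_of_nonneg_left (by
        linarith [le_abs_self lA, le_abs_self rA, abs_nonneg lB, abs_nonneg rB]) hs.le
    linarith
  have hB : s * lB < L - s * rB := by
    have : s * (lB + rB) ≤ s * (|lA| + |lB| + |rA| + |rB|) :=
      mul_le_mul_of_nonneg_left (by
        linarith [le_abs_self lB, le_abs_self rB, abs_nonneg lA, abs_nonneg rA]) hs.le
    linarith
  have mA : ∀ x, x ∈ ω.newCrease c s e A ↔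
      ∃ t : ℝ, s * lA ≤ t ∧ t ≤ L - s * rA ∧ x = u + t • d + (s * (ω.width e / 2)) • n := by
    intro x
    rw [mem_newCrease_iff f.lower]
    refine exists_congr fun t => ?_
    rw [HA s hs hs1 t]
    tauto
  have mB : ∀ x, x ∈ ω.newCrease c s e B ↔
      ∃ t : ℝ, s * lB ≤ t ∧ t ≤ L - s * rB ∧ x = u + t • d + (s * (ω.width e / 2)) • (-n) := by
    intro x
    rw [mem_newCrease_iff f.upper]
    refine exists_congr fun t => ?_
    rw [HB s hs hs2 t]
    tauto
  refine ⟨hA, hB, fun t => ?_, fun t => ?_, ?_, ?_⟩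
  · rw [mem_newCrease_iff f.lower, ← HA s hs hs1 t]
    constructor
    · rintro ⟨t', h1, h2⟩; rwa [h1]
    · intro h1; exact ⟨t, rfl, h1⟩
  · rw [mem_newCrease_iff f.upper, ← HB s hs hs2 t]
    constructor
    · rintro ⟨t', h1, h2⟩; rwa [h1]
    · intro h1; exact ⟨t, rfl, h1⟩
  · rw [← convexHull_union_offsetSegment hA.le hB.le]
    change convexHull ℝ _ = _
    congr 1
    ext x
    constructor
    · rintro ⟨F, hF, hx⟩
      rcases f.eq_or_eq F hF with rfl | rfl
      · obtain ⟨t, h1, h2, rfl⟩ := (mA x).1 hx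
        exact Or.inl ⟨t, h1, h2, by module⟩
      · obtain ⟨t, h1, h2, rfl⟩ := (mB x).1 hx
        exact Or.inr ⟨t, h1, h2, by module⟩
    · rintro (⟨t, h1, h2, rfl⟩ | ⟨t, h1, h2, rfl⟩)
      · exact ⟨A, f.boundedBy_lower, (mA _).2 ⟨t, h1, h2, by module⟩⟩
      · exact ⟨B, f.boundedBy_upper, (mB _).2 ⟨t, h1, h2, by module⟩⟩
  · rw [← convexHull_union_offsetSegment hA.le hB.le]
    change convexHull ℝ _ = _
    congr 1
    have eA : ∀ t : ℝ, ((g (u + t • d + (s * (ω.width e / 2)) • n), s * h A) : Space) =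
        (g u, 0) + t • (g.linearIsometryEquiv d, 0) +
          s • ((ω.width e / 2) • g.linearIsometryEquiv n, h A) := by
      intro t
      rw [g.map_coord]
      ext1
      · simp [smul_smul]
      · simp
    -- Both new creases fold onto one line of the plane, so the strip is vertical; its rise is the
    -- width because the width is the difference of heights.
    have eB : ∀ t : ℝ, ((g (u + t • d + (s * (ω.width e / 2)) • n), s * h B) : Space) =
        (g u, 0) + t • (g.linearIsometryEquiv d, 0) +
          s • (((ω.width e / 2) • g.linearIsometryEquiv n, h A) + (0, ω.width e)) := by
      intro t
      rw [g.map_coord]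
      ext1
      · simp [smul_smul]
      · simp [hw]
    have fA : ∀ t : ℝ, u + t • d + (s * (ω.width e / 2)) • n ∈ closure A.carrier →
        S.fold (u + t • d + (s * (ω.width e / 2)) • n) =
          g (u + t • d + (s * (ω.width e / 2)) • n) := fun t ht => f.fold_lower _ ht
    have fB : ∀ t : ℝ, u + t • d + (s * (ω.width e / 2)) • (-n) ∈ closure B.carrier →
        S.fold (u + t • d + (s * (ω.width e / 2)) • (-n)) =
          g (u + t • d + (s * (ω.width e / 2)) • n) := fun t ht => by
      rw [smul_neg, ← sub_eq_add_neg] at ht ⊢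
      exact f.fold_upper _ _ ht
    ext q
    constructor
    · rintro ⟨F, hF, x, hx, rfl⟩
      rcases f.eq_or_eq F hF with rfl | rfl
      · obtain ⟨t, h1, h2, rfl⟩ := (mA x).1 hx
        exact Or.inl ⟨t, h1, h2, by rw [fA t hx.1.1, eA]⟩
      · obtain ⟨t, h1, h2, rfl⟩ := (mB x).1 hx
        exact Or.inr ⟨t, h1, h2, by rw [fB t hx.1.1, eB]⟩
    · rintro (⟨t, h1, h2, rfl⟩ | ⟨t, h1, h2, rfl⟩)
      · have hx := (mA _).2 ⟨t, h1, h2, rfl⟩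
        exact ⟨A, f.boundedBy_lower, _, hx, by rw [fA t hx.1.1, eA]⟩
      · have hx := (mB _).2 ⟨t, h1, h2, rfl⟩
        exact ⟨B, f.boundedBy_upper, _, hx, by rw [fB t hx.1.1, eB]⟩

end CreaseFrame
end FlatFoldedState


/-! ### Separation of the pieces away from the vertices. -/

theorem exists_pos_le_dist_of_disjoint {K K' : Set Plane} (hK : IsCompact K) (hK' : IsCompact K')
    (h : Disjoint K K') : ∃ η > 0, ∀ x ∈ K, ∀ y ∈ K', η ≤ dist x y := by
  obtain ⟨η, hη, hd⟩ := h.exists_thickenings hK hK'.isClosed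
  refine ⟨η, hη, fun x hx y hy => ?_⟩
  by_contra hlt
  rw [not_le] at hlt
  refine Set.disjoint_left.1 hd (Metric.mem_thickening_iff.2 ⟨x, hx, ?_⟩)
    (Metric.self_subset_thickening hη _ hy)
  rwa [dist_comm]

theorem IsFrame.dist_offset {d n : Plane} (h : IsFrame d n) (u : Plane) (t k : ℝ) :
    dist (u + t • d + k • n) (u + t • d) = |k| := by
  rw [dist_eq_norm, add_sub_cancel_left, norm_smul, h.norm_n, mul_one, Real.norm_eq_abs]

theorem isCompact_arc (u d : Plane) (a b : ℝ) :
    IsCompact ((fun t : ℝ => u + t • d) '' Icc a b) :=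
  isCompact_Icc.image (by fun_prop)

namespace FlatFoldedState
variable {S : FlatFoldedState} {ω : S.WeightAssignment} {h : S.pattern.Face → ℝ}

theorem interior_untrimmedFace_subset (s : ℝ) (F : S.pattern.Face) :
    interior (untrimmedFace ω s F) ⊆ F.carrier := by
  rw [← CreasePattern.Face.interior_closure (S.convex F)]
  exact interior_mono fun x hx => hx.1

namespace CreaseFrame
variable {e : S.pattern.Crease} {A B : S.pattern.Face} {u d n : Plane} {L : ℝ}
  {g : Plane ≃ᵃⁱ[ℝ] Plane} (f : CreaseFrame ω h e A B u d n L g)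
  {e' : S.pattern.Crease} {A' B' : S.pattern.Face} {u' d' n' : Plane} {L' : ℝ}
  {g' : Plane ≃ᵃⁱ[ℝ] Plane} (f' : CreaseFrame ω h e' A' B' u' d' n' L' g')
include f

theorem arc_subset {δ : ℝ} (hδ : 0 < δ) :
    (fun t : ℝ => u + t • d) '' Icc δ (L - δ) ⊆ e.carrier \ S.pattern.vertices := by
  rintro _ ⟨t, ⟨h1, h2⟩, rfl⟩
  exact ⟨f.lower.mem_iff.2 ⟨t, by linarith, by linarith, rfl⟩,
    f.lower.inner_notMem t (by linarith) (by linarith)⟩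

theorem fold_crease {t : ℝ} (h0 : 0 ≤ t) (h1 : t ≤ L) : S.fold (u + t • d) = g (u + t • d) :=
  f.fold_lower _ (f.boundedBy_lower (f.lower.mem_iff.2 ⟨t, h0, h1, rfl⟩))

/-- Close to the inner part of a crease there are points of both incident faces. -/
theorem exists_offset_mem {δ : ℝ} (hδ : 0 < δ) : ∃ s₀ > 0, ∀ s t : ℝ, 0 < s → s < s₀ → δ ≤ t →
    t ≤ L - δ → (∃ x ∈ A.carrier, S.fold x = g (u + t • d + (s * (ω.width e / 2)) • n)) ∧
      (∃ x ∈ B.carrier, S.fold x = g (u + t • d + (s * (ω.width e / 2)) • n)) := by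
  obtain ⟨κ, hκ, H⟩ := f.lower.mem_of_le (S.convex A) f.boundedBy_lower
  obtain ⟨κ', hκ', H'⟩ := f.upper.mem_of_le (S.convex B) f.boundedBy_upper
  have hw := f.width_pos
  refine ⟨min κ κ' * δ / ω.width e, by positivity, fun s t hs hss h1 h2 => ?_⟩
  rw [lt_div_iff₀ hw] at hss
  have hle : ∀ k, min κ κ' ≤ k → 0 < k → s * (ω.width e / 2) ≤ k * t ∧
      s * (ω.width e / 2) ≤ k * (L - t) := by
    intro k hk hk0
    have a1 : min κ κ' * δ ≤ k * δ := by gcongr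
    have a2 : k * δ ≤ k * t := by gcongr
    have a3 : k * δ ≤ k * (L - t) := by gcongr; linarith
    have a4 : 0 < s * ω.width e := by positivity
    constructor <;> linarith
  have m1 := H t _ (by positivity) (hle κ (min_le_left _ _) hκ).1 (hle κ (min_le_left _ _) hκ).2
  have m2 := H' t _ (by positivity : 0 < s * (ω.width e / 2)) (hle κ' (min_le_right _ _) hκ').1
    (hle κ' (min_le_right _ _) hκ').2
  refine ⟨⟨_, m1, f.fold_lower _ (subset_closure m1)⟩, ⟨_, m2, ?_⟩⟩
  rw [smul_neg, ← sub_eq_add_neg] at m2 ⊢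
  exact f.fold_upper _ _ (subset_closure m2)

/-- A third face between the faces of a crease stays away from the crease in the folding. -/
theorem disjoint_face (hwrap : S.NonWrapping) (hh : ω.IsHeight h) {C : S.pattern.Face}
    {x xA xB : Plane} (hx : x ∈ C.carrier) (hxA : xA ∈ A.carrier) (hxB : xB ∈ B.carrier)
    (hA : S.fold xA = S.fold x) (hB : S.fold xB = S.fold x) (h1 : h A < h C) (h2 : h C < h B) :
    Disjoint (S.fold '' closure C.carrier) (S.fold '' (e.carrier \ S.pattern.vertices)) := by
  have l1 : S.layer A C := layer_of_lt hh ⟨_, ⟨_, hxA, hA⟩, ⟨_, hx, rfl⟩⟩ h1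
  have l2 : S.layer C B := layer_of_lt hh ⟨_, ⟨_, hx, rfl⟩, ⟨_, hxB, hB⟩⟩ h2
  rw [Set.disjoint_left]
  rintro _ ⟨y, hy, rfl⟩ hye
  -- Contact with the open face is excluded by the flat folded state, contact with its edges by
  -- non-wrapping.
  by_cases hyC : y ∈ C.carrier
  · obtain ⟨p, hp, hpy⟩ := hye
    refine S.no_self_intersection e A B C f.boundedBy_lower f.boundedBy_upper f.ne ?_ ?_
      ⟨S.fold y, ⟨y, hyC, rfl⟩, ⟨p, hp.1, hpy⟩⟩ ⟨transGen_of_layer l1, transGen_of_layer l2⟩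
    · rintro rfl; exact h1.false
    · rintro rfl; exact h2.false
  · obtain ⟨e', he', hye', hCe'⟩ := CreasePattern.Face.exists_edge (S.convex C) hy hyC
    exact Set.disjoint_left.1 (hwrap e A B C f.boundedBy_lower f.boundedBy_upper l1 l2 e' he' hCe')
      ⟨y, hye', rfl⟩ hye

/-- The two faces lie on opposite sides of `e`, so a common edge lies on the line of `e`, and within
a face that line is reached only along `e`. -/
theorem carrier_subset_of_boundedBy (hcor : S.pattern.NoStraightCorner)
    (hA : A.BoundedBy e'.carrier) (hB : B.BoundedBy e'.carrier) : e'.carrier ⊆ e.carrier := by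
  intro x hx
  have h1 := f.lower.closure_nonneg (hA hx)
  have h2 := f.upper.closure_nonneg (hB hx)
  rw [inner_neg_left] at h2
  exact CreasePattern.mem_crease_of_mem_line S.convex hcor f.lower f.boundedBy_lower (hA hx)
    (f.lower.mem_line_iff.2 (by linarith))

/-- In the folding, the inner part of a widened crease meets no face at an intermediate height. -/
theorem exists_scale_folded_face (hwrap : S.NonWrapping) (hh : ω.IsHeight h) (C : S.pattern.Face)
    {δ : ℝ} (hδ : 0 < δ) : ∃ s₀ > 0, ∀ s t : ℝ, 0 < s → s < s₀ → δ ≤ t → t ≤ L - δ →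
      ∀ x ∈ C.carrier, S.fold x = g (u + t • d + (s * (ω.width e / 2)) • n) →
        h A < h C → h C < h B → False := by
  have hw := f.width_pos
  -- If the face misses the crease in the folding, compactness separates them. If it does not, a
  -- meeting at an intermediate height would give the very disjointness that fails.
  by_cases hdisj : Disjoint (S.fold '' closure C.carrier)
      (S.fold '' (e.carrier \ S.pattern.vertices))
  · obtain ⟨gC, hgC⟩ := exists_isometry C
    have hK : IsCompact (S.fold '' closure C.carrier) := by
      rw [Set.image_congr hgC]
      exact C.isCompact_closure.image gC.continuous
    have hK' : IsCompact (g '' ((fun t : ℝ => u + t • d) '' Icc δ (L - δ))) :=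
      (isCompact_arc _ _ _ _).image g.continuous
    have hd : Disjoint (S.fold '' closure C.carrier)
        (g '' ((fun t : ℝ => u + t • d) '' Icc δ (L - δ))) := by
      refine hdisj.mono_right ?_
      rintro _ ⟨_, ⟨t, ht, rfl⟩, rfl⟩
      exact ⟨_, f.arc_subset hδ ⟨t, ht, rfl⟩,
        f.fold_crease (by linarith [ht.1]) (by linarith [ht.2])⟩
    obtain ⟨η, hη, H⟩ := exists_pos_le_dist_of_disjoint hK hK' hd
    refine ⟨η / ω.width e, by positivity, fun s t hs hss h1 h2 x hx hxe _ _ => ?_⟩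
    rw [lt_div_iff₀ hw] at hss
    have := H _ ⟨x, subset_closure hx, rfl⟩ _ ⟨_, ⟨t, ⟨h1, h2⟩, rfl⟩, rfl⟩
    rw [hxe, g.dist_map, f.lower.dist_offset, abs_of_pos (by positivity)] at this
    nlinarith
  · obtain ⟨s₀, hs₀, H⟩ := f.exists_offset_mem hδ
    refine ⟨s₀, hs₀, fun s t hs hss h1 h2 x hx hxe h3 h4 => hdisj ?_⟩
    obtain ⟨⟨xA, hxA, hA⟩, ⟨xB, hxB, hB⟩⟩ := H s t hs hss h1 h2
    exact f.disjoint_face hwrap hh hx hxA hxB (hA.trans hxe.symm) (hB.trans hxe.symm) h3 h4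

/-- In the plane, the inner part of a widened crease meets no reduced face. -/
theorem exists_scale_flat_face (C : S.pattern.Face) {δ : ℝ} (hδ : 0 < δ) :
    ∃ s₀ > 0, ∀ s t k : ℝ, 0 < s → s < s₀ → δ ≤ t → t ≤ L - δ → |k| ≤ s * (ω.width e / 2) →
      u + t • d + k • n ∉ interior (untrimmedFace ω s C) := by
  have hw := f.width_pos
  by_cases hC : C.BoundedBy e.carrier
  · refine ⟨1, one_pos, fun s t k hs _ _ _ hk hmem => ?_⟩
    obtain ⟨n', hn', hfr, hk'⟩ : ∃ n' : Plane, IsFrame d n' ∧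
        S.pattern.EdgeFrame e.carrier C.carrier u d n' L ∧
        ∃ k' : ℝ, u + t • d + k • n = u + t • d + k' • n' ∧ |k'| ≤ s * (ω.width e / 2) := by
      rcases f.eq_or_eq C hC with rfl | rfl
      · exact ⟨n, f.lower.toIsFrame, f.lower, k, rfl, hk⟩
      · exact ⟨-n, f.upper.toIsFrame, f.upper, -k, by simp, by simpa using hk⟩
    obtain ⟨k', hkk, hk'⟩ := hk'
    rw [hkk] at hmem
    -- A strip point inside the cut face would leave room to move closer to the crease than the cut
    -- allows.
    have hlim : Tendsto (fun ε : ℝ => u + t • d + (k' + -ε) • n') (𝓝[>] 0)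
        (𝓝 (u + t • d + k' • n')) := by
      have : Continuous fun ε : ℝ => u + t • d + (k' + -ε) • n' := by fun_prop
      simpa using (this.tendsto 0).mono_left nhdsWithin_le_nhds
    obtain ⟨ε, hε, hε0⟩ := ((hlim.eventually (isOpen_interior.mem_nhds hmem)).and
      (self_mem_nhdsWithin : ∀ᶠ ε : ℝ in 𝓝[>] 0, ε ∈ Ioi (0 : ℝ))).exists
    have hε0 : 0 < ε := hε0
    have hm := interior_subset hε
    have := hm.2 e hC
    rw [show e.line = (affineSpan ℝ e.carrier : Set Plane) from rfl,
      hfr.infDist_of_mem_closure hm.1, hfr.inner_coord] at this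
    linarith [le_abs_self k']
  · have hd : Disjoint ((fun t : ℝ => u + t • d) '' Icc δ (L - δ)) (closure C.carrier) := by
      rw [Set.disjoint_left]
      intro x hx hxC
      have := f.arc_subset hδ hx
      exact hC (CreasePattern.boundedBy_of_mem e.isEdge this.1 this.2 hxC)
    obtain ⟨η, hη, H⟩ := exists_pos_le_dist_of_disjoint (isCompact_arc _ _ _ _)
      C.isCompact_closure hd
    refine ⟨η / ω.width e, by positivity, fun s t k hs hss h1 h2 hk hmem => ?_⟩
    rw [lt_div_iff₀ hw] at hss
    have := H _ ⟨t, ⟨h1, h2⟩, rfl⟩ _ (interior_subset hmem).1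
    rw [dist_comm, f.lower.dist_offset] at this
    nlinarith

include f'

/-- The four faces share the folded point `q`, so any two distinct ones are ordered by height; both
lower faces are below `k` and both upper faces above it. If the lower faces differ, the higher of
them lies between the faces of the other crease; if they agree, the lower of the two upper faces
does. If both pairs agree, the creases coincide. -/
theorem disjoint_crease (hwrap : S.NonWrapping) (hcor : S.pattern.NoStraightCorner)
    (hh : ω.IsHeight h) (hne : e ≠ e') {xA xB xA' xB' : Plane} (hxA : xA ∈ A.carrier)
    (hxB : xB ∈ B.carrier) (hxA' : xA' ∈ A'.carrier) (hxB' : xB' ∈ B'.carrier) {q : Plane}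
    (hA : S.fold xA = q) (hB : S.fold xB = q) (hA' : S.fold xA' = q) (hB' : S.fold xB' = q) {k : ℝ}
    (h1 : h A < k) (h2 : k < h B) (h3 : h A' < k) (h4 : k < h B') :
    Disjoint (S.fold '' e'.carrier) (S.fold '' (e.carrier \ S.pattern.vertices)) ∨
      Disjoint (S.fold '' e.carrier) (S.fold '' (e'.carrier \ S.pattern.vertices)) := by
  have lay : ∀ {C D : S.pattern.Face} {x y : Plane}, x ∈ C.carrier → y ∈ D.carrier →
      S.fold x = q → S.fold y = q → h C < h D → S.layer C D := by
    intro C D x y hx hy hxq hyq hlt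
    exact layer_of_lt hh ⟨q, ⟨x, hx, hxq⟩, ⟨y, hy, hyq⟩⟩ hlt
  have eqf : ∀ {C D : S.pattern.Face} {x y : Plane}, x ∈ C.carrier → y ∈ D.carrier →
      S.fold x = q → S.fold y = q → h C = h D → C = D := by
    intro C D x y hx hy hxq hyq heq
    by_contra hCD
    exact height_ne hh hCD ⟨q, ⟨x, hx, hxq⟩, ⟨y, hy, hyq⟩⟩ heq
  have b1 := f.boundedBy_lower
  have b2 := f.boundedBy_upper
  have b3 := f'.boundedBy_lower
  have b4 := f'.boundedBy_upper
  rcases lt_trichotomy (h A) (h A') with hlt | heq | hgt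
  · exact Or.inl (hwrap e A B A' b1 b2 (lay hxA hxA' hA hA' hlt)
      (lay hxA' hxB hA' hB (by linarith)) _ e'.isEdge b3)
  · obtain rfl := eqf hxA hxA' hA hA' heq
    rcases lt_trichotomy (h B) (h B') with hlt | heq | hgt
    · exact Or.inr (hwrap e' A B' B b3 b4 (lay hxA hxB hA hB (by linarith))
        (lay hxB hxB' hB hB' hlt) _ e.isEdge b2)
    · obtain rfl := eqf hxB hxB' hB hB' heq
      exact (hne (Subtype.ext (Subset.antisymm
        (f'.carrier_subset_of_boundedBy hcor b1 b2)
        (f.carrier_subset_of_boundedBy hcor b3 b4)))).elim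
    · exact Or.inl (hwrap e A B B' b1 b2 (lay hxA hxB' hA hB' (by linarith))
        (lay hxB' hxB hB' hB hgt) _ e'.isEdge b4)
  · exact Or.inr (hwrap e' A' B' A b3 b4 (lay hxA' hxA hA' hA hgt)
      (lay hxA hxB' hA hB' (by linarith)) _ e.isEdge b1)

/-- Either the folded inner arcs have positive distance, which offsets of order `s` cannot bridge,
or they meet, and then a common point of the strips would lie under all four faces and contradict
`disjoint_crease`. -/
theorem exists_scale_folded_crease (hwrap : S.NonWrapping) (hcor : S.pattern.NoStraightCorner)
    (hh : ω.IsHeight h) (hne : e ≠ e') {δ : ℝ} (hδ : 0 < δ) :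
    ∃ s₀ > 0, ∀ s t t' : ℝ, 0 < s → s < s₀ → δ ≤ t → t ≤ L - δ → δ ≤ t' → t' ≤ L' - δ →
      g (u + t • d + (s * (ω.width e / 2)) • n) = g' (u' + t' • d' + (s * (ω.width e' / 2)) • n') →
      ∀ k, h A < k → k < h B → h A' < k → k < h B' → False := by
  have hw := f.width_pos
  have hw' := f'.width_pos
  by_cases hdisj : Disjoint (g '' ((fun t : ℝ => u + t • d) '' Icc δ (L - δ)))
      (g' '' ((fun t : ℝ => u' + t • d') '' Icc δ (L' - δ)))
  · obtain ⟨η, hη, H⟩ := exists_pos_le_dist_of_disjoint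
      ((isCompact_arc _ _ _ _).image g.continuous) ((isCompact_arc _ _ _ _).image g'.continuous)
      hdisj
    refine ⟨η / (ω.width e + ω.width e'), by positivity,
      fun s t t' hs hss h1 h2 h3 h4 heq k _ _ _ _ => ?_⟩
    rw [lt_div_iff₀ (by positivity)] at hss
    have a1 := H _ ⟨_, ⟨t, ⟨h1, h2⟩, rfl⟩, rfl⟩ _ ⟨_, ⟨t', ⟨h3, h4⟩, rfl⟩, rfl⟩
    have a2 := dist_triangle_left (g (u + t • d)) (g' (u' + t' • d'))
      (g (u + t • d + (s * (ω.width e / 2)) • n))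
    rw [g.dist_map, heq, g'.dist_map, f.lower.dist_offset, f'.lower.dist_offset,
      abs_of_pos (by positivity), abs_of_pos (by positivity)] at a2
    nlinarith
  · obtain ⟨s₁, hs₁, H₁⟩ := f.exists_offset_mem hδ
    obtain ⟨s₂, hs₂, H₂⟩ := f'.exists_offset_mem hδ
    refine ⟨min s₁ s₂, by positivity, fun s t t' hs hss h1 h2 h3 h4 heq k k1 k2 k3 k4 => hdisj ?_⟩
    obtain ⟨⟨xA, hxA, hA⟩, ⟨xB, hxB, hB⟩⟩ := H₁ s t hs (hss.trans_le (min_le_left _ _)) h1 h2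
    obtain ⟨⟨xA', hxA', hA'⟩, ⟨xB', hxB', hB'⟩⟩ :=
      H₂ s t' hs (hss.trans_le (min_le_right _ _)) h3 h4
    rw [← heq] at hA' hB'
    have i1 : g '' ((fun t : ℝ => u + t • d) '' Icc δ (L - δ)) ⊆
        S.fold '' (e.carrier \ S.pattern.vertices) := by
      rintro _ ⟨_, ⟨t, ht, rfl⟩, rfl⟩
      exact ⟨_, f.arc_subset hδ ⟨t, ht, rfl⟩,
        f.fold_crease (by linarith [ht.1]) (by linarith [ht.2])⟩
    have i2 : g' '' ((fun t : ℝ => u' + t • d') '' Icc δ (L' - δ)) ⊆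
        S.fold '' (e'.carrier \ S.pattern.vertices) := by
      rintro _ ⟨_, ⟨t, ht, rfl⟩, rfl⟩
      exact ⟨_, f'.arc_subset hδ ⟨t, ht, rfl⟩,
        f'.fold_crease (by linarith [ht.1]) (by linarith [ht.2])⟩
    rcases f.disjoint_crease f' hwrap hcor hh hne hxA hxB hxA' hxB' hA hB hA' hB' k1 k2 k3 k4
      with hd | hd
    · exact (hd.mono (i2.trans (image_mono sdiff_subset)) i1).symm
    · exact hd.mono (i1.trans (image_mono sdiff_subset)) i2

theorem exists_scale_flat_crease (hne : e ≠ e') {δ : ℝ} (hδ : 0 < δ) :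
    ∃ s₀ > 0, ∀ s t t' k k' : ℝ, 0 < s → s < s₀ → δ ≤ t → t ≤ L - δ → δ ≤ t' → t' ≤ L' - δ →
      |k| ≤ s * (ω.width e / 2) → |k'| ≤ s * (ω.width e' / 2) →
      u + t • d + k • n ≠ u' + t' • d' + k' • n' := by
  have hw := f.width_pos
  have hw' := f'.width_pos
  have hd : Disjoint ((fun t : ℝ => u + t • d) '' Icc δ (L - δ))
      ((fun t : ℝ => u' + t • d') '' Icc δ (L' - δ)) := by
    rw [Set.disjoint_left]
    intro x hx hx'
    have m1 := f.arc_subset hδ hx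
    have m2 := f'.arc_subset hδ hx'
    obtain ⟨a, b, hab, he⟩ := e.isEdge
    obtain ⟨a', b', hab', he'⟩ := e'.isEdge
    rcases S.pattern.edges_meet _ _ _ _ x hab hab' (he ▸ m1.1) (he' ▸ m2.1) with h1 | h1
    · exact m1.2 h1
    · exact hne (Subtype.ext (by
        change e.carrier = e'.carrier
        rw [he, he', h1]))
  obtain ⟨η, hη, H⟩ := exists_pos_le_dist_of_disjoint (isCompact_arc _ _ _ _)
    (isCompact_arc _ _ _ _) hd
  refine ⟨η / (ω.width e + ω.width e'), by positivity,
    fun s t t' k k' hs hss h1 h2 h3 h4 hk hk' heq => ?_⟩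
  rw [lt_div_iff₀ (by positivity)] at hss
  have a1 := H _ ⟨t, ⟨h1, h2⟩, rfl⟩ _ ⟨t', ⟨h3, h4⟩, rfl⟩
  have a2 := dist_triangle_left (u + t • d) (u' + t' • d') (u + t • d + k • n)
  rw [f.lower.dist_offset, heq, f'.lower.dist_offset] at a2
  nlinarith

end CreaseFrame
end FlatFoldedState


/-! ### From local pictures to small scales, and back. -/

section Families
variable {V : Type*} [NormedAddCommGroup V] [NormedSpace ℝ V] {ι : Type*} [Finite ι]

theorem exists_small_of_mem_localPicture {z y : V} {Q : ℝ → Set V} (hy : y ∈ localPicture z Q)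
    {r : ℝ} (hr : 0 < r) : ∃ s, 0 < s ∧ s < r ∧ ‖s • y‖ < r ∧ z + s • y ∈ Q s := by
  have hy' : ∀ᶠ t : ℝ in 𝓝[>] 0, z + t • y ∈ Q t := hy
  obtain ⟨s, h3, h4, h5, h6⟩ := (hy'.and (eventually_small y hr)).exists
  exact ⟨s, h4, h5, h6, h3⟩

variable {Z : Set V} (hZ : Z.Finite) {Out : ℝ → ℝ → ι → Set V}
  (hmono : ∀ i s δ δ', δ' ≤ δ → Out δ s i ⊆ Out δ' s i)
  (hdis : ∀ i j, i ≠ j → ∀ δ, 0 < δ → ∃ s₀ > 0, ∀ s, 0 < s → s < s₀ →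
    Disjoint (Out δ s i) (Out δ s j))
include hZ hmono hdis

/-- If the pieces do not intersect strictly near the points of `Z` and are separated elsewhere,
then they do not intersect strictly at small scales. -/
theorem exists_scale_of_localPicture {Q : ι → ℝ → Set V}
    (hconv : ∀ i, ∃ r > 0, ∀ s, 0 < s → s < r → Convex ℝ (Q i s))
    (hcon : ∀ z ∈ Z, ∀ i, ConicAt z (Q i))
    (hout : ∀ i r, 0 < r → ∃ δ > 0, ∃ s₀ > 0, ∀ s x, 0 < s → s < s₀ →
      x ∈ intrinsicInterior ℝ (Q i s) → (∀ z ∈ Z, r ≤ ‖x - z‖) → x ∈ Out δ s i)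
    (hloc : ∀ z ∈ Z, ∀ i j, i ≠ j →
      ¬ StrictlyIntersect (localPicture z (Q i)) (localPicture z (Q j))) :
    ∃ s₀ > 0, ∀ s, 0 < s → s < s₀ → ∀ i j, i ≠ j → ¬ StrictlyIntersect (Q i s) (Q j s) := by
  have : Finite Z := hZ
  obtain ⟨r₁, hr₁, H₁⟩ := exists_pos_forall_of_finite
    (p := fun (i : ι) r => ∀ s, 0 < s → s < r → Convex ℝ (Q i s))
    (fun i r r' hle h s h0 h1 => h s h0 (h1.trans_le hle)) hconv
  obtain ⟨r₂, hr₂, H₂⟩ := exists_pos_forall_of_finite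
    (p := fun (i : Z × ι) r => ConicWithin r i.1.1 (Q i.2))
    (fun i r r' hle h => h.mono hle) (fun i => hcon i.1.1 i.1.2 i.2)
  have hr : 0 < min r₁ r₂ := by positivity
  obtain ⟨δ, hδ, H₃⟩ := exists_pos_forall_of_finite
    (p := fun (i : ι) δ => ∃ s₀ > 0, ∀ s x, 0 < s → s < s₀ →
      x ∈ intrinsicInterior ℝ (Q i s) → (∀ z ∈ Z, min r₁ r₂ ≤ ‖x - z‖) → x ∈ Out δ s i)
    (fun i δ δ' hle ⟨s₀, h0, h⟩ => ⟨s₀, h0, fun s x a b c d => hmono _ _ _ _ hle (h s x a b c d)⟩)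
    (fun i => hout i _ hr)
  obtain ⟨s₁, hs₁, H₄⟩ := exists_pos_forall_of_finite
    (p := fun (i : ι) s₀ => ∀ s x, 0 < s → s < s₀ →
      x ∈ intrinsicInterior ℝ (Q i s) → (∀ z ∈ Z, min r₁ r₂ ≤ ‖x - z‖) → x ∈ Out δ s i)
    (fun i r r' hle h s x h0 h1 => h s x h0 (h1.trans_le hle)) H₃
  obtain ⟨s₂, hs₂, H₅⟩ := exists_pos_forall_of_finite
    (p := fun (i : {p : ι × ι // p.1 ≠ p.2}) s₀ => ∀ s, 0 < s → s < s₀ →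
      Disjoint (Out δ s i.1.1) (Out δ s i.1.2))
    (fun i r r' hle h s h0 h1 => h s h0 (h1.trans_le hle)) (fun i => hdis _ _ i.2 δ hδ)
  refine ⟨min (min r₁ r₂) (min s₁ s₂), by positivity, fun s hs hss i j hij hint => ?_⟩
  have hsr : s < min r₁ r₂ := hss.trans_le (min_le_left _ _)
  obtain ⟨x, hxi, hxj⟩ := hint
  -- Far from `Z` the separation applies; near a point of `Z` the intersection passes to the local
  -- pictures there.
  by_cases hfar : ∀ z ∈ Z, min r₁ r₂ ≤ ‖x - z‖
  · exact Set.disjoint_left.1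
      (H₅ ⟨(i, j), hij⟩ s hs (hss.trans_le ((min_le_right _ _).trans (min_le_right _ _))))
      (H₄ i s x hs (hss.trans_le ((min_le_right _ _).trans (min_le_left _ _))) hxi hfar)
      (H₄ j s x hs (hss.trans_le ((min_le_right _ _).trans (min_le_left _ _))) hxj hfar)
  · push Not at hfar
    obtain ⟨z, hz, hxz⟩ := hfar
    exact hloc z hz i j hij (((H₂ (⟨z, hz⟩, i)).mono (min_le_right _ _)).strictlyIntersect_localPicture
      ((H₂ (⟨z, hz⟩, j)).mono (min_le_right _ _))
      (fun s h0 h1 => H₁ i s h0 (h1.trans_le (min_le_left _ _)))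
      (fun s h0 h1 => H₁ j s h0 (h1.trans_le (min_le_left _ _))) hs hsr hxi hxj hxz)

/-- If the points of the local pictures can be moved, by a change of scale, to places where the
pieces are separated, then the local pictures do not intersect strictly. -/
theorem exists_trimming_scale {Q : ℝ → ι → ℝ → Set V} (μ : V → ℝ)
    (hpos : ∀ z ∈ Z, ∀ i, ∃ ρ₀ > 0, ∀ ρ, 0 < ρ → ρ ≤ ρ₀ → ∃ δ > 0, ∃ ε₀ > 0, ∀ ε, 0 < ε → ε ≤ ε₀ →
      ∀ y ∈ intrinsicInterior ℝ (localPicture z (Q ε i)),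
        z + (ρ / max (μ y) (1 / ε)) • y ∈ Out δ (ρ / max (μ y) (1 / ε)) i) :
    ∃ ε₀ > 0, ∀ ε, 0 < ε → ε ≤ ε₀ → ∀ z ∈ Z, ∀ i j, i ≠ j →
      ¬ StrictlyIntersect (localPicture z (Q ε i)) (localPicture z (Q ε j)) := by
  have : Finite Z := hZ
  obtain ⟨ρ, hρ, H₁⟩ := exists_pos_forall_of_finite
    (p := fun (i : Z × ι) ρ₀ => ∀ ρ, 0 < ρ → ρ ≤ ρ₀ → ∃ δ > 0, ∃ ε₀ > 0, ∀ ε, 0 < ε → ε ≤ ε₀ →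
      ∀ y ∈ intrinsicInterior ℝ (localPicture i.1.1 (Q ε i.2)),
        i.1.1 + (ρ / max (μ y) (1 / ε)) • y ∈ Out δ (ρ / max (μ y) (1 / ε)) i.2)
    (fun i r r' hle h ρ h0 h1 => h ρ h0 (h1.trans hle)) (fun i => hpos i.1.1 i.1.2 i.2)
  obtain ⟨δ, hδ, H₂⟩ := exists_pos_forall_of_finite
    (p := fun (i : Z × ι) δ => ∃ ε₀ > 0, ∀ ε, 0 < ε → ε ≤ ε₀ →
      ∀ y ∈ intrinsicInterior ℝ (localPicture i.1.1 (Q ε i.2)),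
        i.1.1 + (ρ / max (μ y) (1 / ε)) • y ∈ Out δ (ρ / max (μ y) (1 / ε)) i.2)
    (fun i δ δ' hle ⟨ε₀, h0, h⟩ => ⟨ε₀, h0, fun ε a b y c => hmono _ _ _ _ hle (h ε a b y c)⟩)
    (fun i => H₁ i ρ hρ le_rfl)
  obtain ⟨ε₁, hε₁, H₃⟩ := exists_pos_forall_of_finite
    (p := fun (i : Z × ι) ε₀ => ∀ ε, 0 < ε → ε ≤ ε₀ →
      ∀ y ∈ intrinsicInterior ℝ (localPicture i.1.1 (Q ε i.2)),
        i.1.1 + (ρ / max (μ y) (1 / ε)) • y ∈ Out δ (ρ / max (μ y) (1 / ε)) i.2)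
    (fun i r r' hle h ε h0 h1 => h ε h0 (h1.trans hle)) H₂
  obtain ⟨s₀, hs₀, H₄⟩ := exists_pos_forall_of_finite
    (p := fun (i : {p : ι × ι // p.1 ≠ p.2}) s₀ => ∀ s, 0 < s → s < s₀ →
      Disjoint (Out δ s i.1.1) (Out δ s i.1.2))
    (fun i r r' hle h s h0 h1 => h s h0 (h1.trans_le hle)) (fun i => hdis _ _ i.2 δ hδ)
  -- `ρ` and `δ` are fixed before `ε`, so `s₀` is known here; the scale assigned to `y` is at most
  -- `ρ * ε`, hence below `s₀`.
  refine ⟨min ε₁ (s₀ / (2 * ρ)), by positivity, fun ε hε hεε z hz i j hij hint => ?_⟩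
  obtain ⟨y, hyi, hyj⟩ := hint
  have h1 : 0 < max (μ y) (1 / ε) := lt_max_of_lt_right (by positivity)
  have hlt : ρ / max (μ y) (1 / ε) < s₀ := by
    have h2 : ρ / max (μ y) (1 / ε) ≤ ρ * ε := by
      rw [div_le_iff₀ h1]
      calc ρ = ρ * ε * (1 / ε) := by field_simp
        _ ≤ _ := by gcongr; exact le_max_right _ _
    have h3 : ε ≤ s₀ / (2 * ρ) := hεε.trans (min_le_right _ _)
    rw [le_div_iff₀ (by positivity)] at h3
    linarith
  -- The scale depends on `y` alone, so both pieces are tested at the same scale and the same point.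
  exact Set.disjoint_left.1 (H₄ ⟨(i, j), hij⟩ _ (by positivity) hlt)
    (H₃ (⟨z, hz⟩, i) ε hε (hεε.trans (min_le_left _ _)) y hyi)
    (H₃ (⟨z, hz⟩, j) ε hε (hεε.trans (min_le_left _ _)) y hyj)

end Families

/-! ### The separated parts of all pieces. -/

namespace FlatFoldedState
variable {S : FlatFoldedState} {ω : S.WeightAssignment} {h : S.pattern.Face → ℝ}

/-- Coordinates for all creases. -/
structure CreaseFrames (ω : S.WeightAssignment) (h : S.pattern.Face → ℝ) where
  A : S.pattern.Crease → S.pattern.Face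
  B : S.pattern.Crease → S.pattern.Face
  u : S.pattern.Crease → Plane
  d : S.pattern.Crease → Plane
  n : S.pattern.Crease → Plane
  L : S.pattern.Crease → ℝ
  g : S.pattern.Crease → Plane ≃ᵃⁱ[ℝ] Plane
  frame : ∀ e, CreaseFrame ω h e (A e) (B e) (u e) (d e) (n e) (L e) (g e)

theorem exists_creaseFrames (hh : ω.IsHeight h) : Nonempty (CreaseFrames ω h) := by
  choose A B u d n L g f using fun e => exists_creaseFrame hh e
  exact ⟨⟨A, B, u, d, n, L, g, f⟩⟩

theorem finite_piece : Finite S.Piece := by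
  have := S.finite_face
  have := CreasePattern.finite_crease (P := S.pattern)
  infer_instance

namespace CreaseFrames
variable (Φ : CreaseFrames ω h)

/-- The parts of the planar pieces away from the ends of the creases, not depending on the
trimming. -/
def outFlat (δ s : ℝ) : S.Piece → Set Plane
  | Sum.inl C => interior (untrimmedFace ω s C)
  | Sum.inr e => {x | ∃ t k : ℝ, δ ≤ t ∧ t ≤ Φ.L e - δ ∧ |k| ≤ s * (ω.width e / 2) ∧
      x = Φ.u e + t • Φ.d e + k • Φ.n e}

/-- The parts of the folded pieces away from the ends of the creases, not depending on the
trimming. -/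
def outFolded (δ s : ℝ) : S.Piece → Set Space
  | Sum.inl C => {q | ∃ x ∈ interior (untrimmedFace ω s C), q = (S.fold x, s * h C)}
  | Sum.inr e => {q | ∃ t k : ℝ, δ ≤ t ∧ t ≤ Φ.L e - δ ∧ h (Φ.A e) < k ∧ k < h (Φ.B e) ∧
      q = (Φ.g e (Φ.u e + t • Φ.d e + (s * (ω.width e / 2)) • Φ.n e), s * k)}

theorem outFlat_mono (i : S.Piece) (s δ δ' : ℝ) (hle : δ' ≤ δ) :
    Φ.outFlat δ s i ⊆ Φ.outFlat δ' s i := by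
  rcases i with C | e
  · exact Subset.rfl
  · rintro x ⟨t, k, h1, h2, h3⟩
    exact ⟨t, k, hle.trans h1, by linarith, h3⟩

theorem outFolded_mono (i : S.Piece) (s δ δ' : ℝ) (hle : δ' ≤ δ) :
    Φ.outFolded δ s i ⊆ Φ.outFolded δ' s i := by
  rcases i with C | e
  · exact Subset.rfl
  · rintro x ⟨t, k, h1, h2, h3⟩
    exact ⟨t, k, hle.trans h1, by linarith, h3⟩

theorem disjoint_outFlat (i j : S.Piece) (hij : i ≠ j) (δ : ℝ) (hδ : 0 < δ) :
    ∃ s₀ > 0, ∀ s, 0 < s → s < s₀ → Disjoint (Φ.outFlat δ s i) (Φ.outFlat δ s j) := by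
  have hfc : ∀ (e : S.pattern.Crease) (C : S.pattern.Face), ∃ s₀ > 0, ∀ s, 0 < s → s < s₀ →
      Disjoint (Φ.outFlat δ s (Sum.inr e)) (Φ.outFlat δ s (Sum.inl C)) := by
    intro e C
    obtain ⟨s₀, hs₀, H⟩ := (Φ.frame e).exists_scale_flat_face C hδ
    refine ⟨s₀, hs₀, fun s hs hss => Set.disjoint_left.2 ?_⟩
    rintro _ ⟨t, k, h1, h2, h3, rfl⟩
    exact H s t k hs hss h1 h2 h3
  rcases i with C | e <;> rcases j with C' | e'
  · refine ⟨1, one_pos, fun s _ _ => Set.disjoint_left.2 fun x h1 h2 => hij ?_⟩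
    rw [CreasePattern.Face.eq_of_mem (interior_untrimmedFace_subset s C h1)
      (interior_untrimmedFace_subset s C' h2)]
  · obtain ⟨s₀, hs₀, H⟩ := hfc e' C
    exact ⟨s₀, hs₀, fun s hs hss => (H s hs hss).symm⟩
  · exact hfc e C'
  · obtain ⟨s₀, hs₀, H⟩ := (Φ.frame e).exists_scale_flat_crease (Φ.frame e')
      (fun he => hij (congrArg Sum.inr he)) hδ
    refine ⟨s₀, hs₀, fun s hs hss => Set.disjoint_left.2 ?_⟩
    rintro _ ⟨t, k, h1, h2, h3, rfl⟩ ⟨t', k', h1', h2', h3', he⟩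
    exact H s t t' k k' hs hss h1 h2 h1' h2' h3 h3' he

/-- Comparing heights first reduces each case to the plane: two overlapping faces never have equal
heights, and a crease is met only strictly between the heights of its faces. -/
theorem disjoint_outFolded (hwrap : S.NonWrapping) (hcor : S.pattern.NoStraightCorner)
    (hh : ω.IsHeight h) (i j : S.Piece) (hij : i ≠ j) (δ : ℝ) (hδ : 0 < δ) :
    ∃ s₀ > 0, ∀ s, 0 < s → s < s₀ → Disjoint (Φ.outFolded δ s i) (Φ.outFolded δ s j) := by
  have hfc : ∀ (e : S.pattern.Crease) (C : S.pattern.Face), ∃ s₀ > 0, ∀ s, 0 < s → s < s₀ →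
      Disjoint (Φ.outFolded δ s (Sum.inr e)) (Φ.outFolded δ s (Sum.inl C)) := by
    intro e C
    obtain ⟨s₀, hs₀, H⟩ := (Φ.frame e).exists_scale_folded_face hwrap hh C hδ
    refine ⟨s₀, hs₀, fun s hs hss => Set.disjoint_left.2 ?_⟩
    rintro _ ⟨t, k, h1, h2, h3, h4, rfl⟩ ⟨x, hx, he⟩
    obtain ⟨e1, e2⟩ := Prod.ext_iff.1 he
    have hk : k = h C := mul_left_cancel₀ hs.ne' e2
    subst hk
    exact H s t hs hss h1 h2 x (interior_untrimmedFace_subset s C hx) e1.symm h3 h4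
  rcases i with C | e <;> rcases j with C' | e'
  · refine ⟨1, one_pos, fun s hs _ => Set.disjoint_left.2 ?_⟩
    rintro _ ⟨x, hx, rfl⟩ ⟨x', hx', he⟩
    obtain ⟨e1, e2⟩ := Prod.ext_iff.1 he
    exact height_ne hh (fun he => hij (congrArg Sum.inl he))
      ⟨S.fold x, ⟨x, interior_untrimmedFace_subset s C hx, rfl⟩,
        ⟨x', interior_untrimmedFace_subset s C' hx', e1.symm⟩⟩ (mul_left_cancel₀ hs.ne' e2)
  · obtain ⟨s₀, hs₀, H⟩ := hfc e' C
    exact ⟨s₀, hs₀, fun s hs hss => (H s hs hss).symm⟩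
  · exact hfc e C'
  · obtain ⟨s₀, hs₀, H⟩ := (Φ.frame e).exists_scale_folded_crease (Φ.frame e') hwrap hcor hh
      (fun he => hij (congrArg Sum.inr he)) hδ
    refine ⟨s₀, hs₀, fun s hs hss => Set.disjoint_left.2 ?_⟩
    rintro _ ⟨t, k, h1, h2, h3, h4, rfl⟩ ⟨t', k', h1', h2', h3', h4', he⟩
    obtain ⟨e1, e2⟩ := Prod.ext_iff.1 he
    have hk : k = k' := mul_left_cancel₀ hs.ne' e2
    subst hk
    exact H s t t' hs hss h1 h2 h1' h2' e1 k h3 h4 h3' h4'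

end CreaseFrames
end FlatFoldedState


/-! ### Conicity of the pieces and their shape far from the vertices. -/

theorem AffineIsometryEquiv.map_add_smul (g : Plane ≃ᵃⁱ[ℝ] Plane) (z y : Plane) (s : ℝ) :
    g (z + s • y) = g z + s • g.linearIsometryEquiv y := by
  simpa using g.map_coord z y 0 s 0

namespace FlatFoldedState
variable {S : FlatFoldedState} {ω : S.WeightAssignment} {h : S.pattern.Face → ℝ}

section Face
variable {c : S.Trimming} {C : S.pattern.Face} {g : Plane ≃ᵃⁱ[ℝ] Plane}
  (hg : ∀ x ∈ closure C.carrier, S.fold x = g x)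
include hg

theorem foldedPiece_face (s : ℝ) :
    ω.foldedPiece h c s (Sum.inl C) = (g '' ω.reducedFace c s C) ×ˢ {s * h C} := by
  ext ⟨x, k⟩
  constructor
  · rintro ⟨y, hy, he⟩
    obtain ⟨rfl, rfl⟩ := Prod.ext_iff.1 he
    exact ⟨⟨y, hy, (hg y hy.1).symm⟩, rfl⟩
  · rintro ⟨⟨y, hy, hyx⟩, hk⟩
    exact ⟨y, hy, Prod.ext ((hg y hy.1).trans hyx) hk.symm⟩

theorem add_smul_mem_foldedPiece_iff {s : ℝ} (hs : 0 < s) (z : Plane) (y : Space) :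
    ((z, 0) : Space) + s • y ∈ ω.foldedPiece h c s (Sum.inl C) ↔ y.2 = h C ∧
      g.symm z + s • g.symm.linearIsometryEquiv y.1 ∈ ω.reducedFace c s C := by
  rw [foldedPiece_face hg, ← g.symm.map_add_smul, mem_prod, and_comm]
  refine and_congr ?_ ?_
  · simp [hs.ne']
  · constructor
    · rintro ⟨x, hx, he⟩
      have he : g x = z + s • y.1 := he
      rwa [← he, g.symm_apply_apply]
    · intro hx
      exact ⟨_, hx, g.apply_symm_apply _⟩

omit hg in
theorem convex_foldedPiece_face {s : ℝ} (hs : 0 < s) :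
    Convex ℝ (ω.foldedPiece h c s (Sum.inl C)) := by
  obtain ⟨g, hg⟩ := exists_isometry C
  rw [foldedPiece_face hg]
  exact ((convex_reducedFace ω c C hs).affine_image
    (g.toAffineEquiv : Plane →ᵃ[ℝ] Plane)).prod (convex_singleton _)

omit hg in
theorem conicAt_foldedPiece_face (z : Plane) :
    ConicAt ((z, 0) : Space) fun s => ω.foldedPiece h c s (Sum.inl C) := by
  obtain ⟨g, hg⟩ := exists_isometry C
  obtain ⟨r, hr, H⟩ := conicAt_reducedFace ω c C (g.symm z)
  -- The norm on the product dominates that of the planar part, so the planar radius can be reused.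
  have hn : ∀ (s : ℝ) (y : Space), ‖s • g.symm.linearIsometryEquiv y.1‖ ≤ ‖s • y‖ := by
    intro s y
    rw [norm_smul, LinearIsometryEquiv.norm_map, ← norm_smul]
    exact norm_fst_le (s • y)
  refine ⟨r, hr, fun s s' y h1 h2 h3 h4 h5 h6 hy => ?_⟩
  rw [add_smul_mem_foldedPiece_iff hg h1] at hy
  rw [add_smul_mem_foldedPiece_iff hg h3]
  exact ⟨hy.1, H s s' _ h1 h2 h3 h4 ((hn _ _).trans_lt h5) ((hn _ _).trans_lt h6) hy.2⟩

omit hg in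
theorem interior_reducedFace_nonempty (hc : IsBoundedTrimming ω c) :
    ∃ s₀ > 0, ∀ s, 0 < s → s < s₀ → (interior (ω.reducedFace c s C)).Nonempty := by
  obtain ⟨p, hp⟩ : C.carrier.Nonempty := by
    obtain ⟨p, hp, he⟩ := C.isRegion
    exact ⟨p, by rw [he]; exact mem_connectedComponentIn hp⟩
  obtain ⟨ρ, hρ, H⟩ := exists_ball_subset_reducedFace hc hp
  exact ⟨ρ, hρ, fun s hs hss => ⟨p, interior_maximal (H s hs hss) Metric.isOpen_ball
    (Metric.mem_ball_self hρ)⟩⟩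

omit hg in
theorem intrinsicInterior_reducedFace_subset (hc : IsBoundedTrimming ω c) :
    ∃ s₀ > 0, ∀ s, 0 < s → s < s₀ →
      intrinsicInterior ℝ (ω.reducedFace c s C) ⊆ interior (untrimmedFace ω s C) := by
  obtain ⟨s₀, hs₀, H⟩ := interior_reducedFace_nonempty (C := C) hc
  refine ⟨s₀, hs₀, fun s hs hss => ?_⟩
  rw [intrinsicInterior_eq_interior_of_nonempty (H s hs hss)]
  exact interior_mono (reducedFace_subset_untrimmedFace ω c C hs)

omit hg in
theorem intrinsicInterior_foldedPiece_face_subset (hc : IsBoundedTrimming ω c) :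
    ∃ s₀ > 0, ∀ s, 0 < s → s < s₀ → ∀ q ∈ intrinsicInterior ℝ (ω.foldedPiece h c s (Sum.inl C)),
      ∃ x ∈ interior (untrimmedFace ω s C), q = (S.fold x, s * h C) := by
  obtain ⟨g, hg⟩ := exists_isometry C
  obtain ⟨s₀, hs₀, H⟩ := interior_reducedFace_nonempty (C := C) hc
  refine ⟨s₀, hs₀, fun s hs hss q hq => ?_⟩
  have him : interior (g '' ω.reducedFace c s C) = g '' interior (ω.reducedFace c s C) :=
    (g.toHomeomorph.image_interior _).symm
  rw [foldedPiece_face hg] at hq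
  obtain ⟨h1, h2⟩ := mem_interior_of_mem_intrinsicInterior_slice
    (by rw [him]; exact (H s hs hss).image g) hq
  rw [him] at h1
  obtain ⟨x, hx, hxq⟩ := h1
  have hxu := interior_mono (reducedFace_subset_untrimmedFace ω c C hs) hx
  exact ⟨x, hxu, Prod.ext ((hxq.symm.trans (hg x (interior_subset hxu).1).symm)) h2⟩

end Face

/-- Height is linear and nonconstant on `X`, so neither extreme is attained in the relative
interior. This strictness is needed because a widened crease touches its two faces at the extreme
heights. -/
theorem snd_between_of_mem_intrinsicInterior {X : Set Space} {a b : ℝ} (hab : a < b)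
    (hX : ∀ x ∈ X, a ≤ x.2 ∧ x.2 ≤ b) (ha : ∃ x ∈ X, x.2 = a) (hb : ∃ x ∈ X, x.2 = b) {q : Space}
    (hq : q ∈ intrinsicInterior ℝ X) : a < q.2 ∧ q.2 < b := by
  obtain ⟨x, hx, hxa⟩ := ha
  obtain ⟨y, hy, hyb⟩ := hb
  refine ⟨lt_of_mem_intrinsicInterior (LinearMap.snd ℝ Plane ℝ) hq (fun z hz => (hX z hz).1) hy
    (by rw [LinearMap.snd_apply, hyb]; exact hab), ?_⟩
  have := lt_of_mem_intrinsicInterior (-LinearMap.snd ℝ Plane ℝ) hq (m := -b)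
    (fun z hz => by simpa using (hX z hz).2) hx (by simpa [hxa] using hab)
  simpa using this

theorem folded_strip_point (ω : S.WeightAssignment) (h : S.pattern.Face → ℝ)
    (e : S.pattern.Crease) (A : S.pattern.Face) (g : Plane ≃ᵃⁱ[ℝ] Plane) (u d n : Plane) (s t τ : ℝ) :
    ((g u, 0) : Space) + t • (g.linearIsometryEquiv d, 0) +
      s • (((ω.width e / 2) • g.linearIsometryEquiv n, h A) + τ • (0, ω.width e)) =
    (g (u + t • d + (s * (ω.width e / 2)) • n), s * (h A + τ * ω.width e)) := by
  rw [g.map_coord]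
  ext1
  · simp [smul_smul]
  · simp

namespace CreaseFrame
variable {e : S.pattern.Crease} {A B : S.pattern.Face} {u d n : Plane} {L : ℝ}
  {g : Plane ≃ᵃⁱ[ℝ] Plane} (f : CreaseFrame ω h e A B u d n L g)
include f

theorem norm_folded_direction : ‖((g.linearIsometryEquiv d, 0) : Space)‖ = 1 := by
  rw [Prod.norm_mk, LinearIsometryEquiv.norm_map, f.lower.norm_d]
  simp

variable (hcor : S.pattern.NoStraightCorner) {c : S.Trimming} (hc : IsBoundedTrimming ω c)
include hcor hc

theorem conicAt_flatPiece (z : Plane) : ConicAt z fun s => ω.flatPiece c s (Sum.inr e) := by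
  obtain ⟨lA, lB, rA, rB, -, -, -, -, s₀, hs₀, H⟩ := f.exists_piece_eq_strip hcor hc
  exact (conicAt_strip f.lower.posL f.lower.norm_d).congr hs₀
    fun s h0 h1 => (H s h0 h1).2.2.2.2.1.symm

theorem conicAt_foldedPiece (z : Space) : ConicAt z fun s => ω.foldedPiece h c s (Sum.inr e) := by
  obtain ⟨lA, lB, rA, rB, -, -, -, -, s₀, hs₀, H⟩ := f.exists_piece_eq_strip hcor hc
  exact (conicAt_strip f.lower.posL f.norm_folded_direction).congr hs₀
    fun s h0 h1 => (H s h0 h1).2.2.2.2.2.symm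

theorem flatPiece_of_far {r : ℝ} (hr : 0 < r) : ∃ s₀ > 0, ∀ s x, 0 < s → s < s₀ →
    x ∈ ω.flatPiece c s (Sum.inr e) → r ≤ ‖x - u‖ → r ≤ ‖x - (u + L • d)‖ →
    ∃ t k : ℝ, r / 2 ≤ t ∧ t ≤ L - r / 2 ∧ |k| ≤ s * (ω.width e / 2) ∧
      x = u + t • d + k • n := by
  have hw := f.width_pos
  obtain ⟨lA, lB, rA, rB, -, -, -, -, s₀, hs₀, H⟩ := f.exists_piece_eq_strip hcor hc
  obtain ⟨s₁, hs₁, H₁⟩ := strip_of_far (p := u) (E₀ := (ω.width e / 2) • n)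
    (E₁ := -(ω.width e) • n) (L := L) (lA := lA) (lB := lB) (rA := rA) (rB := rB)
    f.lower.norm_d hr
  refine ⟨min s₀ s₁, by positivity, fun s x hs hss hx h1 h2 => ?_⟩
  rw [(H s hs (hss.trans_le (min_le_left _ _))).2.2.2.2.1] at hx
  obtain ⟨τ, t, h3, h4, h5, h6, rfl⟩ := H₁ s x hs (hss.trans_le (min_le_right _ _)) hx h1 h2
  -- The factor `1 - 2 * τ` runs from `1` to `-1` across the strip.
  refine ⟨t, s * (ω.width e / 2) * (1 - 2 * τ), h5, h6, ?_, by module⟩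
  rw [abs_mul, abs_of_pos (by positivity)]
  refine mul_le_of_le_one_right (by positivity) (abs_le.2 ⟨by linarith, by linarith⟩)

theorem foldedPiece_of_far {r : ℝ} (hr : 0 < r) : ∃ s₀ > 0, ∀ s q, 0 < s → s < s₀ →
    q ∈ intrinsicInterior ℝ (ω.foldedPiece h c s (Sum.inr e)) →
    r ≤ ‖q - (g u, 0)‖ → r ≤ ‖q - (g (u + L • d), 0)‖ →
    ∃ t k : ℝ, r / 2 ≤ t ∧ t ≤ L - r / 2 ∧ h A < k ∧ k < h B ∧
      q = (g (u + t • d + (s * (ω.width e / 2)) • n), s * k) := by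
  have hw := f.width_pos
  have hwe := f.width_eq
  obtain ⟨lA, lB, rA, rB, -, -, -, -, s₀, hs₀, H⟩ := f.exists_piece_eq_strip hcor hc
  obtain ⟨s₁, hs₁, H₁⟩ := strip_of_far (p := ((g u, 0) : Space))
    (E₀ := ((ω.width e / 2) • g.linearIsometryEquiv n, h A))
    (E₁ := (0, ω.width e)) (L := L) (lA := lA) (lB := lB) (rA := rA) (rB := rB)
    f.norm_folded_direction hr
  refine ⟨min s₀ s₁, by positivity, fun s x hs hss hx h1 h2 => ?_⟩
  obtain ⟨hA, hB, -, -, -, heq⟩ := H s hs (hss.trans_le (min_le_left _ _))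
  have hsnd : s * h A < x.2 ∧ x.2 < s * h B := by
    refine snd_between_of_mem_intrinsicInterior (mul_lt_mul_of_pos_left f.lt hs) ?_ ?_ ?_ hx
    · intro y hy
      rw [heq] at hy
      obtain ⟨τ, t, h3, h4, -, -, rfl⟩ := hy
      rw [folded_strip_point]
      have e1 : 0 ≤ τ * ω.width e := by positivity
      have e2 : τ * ω.width e ≤ 1 * ω.width e := by gcongr
      exact ⟨mul_le_mul_of_nonneg_left (by linarith) hs.le,
        mul_le_mul_of_nonneg_left (by linarith) hs.le⟩
    · rw [heq]
      refine ⟨_, ⟨0, s * lA, le_rfl, zero_le_one, by simp, by simpa using hA.le, rfl⟩, ?_⟩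
      rw [folded_strip_point]; simp
    · rw [heq]
      refine ⟨_, ⟨1, s * lB, zero_le_one, le_rfl, by simp, by simpa using hB.le, rfl⟩, ?_⟩
      rw [folded_strip_point]
      change s * _ = _
      rw [hwe]; ring
  have hx' := intrinsicInterior_subset hx
  rw [heq] at hx'
  obtain ⟨τ, t, h3, h4, h5, h6, rfl⟩ := H₁ s x hs (hss.trans_le (min_le_right _ _)) hx' h1 (by
    refine h2.trans_eq ?_
    rw [g.map_add_smul]
    simp)
  rw [folded_strip_point] at hsnd ⊢
  exact ⟨t, _, h5, h6, lt_of_mul_lt_mul_left hsnd.1 hs.le, lt_of_mul_lt_mul_left hsnd.2 hs.le, rfl⟩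

theorem newCrease_nontrivial : ∃ s₀ > 0, ∀ s, 0 < s → s < s₀ → ∀ F : S.pattern.Face,
    F.BoundedBy e.carrier → (ω.newCrease c s e F).Nontrivial := by
  obtain ⟨lA, lB, rA, rB, -, -, -, -, s₀, hs₀, H⟩ := f.exists_piece_eq_strip hcor hc
  have key : ∀ (N : Plane) (a b : ℝ), a < b → u + a • d + N ≠ u + b • d + N := by
    intro N a b hab he
    rw [add_left_inj, add_right_inj] at he
    have hd : d ≠ 0 := norm_ne_zero_iff.1 (by rw [f.lower.norm_d]; exact one_ne_zero)
    exact hab.ne (smul_left_injective ℝ hd he)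
  refine ⟨s₀, hs₀, fun s hs hss F hF => ?_⟩
  obtain ⟨hA, hB, mA, mB, -⟩ := H s hs hss
  rcases f.eq_or_eq F hF with rfl | rfl
  · exact ⟨_, (mA _).2 ⟨le_rfl, hA.le⟩, _, (mA _).2 ⟨hA.le, le_rfl⟩, key _ _ _ hA⟩
  · exact ⟨_, (mB _).2 ⟨le_rfl, hB.le⟩, _, (mB _).2 ⟨hB.le, le_rfl⟩, key _ _ _ hB⟩

end CreaseFrame

section Scale
variable (hcor : S.pattern.NoStraightCorner) (hh : ω.IsHeight h) {c : S.Trimming}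
  (hc : IsBoundedTrimming ω c)
include hcor hh hc

theorem exists_scale_flat
    (hloc : ∀ v ∈ S.pattern.vertices, ∀ i j : S.Piece, i ≠ j →
      ¬ StrictlyIntersect (localPicture v fun s => ω.flatPiece c s i)
        (localPicture v fun s => ω.flatPiece c s j)) :
    ∃ s₀ > 0, ∀ s, 0 < s → s < s₀ → ∀ i j : S.Piece, i ≠ j →
      ¬ StrictlyIntersect (ω.flatPiece c s i) (ω.flatPiece c s j) := by
  obtain ⟨Φ⟩ := exists_creaseFrames hh
  have := finite_piece (S := S)
  refine exists_scale_of_localPicture (Q := fun i s => ω.flatPiece c s i)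
    S.pattern.vertices.finite_toSet (fun i s δ δ' => Φ.outFlat_mono i s δ δ') Φ.disjoint_outFlat ?_ ?_ ?_ hloc
  · rintro (C | e)
    · exact ⟨1, one_pos, fun s hs _ => convex_reducedFace ω c C hs⟩
    · exact ⟨1, one_pos, fun s hs _ => convex_convexHull ℝ _⟩
  · rintro z - (C | e)
    · exact conicAt_reducedFace ω c C z
    · exact (Φ.frame e).conicAt_flatPiece hcor hc z
  · rintro (C | e) r hr
    · obtain ⟨s₀, hs₀, H⟩ := intrinsicInterior_reducedFace_subset (C := C) hc
      -- The set assigned to a face does not involve `δ`, so `1` is a filler.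
      exact ⟨1, one_pos, s₀, hs₀, fun s x hs hss hx _ => H s hs hss hx⟩
    · obtain ⟨s₀, hs₀, H⟩ := (Φ.frame e).flatPiece_of_far hcor hc hr
      exact ⟨r / 2, by positivity, s₀, hs₀, fun s x hs hss hx hfar =>
        H s x hs hss (intrinsicInterior_subset hx) (hfar _ (Φ.frame e).lower.start_vertex)
          (hfar _ (Φ.frame e).lower.end_vertex)⟩

theorem exists_scale_folded (hwrap : S.NonWrapping)
    (hloc : ∀ v ∈ S.pattern.vertices, ∀ i j : S.Piece, i ≠ j →
      ¬ StrictlyIntersect (localPicture ((S.fold v, 0) : Space) fun s => ω.foldedPiece h c s i)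
        (localPicture ((S.fold v, 0) : Space) fun s => ω.foldedPiece h c s j)) :
    ∃ s₀ > 0, ∀ s, 0 < s → s < s₀ → ∀ i j : S.Piece, i ≠ j →
      ¬ StrictlyIntersect (ω.foldedPiece h c s i) (ω.foldedPiece h c s j) := by
  obtain ⟨Φ⟩ := exists_creaseFrames hh
  have := finite_piece (S := S)
  refine exists_scale_of_localPicture (Q := fun i s => ω.foldedPiece h c s i)
    (S.pattern.vertices.finite_toSet.image fun v => ((S.fold v, 0) : Space))
    (fun i s δ δ' => Φ.outFolded_mono i s δ δ') (Φ.disjoint_outFolded hwrap hcor hh) ?_ ?_ ?_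
    (by rintro _ ⟨v, hv, rfl⟩; exact hloc v hv)
  · rintro (C | e)
    · exact ⟨1, one_pos, fun s hs _ => convex_foldedPiece_face hs⟩
    · exact ⟨1, one_pos, fun s hs _ => convex_convexHull ℝ _⟩
  · rintro _ ⟨v, -, rfl⟩ (C | e)
    · exact conicAt_foldedPiece_face _
    · exact (Φ.frame e).conicAt_foldedPiece hcor hc _
  · rintro (C | e) r hr
    · obtain ⟨s₀, hs₀, H⟩ := intrinsicInterior_foldedPiece_face_subset (C := C) (h := h) hc
      exact ⟨1, one_pos, s₀, hs₀, fun s x hs hss hx _ => H s hs hss x hx⟩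
    · have f := Φ.frame e
      obtain ⟨s₀, hs₀, H⟩ := f.foldedPiece_of_far hcor hc hr
      have e0 := f.fold_crease le_rfl f.lower.posL.le
      rw [zero_smul, add_zero] at e0
      refine ⟨r / 2, by positivity, s₀, hs₀, fun s x hs hss hx hfar => H s x hs hss hx ?_ ?_⟩
      · exact hfar _ ⟨_, f.lower.start_vertex, by
          change ((_, _) : Space) = _
          rw [e0]⟩
      · exact hfar _ ⟨_, f.lower.end_vertex, by
          change ((_, _) : Space) = _
          rw [f.fold_crease f.lower.posL.le le_rfl]⟩

end Scale
end FlatFoldedState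


/-! ### Local pictures of faces and strips. -/

section LocalPicture
variable {V : Type*} [NormedAddCommGroup V] [NormedSpace ℝ V]

theorem localPicture_congr {z : V} {Q R : ℝ → Set V} {r : ℝ} (hr : 0 < r)
    (h : ∀ s, 0 < s → s < r → Q s = R s) : localPicture z Q = localPicture z R :=
  (localPicture_mono hr fun s h0 h1 => (h s h0 h1).subset).antisymm
    (localPicture_mono hr fun s h0 h1 => (h s h0 h1).superset)

theorem ConicWithin.mem_interior {r s : ℝ} {z y : V} {Q : ℝ → Set V} (h : ConicWithin r z Q)
    (hs : 0 < s) (hsr : s < r) (hy : ‖s • y‖ < r) (hyi : y ∈ interior (localPicture z Q)) :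
    z + s • y ∈ interior (Q s) := by
  have hx : ∀ x, s • s⁻¹ • (x - z) = x - z := fun x => by
    rw [smul_smul, mul_inv_cancel₀ hs.ne', one_smul]
  refine _root_.mem_interior.2 ⟨(fun x => s⁻¹ • (x - z)) ⁻¹' interior (localPicture z Q) ∩
    {x | ‖x - z‖ < r}, ?_, ?_, ?_, ?_⟩
  · rintro x ⟨h1, h2⟩
    have h2 : ‖x - z‖ < r := h2
    have := (h.mem_localPicture_iff hs hsr (by rwa [hx])).1 (interior_subset h1)
    rwa [hx, add_sub_cancel] at this
  · exact (isOpen_interior.preimage (by fun_prop)).inter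
      (isOpen_lt (by fun_prop) continuous_const)
  · rw [mem_preimage, add_sub_cancel_left, smul_smul, inv_mul_cancel₀ hs.ne', one_smul]
    exact hyi
  · change ‖z + s • y - z‖ < r
    rwa [add_sub_cancel_left]

/-- The points `z + s • y` tend to `z`, so a closed set containing the whole family contains `z`. -/
theorem mem_of_localPicture_nonempty {z : V} {Q : ℝ → Set V} {K : Set V} (hK : IsClosed K)
    (hQ : ∀ s, Q s ⊆ K) (h : (localPicture z Q).Nonempty) : z ∈ K := by
  obtain ⟨y, hy⟩ := h
  have hy : ∀ᶠ s : ℝ in 𝓝[>] 0, z + s • y ∈ Q s := hy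
  have hlim : Tendsto (fun s : ℝ => z + s • y) (𝓝[>] 0) (𝓝 z) := by
    have : Continuous fun s : ℝ => z + s • y := by fun_prop
    simpa using (this.tendsto 0).mono_left nhdsWithin_le_nhds
  exact hK.mem_of_tendsto hlim (hy.mono fun s hs => hQ s hs)

/-- The local picture of a strip at a point of its axis. -/
theorem mem_localPicture_strip_iff {p D E₀ E₁ y : V} {L lA lB rA rB : ℝ} (hD : ‖D‖ = 1) {t₀ : ℝ}
    (h0 : 0 ≤ t₀) (h1 : t₀ ≤ L) :
    y ∈ localPicture (p + t₀ • D) (fun s => strip p D E₀ E₁ L lA lB rA rB s) ↔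
      ∃ τ t : ℝ, 0 ≤ τ ∧ τ ≤ 1 ∧ (t₀ = 0 → (1 - τ) * lA + τ * lB ≤ t) ∧
        (t₀ = L → t ≤ -((1 - τ) * rA + τ * rB)) ∧ y = t • D + (E₀ + τ • E₁) := by
  obtain ⟨r, hr, H⟩ := exists_mem_strip_iff (p := p) (E₀ := E₀) (E₁ := E₁) (lA := lA) (lB := lB)
    (rA := rA) (rB := rB) hD h0 h1
  have := eventually_congr ((eventually_small y hr).mono fun s hs => H s y hs.1 hs.2.1 hs.2.2)
  exact this.trans eventually_const

theorem exists_eq_of_localPicture_strip_nonempty {p D E₀ E₁ z : V} {L lA lB rA rB : ℝ}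
    (hL : 0 < L) (hD : ‖D‖ = 1)
    (h : (localPicture z fun s => strip p D E₀ E₁ L lA lB rA rB s).Nonempty) :
    ∃ t, 0 ≤ t ∧ t ≤ L ∧ z = p + t • D := by
  by_contra hz
  push Not at hz
  obtain ⟨r, hr, H⟩ := strip_notMem_of_far (E₀ := E₀) (E₁ := E₁) (lA := lA) (lB := lB)
    (rA := rA) (rB := rB) hL hD hz
  obtain ⟨y, hy⟩ := h
  obtain ⟨s, h1, h2, h3, h4⟩ := exists_small_of_mem_localPicture hy hr
  exact H s _ h1 h2 (by rwa [add_sub_cancel_left]) h4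

end LocalPicture

/-- Points of a trimmed strip, brought to distance `ρ` from the end, keep away from both ends. -/
theorem exists_trimmed_param {L w t₀ : ℝ} (hL : 0 < L) (hw : 0 < w) (h0 : 0 ≤ t₀) (h1 : t₀ ≤ L) :
    ∃ ρ₀ > 0, ∃ ε₀ > 0, ∀ ρ ε t μ : ℝ, 0 < ρ → ρ ≤ ρ₀ → 0 < ε → ε ≤ ε₀ → |t| ≤ μ →
      μ ≤ |t| + w / 2 → (t₀ = 0 → 1 / ε - w / 2 ≤ t) → (t₀ = L → t ≤ -(1 / ε - w / 2)) →
      ρ / 2 ≤ t₀ + ρ / max μ (1 / ε) * t ∧ t₀ + ρ / max μ (1 / ε) * t ≤ L - ρ / 2 := by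
  -- Rescaling sends `|t|` to at most `ρ`. For `ε ≤ 1 / (2 * w)` the divisor `M` is at least `2 *
  -- w`; if `|t|` is at least `1 / ε - w / 2`, then `|t| ≥ M - w / 2`, which is more than `M / 2`,
  -- so the image is at least `ρ / 2`.
  have key : ∀ ρ ε t μ : ℝ, 0 < ρ → 0 < ε → ε ≤ 1 / (2 * w) → |t| ≤ μ → μ ≤ |t| + w / 2 →
      |ρ / max μ (1 / ε) * t| ≤ ρ ∧ (1 / ε - w / 2 ≤ |t| → ρ / 2 ≤ ρ / max μ (1 / ε) * |t|) := by
    intro ρ ε t μ hρ hε hε0 h2 h3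
    have hM : 0 < max μ (1 / ε) := lt_max_of_lt_right (by positivity)
    have hMt : |t| ≤ max μ (1 / ε) := h2.trans (le_max_left _ _)
    constructor
    · rw [abs_mul, abs_of_pos (by positivity), div_mul_eq_mul_div, div_le_iff₀ hM]
      exact mul_le_mul_of_nonneg_left hMt hρ.le
    · intro h4
      have hw2 : 2 * w ≤ max μ (1 / ε) := by
        refine le_trans ?_ (le_max_right _ _)
        rw [le_div_iff₀ (by positivity)] at hε0 ⊢
        linarith
      have hle : max μ (1 / ε) ≤ |t| + w / 2 := max_le h3 (by linarith)
      rw [div_mul_eq_mul_div, le_div_iff₀ hM]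
      nlinarith
  rcases h0.eq_or_lt with rfl | h0
  · refine ⟨L / 2, by positivity, 1 / (2 * w), by positivity,
      fun ρ ε t μ hρ hρ0 hε hε0 h2 h3 h4 _ => ?_⟩
    obtain ⟨k1, k2⟩ := key ρ ε t μ hρ hε hε0 h2 h3
    have h4 := h4 rfl
    have ht : 0 ≤ t := by
      rw [le_div_iff₀ (by positivity)] at hε0
      have : 2 * w ≤ 1 / ε := by rw [le_div_iff₀ hε]; linarith
      linarith
    rw [abs_of_nonneg ht] at k2
    have := k2 h4
    have := (abs_le.1 k1).2
    constructor <;> linarith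
  rcases h1.eq_or_lt with rfl | h1
  · refine ⟨t₀ / 2, by positivity, 1 / (2 * w), by positivity,
      fun ρ ε t μ hρ hρ0 hε hε0 h2 h3 _ h4 => ?_⟩
    obtain ⟨k1, k2⟩ := key ρ ε t μ hρ hε hε0 h2 h3
    have h4 := h4 rfl
    have ht : t ≤ 0 := by
      rw [le_div_iff₀ (by positivity)] at hε0
      have : 2 * w ≤ 1 / ε := by rw [le_div_iff₀ hε]; linarith
      linarith
    rw [abs_of_nonpos ht] at k2
    have := k2 (by linarith)
    have := (abs_le.1 k1).1
    constructor <;> linarith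
  · have h1' : 0 < L - t₀ := by linarith
    refine ⟨min t₀ (L - t₀) / 2, by positivity, 1 / (2 * w), by positivity,
      fun ρ ε t μ hρ hρ0 hε hε0 h2 h3 _ _ => ?_⟩
    have k1 := abs_le.1 (key ρ ε t μ hρ hε hε0 h2 h3).1
    have := min_le_left t₀ (L - t₀)
    have := min_le_right t₀ (L - t₀)
    constructor <;> linarith [k1.1, k1.2]

/-! ### Trimming the sectors far out. -/

namespace FlatFoldedState
variable {S : FlatFoldedState} {ω : S.WeightAssignment} {h : S.pattern.Face → ℝ}

/-- Near the creases, the trimmed sectors keep a distance from the vertex. -/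
def IsFarTrimming (ω : S.WeightAssignment) (R : ℝ) (c : S.Trimming) : Prop :=
  ∀ (F : S.pattern.Face), ∀ v ∈ S.pattern.vertices, ∀ e : S.pattern.Crease, v ∈ e.carrier →
    F.BoundedBy e.carrier → ∀ y ∈ ω.trimmedSector c F v, R ≤ ‖y‖

section Trimming
variable (hcor : S.pattern.NoStraightCorner)
include hcor

/-- The sector lies in a cone `0 ≤ b`, `-(m * b) ≤ a` of angle less than `π`, so some linear
functional dominates the norm on it. A superlevel set of this functional removes only a bounded part
of the sector, and by Cauchy-Schwarz it stays away from the origin. -/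
theorem exists_sector_trimming (ω : S.WeightAssignment) (R : ℝ) (F : S.pattern.Face) {v : Plane}
    (hv : v ∈ S.pattern.vertices) {e : S.pattern.Crease} (hve : v ∈ e.carrier)
    (he : F.BoundedBy e.carrier) :
    ∃ p : Plane × ℝ, Bornology.IsBounded {y ∈ ω.sector F v | ¬ p.2 ≤ inner ℝ p.1 y} ∧
      ∀ y : Plane, p.2 ≤ inner ℝ p.1 y → R ≤ ‖y‖ := by
  obtain ⟨d, n, L, f⟩ : ∃ d n L, S.pattern.EdgeFrame e.carrier F.carrier v d n L := by
    obtain ⟨u, d, n, L, f⟩ := exists_edgeFrame he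
    rcases f.eq_end_of_mem_vertices hve hv with rfl | rfl
    · exact ⟨_, _, _, f⟩
    · exact ⟨_, _, _, f.reverse⟩
  obtain ⟨m, hm, H⟩ := CreasePattern.exists_cone_bound S.convex hcor f he
  have hin : ∀ a b : ℝ, inner ℝ (d + (2 * m + 1) • n) (a • d + b • n) = a + (2 * m + 1) * b := by
    intro a b
    rw [inner_add_left, inner_smul_left, f.inner_d, f.inner_n]
    simp
  have hp : 0 < ‖d + (2 * m + 1) • n‖ := by
    rw [norm_pos_iff]
    intro h0
    have := f.inner_d 1 (2 * m + 1)
    rw [one_smul, h0, inner_zero_right] at this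
    linarith
  -- The coefficient `2 * m + 1` gives `|a| + b ≤ a + (2 * m + 1) * b` on the cone, also for
  -- negative `a`.
  refine ⟨(d + (2 * m + 1) • n, ‖d + (2 * m + 1) • n‖ * R), ?_, fun y hy => ?_⟩
  · refine (Metric.isBounded_closedBall (x := (0 : Plane))
      (r := ‖d + (2 * m + 1) • n‖ * R)).subset ?_
    rintro y ⟨⟨⟨t, ht, hyt⟩, -⟩, hlt⟩
    obtain ⟨a, b, rfl⟩ := f.exists_coord 0 y
    rw [zero_add] at hyt hlt ⊢
    obtain ⟨hb, hab⟩ := H a b t ht hyt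
    rw [not_le, hin] at hlt
    rw [mem_closedBall_zero_iff]
    refine (f.norm_le a b).trans ?_
    rw [abs_of_nonneg hb]
    have hmb := mul_nonneg hm hb
    rcases abs_cases a with ⟨h1, -⟩ | ⟨h1, -⟩ <;> rw [h1] <;> linarith
  · exact le_of_mul_le_mul_left (hy.trans (real_inner_le_norm _ _)) hp

theorem exists_farTrimming (ω : S.WeightAssignment) (R : ℝ) :
    ∃ c : S.Trimming, IsBoundedTrimming ω c ∧ IsFarTrimming ω R c := by
  have key : ∀ (F : S.pattern.Face) (v : Plane), ∃ T : Finset (Plane × ℝ), v ∈ S.pattern.vertices →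
      Bornology.IsBounded {y ∈ ω.sector F v | ¬ ∀ p ∈ T, p.2 ≤ inner ℝ p.1 y} ∧
      ∀ e : S.pattern.Crease, v ∈ e.carrier → F.BoundedBy e.carrier →
        ∀ y : Plane, (∀ p ∈ T, p.2 ≤ inner ℝ p.1 y) → R ≤ ‖y‖ := by
    intro F v
    by_cases hex : ∃ e : S.pattern.Crease, v ∈ e.carrier ∧ F.BoundedBy e.carrier
    · by_cases hv : v ∈ S.pattern.vertices
      · obtain ⟨e, hve, he⟩ := hex
        obtain ⟨p, h1, h2⟩ := exists_sector_trimming hcor ω R F hv hve he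
        exact ⟨{p}, fun _ => ⟨by simpa using h1, fun _ _ _ y hy => h2 y (hy p (by simp))⟩⟩
      · exact ⟨∅, fun hv' => (hv hv').elim⟩
    · exact ⟨∅, fun _ => ⟨by simp, fun e h1 h2 => (hex ⟨e, h1, h2⟩).elim⟩⟩
  choose c hc using key
  refine ⟨c, fun F v hv _ => (hc F v hv).1.subset ?_, fun F v hv e hve he y hy =>
    (hc F v hv).2 e hve he y hy.2⟩
  rintro y ⟨h1, h2⟩
  exact ⟨h1, fun h3 => h2 ⟨h1, h3⟩⟩

/-- The end of the new crease has norm at least `1 / ε` and at most `|l| + w / 2`, so `|l|` is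
large; the cone bound keeps `l` above a fixed negative number, so for small `ε` the sign is
positive. -/
theorem exists_offset_ge {e : S.pattern.Crease} {F : S.pattern.Face} {u d n : Plane} {L w : ℝ}
    (f : S.pattern.EdgeFrame e.carrier F.carrier u d n L) (he : F.BoundedBy e.carrier)
    (hw : 0 < w) : ∃ ε₀ > 0, ∀ ε, 0 < ε → ε ≤ ε₀ → ∀ c : S.Trimming,
      IsFarTrimming ω (1 / ε) c → ∀ l : ℝ, l • d + (w / 2) • n ∈ ω.trimmedSector c F u →
        1 / ε - w / 2 ≤ l := by
  obtain ⟨m, hm, H⟩ := CreasePattern.exists_cone_bound S.convex hcor f he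
  refine ⟨1 / (w / 2 + m * (w / 2) + 1), by positivity, fun ε hε hε0 c hc l hl => ?_⟩
  rw [le_div_iff₀ (by positivity)] at hε0
  have h1 : w / 2 + m * (w / 2) + 1 ≤ 1 / ε := by rw [le_div_iff₀ hε]; linarith
  have h2 := (hc F u f.start_vertex e f.start_mem he _ hl).trans (f.norm_le _ _)
  rw [abs_of_pos (by positivity : 0 < w / 2)] at h2
  obtain ⟨⟨⟨t, ht, hlt⟩, -⟩, -⟩ := hl
  have h3 := (H _ _ t ht hlt).2
  rcases abs_cases l with ⟨h4, -⟩ | ⟨h4, -⟩ <;> rw [h4] at h2 <;> linarith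

end Trimming
end FlatFoldedState


/-! ### Existence of a refinement. -/

namespace FlatFoldedState
variable {S : FlatFoldedState} {ω : S.WeightAssignment} {h : S.pattern.Face → ℝ}

/-- For faces no distance from the vertex is needed: their separated part is the whole interior of
the untrimmed face, and the chosen scale only has to bring the point into the range of conicity. -/
theorem exists_face_scale (ω : S.WeightAssignment) (C : S.pattern.Face) (z : Plane) :
    ∃ ρ₀ > 0, ∀ ρ ε : ℝ, 0 < ρ → ρ ≤ ρ₀ → 0 < ε → ε ≤ 1 → ∀ (c : S.Trimming) (y : Plane),
      y ∈ interior (localPicture z fun s => ω.reducedFace c s C) →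
      z + (ρ / max ‖y‖ (1 / ε)) • y ∈ interior (untrimmedFace ω (ρ / max ‖y‖ (1 / ε)) C) := by
  obtain ⟨r, hr, H⟩ := conicAt_untrimmedFace ω C z
  refine ⟨r / 2, by positivity, fun ρ ε hρ hρ0 hε hε0 c y hy => ?_⟩
  have hM1 : 1 ≤ max ‖y‖ (1 / ε) := (by rwa [le_div_iff₀ hε, one_mul] : 1 ≤ 1 / ε).trans
    (le_max_right _ _)
  have hM : 0 < max ‖y‖ (1 / ε) := by linarith
  refine H.mem_interior (by positivity) ?_ ?_ (interior_mono (localPicture_mono one_pos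
    fun s hs _ => reducedFace_subset_untrimmedFace ω c C hs) hy)
  · have := div_le_self hρ.le hM1
    linarith
  · rw [norm_smul, Real.norm_of_nonneg (by positivity), div_mul_eq_mul_div, div_lt_iff₀ hM]
    have : ρ * ‖y‖ ≤ ρ * max ‖y‖ (1 / ε) := by gcongr; exact le_max_left _ _
    nlinarith

theorem mem_closure_of_localPicture_nonempty {c : S.Trimming} {C : S.pattern.Face} {z : Plane}
    (hy : (localPicture z fun s => ω.reducedFace c s C).Nonempty) : z ∈ closure C.carrier :=
  mem_of_localPicture_nonempty isClosed_closure (fun _ _ hx => hx.1) hy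

theorem localPicture_foldedPiece_face {c : S.Trimming} {C : S.pattern.Face}
    {g : Plane ≃ᵃⁱ[ℝ] Plane} (hg : ∀ x ∈ closure C.carrier, S.fold x = g x) (z : Plane) :
    localPicture ((z, 0) : Space) (fun s => ω.foldedPiece h c s (Sum.inl C)) =
      (g.symm.linearIsometryEquiv ⁻¹'
        localPicture (g.symm z) fun s => ω.reducedFace c s C) ×ˢ {h C} := by
  ext y
  have h1 := eventually_congr ((eventually_small y one_pos).mono fun s hs =>
    add_smul_mem_foldedPiece_iff (ω := ω) (h := h) (c := c) hg hs.1 z y)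
  refine h1.trans ?_
  rw [eventually_and, eventually_const, and_comm]
  exact Iff.rfl

theorem exists_folded_face_scale (C : S.pattern.Face) (z : Plane) :
    ∃ ρ₀ > 0, ∀ ρ ε : ℝ, 0 < ρ → ρ ≤ ρ₀ → 0 < ε → ε ≤ 1 → ∀ c : S.Trimming, IsBoundedTrimming ω c →
      ∀ y ∈ intrinsicInterior ℝ
        (localPicture ((z, 0) : Space) fun s => ω.foldedPiece h c s (Sum.inl C)),
      ∃ x ∈ interior (untrimmedFace ω (ρ / max ‖y.1‖ (1 / ε)) C),
        ((z, 0) : Space) + (ρ / max ‖y.1‖ (1 / ε)) • y =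
          (S.fold x, (ρ / max ‖y.1‖ (1 / ε)) * h C) := by
  obtain ⟨g, hg⟩ := exists_isometry C
  obtain ⟨ρ₀, hρ₀, H⟩ := exists_face_scale ω C (g.symm z)
  refine ⟨ρ₀, hρ₀, fun ρ ε hρ hρ0 hε hε0 c hc y hy => ?_⟩
  rw [localPicture_foldedPiece_face hg] at hy
  have him : interior (g.symm.linearIsometryEquiv ⁻¹'
      localPicture (g.symm z) fun s => ω.reducedFace c s C) = g.symm.linearIsometryEquiv ⁻¹'
        interior (localPicture (g.symm z) fun s => ω.reducedFace c s C) :=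
    (g.symm.linearIsometryEquiv.toHomeomorph.preimage_interior _).symm
  have hz := mem_closure_of_localPicture_nonempty ⟨_, (intrinsicInterior_subset hy).1⟩
  obtain ⟨h1, h2⟩ := mem_interior_of_mem_intrinsicInterior_slice (by
    rw [him]
    exact (nonempty_interior_localPicture_reducedFace hc hz).preimage
      g.symm.linearIsometryEquiv.surjective) hy
  rw [him] at h1
  have h3 := H ρ ε hρ hρ0 hε hε0 c _ h1
  rw [LinearIsometryEquiv.norm_map] at h3
  refine ⟨_, h3, ?_⟩
  rw [hg _ (interior_subset h3).1, ← g.symm.map_add_smul, g.apply_symm_apply]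
  ext1
  · rfl
  · simp [h2]

namespace CreaseFrame
variable {e : S.pattern.Crease} {A B : S.pattern.Face} {u d n : Plane} {L : ℝ}
  {g : Plane ≃ᵃⁱ[ℝ] Plane} (f : CreaseFrame ω h e A B u d n L g)
  (hcor : S.pattern.NoStraightCorner)
include f hcor

/-- All four ends of the new creases are displaced by at least `1 / ε - w / 2`, hence so are the
intermediate ends of the strip. The measure `μ` of a strip point may exceed `|t|` by half the width,
which `exists_trimmed_param` absorbs. -/
theorem exists_trimmed_strip {t₀ : ℝ} (h0 : 0 ≤ t₀) (h1 : t₀ ≤ L) :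
    ∃ ρ₀ > 0, ∃ ε₀ > 0, ∀ ρ ε : ℝ, 0 < ρ → ρ ≤ ρ₀ → 0 < ε → ε ≤ ε₀ →
      ∀ c : S.Trimming, IsFarTrimming ω (1 / ε) c → ∀ lA lB rA rB : ℝ,
      lA • d + (ω.width e / 2) • n ∈ ω.trimmedSector c A u →
      lB • d + (ω.width e / 2) • (-n) ∈ ω.trimmedSector c B u →
      rA • (-d) + (ω.width e / 2) • n ∈ ω.trimmedSector c A (u + L • d) →
      rB • (-d) + (ω.width e / 2) • (-n) ∈ ω.trimmedSector c B (u + L • d) →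
      ∀ τ t μ : ℝ, 0 ≤ τ → τ ≤ 1 → (t₀ = 0 → (1 - τ) * lA + τ * lB ≤ t) →
      (t₀ = L → t ≤ -((1 - τ) * rA + τ * rB)) → |t| ≤ μ → μ ≤ |t| + ω.width e / 2 →
      ρ / 2 ≤ t₀ + ρ / max μ (1 / ε) * t ∧ t₀ + ρ / max μ (1 / ε) * t ≤ L - ρ / 2 := by
  have hw := f.width_pos
  obtain ⟨ρ₀, hρ₀, ε₀, hε₀, H⟩ := exists_trimmed_param f.lower.posL hw h0 h1
  obtain ⟨ε₁, hε₁, H₁⟩ := exists_offset_ge (ω := ω) hcor f.lower f.boundedBy_lower hw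
  obtain ⟨ε₂, hε₂, H₂⟩ := exists_offset_ge (ω := ω) hcor f.upper f.boundedBy_upper hw
  obtain ⟨ε₃, hε₃, H₃⟩ := exists_offset_ge (ω := ω) hcor f.lower.reverse f.boundedBy_lower hw
  obtain ⟨ε₄, hε₄, H₄⟩ := exists_offset_ge (ω := ω) hcor f.upper.reverse f.boundedBy_upper hw
  refine ⟨ρ₀, hρ₀, min ε₀ (min (min ε₁ ε₂) (min ε₃ ε₄)), by positivity, ?_⟩
  intro ρ ε hρ hρ0 hε hε0 c hc lA lB rA rB hlA hlB hrA hrB τ t μ hτ0 hτ1 hl hr hμ hμ'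
  obtain ⟨i0, i⟩ := le_min_iff.1 hε0
  obtain ⟨i12, i34⟩ := le_min_iff.1 i
  obtain ⟨i1, i2⟩ := le_min_iff.1 i12
  obtain ⟨i3, i4⟩ := le_min_iff.1 i34
  have a1 := H₁ ε hε i1 c hc lA hlA
  have a2 := H₂ ε hε i2 c hc lB hlB
  have a3 := H₃ ε hε i3 c hc rA hrA
  have a4 := H₄ ε hε i4 c hc rB hrB
  have combo : ∀ a b : ℝ, 1 / ε - ω.width e / 2 ≤ a → 1 / ε - ω.width e / 2 ≤ b →
      1 / ε - ω.width e / 2 ≤ (1 - τ) * a + τ * b := by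
    intro a b ha hb
    nlinarith
  refine H ρ ε t μ hρ hρ0 hε i0 hμ hμ' (fun h => (combo _ _ a1 a2).trans (hl h)) fun h => ?_
  have := combo _ _ a3 a4
  have := hr h
  linarith

theorem exists_flat_scale (z : Plane) : ∃ ρ₀ > 0, ∃ ε₀ > 0, ∀ ρ ε : ℝ, 0 < ρ → ρ ≤ ρ₀ →
    0 < ε → ε ≤ ε₀ → ∀ c : S.Trimming, IsBoundedTrimming ω c → IsFarTrimming ω (1 / ε) c →
    ∀ y ∈ localPicture z fun s => ω.flatPiece c s (Sum.inr e),
      ∃ t k : ℝ, ρ / 2 ≤ t ∧ t ≤ L - ρ / 2 ∧ |k| ≤ ρ / max ‖y‖ (1 / ε) * (ω.width e / 2) ∧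
        z + (ρ / max ‖y‖ (1 / ε)) • y = u + t • d + k • n := by
  have hw := f.width_pos
  by_cases hz : ∃ t, 0 ≤ t ∧ t ≤ L ∧ z = u + t • d
  · obtain ⟨t₀, h0, h1, rfl⟩ := hz
    obtain ⟨ρ₀, hρ₀, ε₀, hε₀, H⟩ := f.exists_trimmed_strip hcor h0 h1
    refine ⟨ρ₀, hρ₀, ε₀, hε₀, fun ρ ε hρ hρ0 hε hε0 c hc hfar y hy => ?_⟩
    obtain ⟨lA, lB, rA, rB, hlA, hlB, hrA, hrB, s₀, hs₀, K⟩ := f.exists_piece_eq_strip hcor hc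
    rw [localPicture_congr hs₀ fun s h0 h1 => (K s h0 h1).2.2.2.2.1,
      mem_localPicture_strip_iff f.lower.norm_d h0 h1] at hy
    obtain ⟨τ, t, hτ0, hτ1, hl, hr, rfl⟩ := hy
    have hy : t • d + ((ω.width e / 2) • n + τ • -ω.width e • n) =
        t • d + (ω.width e / 2 * (1 - 2 * τ)) • n := by module
    have hk : |ω.width e / 2 * (1 - 2 * τ)| ≤ ω.width e / 2 := by
      rw [abs_mul, abs_of_pos (by positivity)]
      exact mul_le_of_le_one_right (by positivity) (abs_le.2 ⟨by linarith, by linarith⟩)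
    rw [hy]
    obtain ⟨b1, b2⟩ := H ρ ε hρ hρ0 hε hε0 c hfar lA lB rA rB hlA hlB hrA hrB τ t _ hτ0 hτ1 hl hr
      (f.lower.abs_le_norm _ _) ((f.lower.norm_le t (ω.width e / 2 * (1 - 2 * τ))).trans
        (by linarith))
    refine ⟨_, ρ / max ‖t • d + (ω.width e / 2 * (1 - 2 * τ)) • n‖ (1 / ε) *
      (ω.width e / 2 * (1 - 2 * τ)), b1, b2, ?_, ?_⟩
    · have hM : 0 < max ‖t • d + (ω.width e / 2 * (1 - 2 * τ)) • n‖ (1 / ε) :=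
        lt_max_of_lt_right (by positivity)
      rw [abs_mul, abs_of_pos (by positivity)]
      gcongr
    · module
  -- Off the crease the local picture is empty and the constants are fillers.
  · refine ⟨1, one_pos, 1, one_pos, fun ρ ε _ _ _ _ c hc _ y hy => (hz ?_).elim⟩
    obtain ⟨lA, lB, rA, rB, -, -, -, -, s₀, hs₀, K⟩ := f.exists_piece_eq_strip hcor hc
    rw [localPicture_congr hs₀ fun s h0 h1 => (K s h0 h1).2.2.2.2.1] at hy
    exact exists_eq_of_localPicture_strip_nonempty f.lower.posL f.lower.norm_d ⟨y, hy⟩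

theorem exists_folded_scale (z : Plane) : ∃ ρ₀ > 0, ∃ ε₀ > 0, ∀ ρ ε : ℝ, 0 < ρ → ρ ≤ ρ₀ →
    0 < ε → ε ≤ ε₀ → ∀ c : S.Trimming, IsBoundedTrimming ω c → IsFarTrimming ω (1 / ε) c →
    ∀ y ∈ intrinsicInterior ℝ
      (localPicture ((z, 0) : Space) fun s => ω.foldedPiece h c s (Sum.inr e)),
      ∃ t k : ℝ, ρ / 2 ≤ t ∧ t ≤ L - ρ / 2 ∧ h A < k ∧ k < h B ∧
        ((z, 0) : Space) + (ρ / max ‖y.1‖ (1 / ε)) • y =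
          (g (u + t • d + (ρ / max ‖y.1‖ (1 / ε) * (ω.width e / 2)) • n),
            ρ / max ‖y.1‖ (1 / ε) * k) := by
  have hw := f.width_pos
  have hwe := f.width_eq
  have hL := f.lower.posL
  by_cases hz : ∃ t, 0 ≤ t ∧ t ≤ L ∧
    ((z, 0) : Space) = (g u, 0) + t • (g.linearIsometryEquiv d, 0)
  · obtain ⟨t₀, h0, h1, hz⟩ := hz
    obtain ⟨ρ₀, hρ₀, ε₀, hε₀, H⟩ := f.exists_trimmed_strip hcor h0 h1
    refine ⟨ρ₀, hρ₀, ε₀, hε₀, fun ρ ε hρ hρ0 hε hε0 c hc hfar y hy => ?_⟩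
    obtain ⟨lA, lB, rA, rB, hlA, hlB, hrA, hrB, s₀, hs₀, K⟩ := f.exists_piece_eq_strip hcor hc
    rw [localPicture_congr hs₀ fun s h0 h1 => (K s h0 h1).2.2.2.2.2, hz] at hy
    have hmem := fun y => mem_localPicture_strip_iff (y := y) (p := ((g u, 0) : Space))
      (E₀ := ((ω.width e / 2) • g.linearIsometryEquiv n, h A)) (E₁ := (0, ω.width e))
      (lA := lA) (lB := lB) (rA := rA) (rB := rB) f.norm_folded_direction h0 h1
    have hsnd : h A < y.2 ∧ y.2 < h B := by
      -- At most one end constraint is active since `0 < L`, so both extreme heights occur in the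
      -- local picture.
      have hex : ∀ l r : ℝ, ∃ t, (t₀ = 0 → l ≤ t) ∧ (t₀ = L → t ≤ -r) := by
        intro l r
        by_cases ht : t₀ = 0
        · exact ⟨l, fun _ => le_rfl, fun h => (hL.ne (ht.symm.trans h)).elim⟩
        · exact ⟨-r, fun h => (ht h).elim, fun _ => le_rfl⟩
      refine snd_between_of_mem_intrinsicInterior f.lt ?_ ?_ ?_ hy
      · intro x hx
        obtain ⟨τ, t, h3, h4, -, -, rfl⟩ := (hmem x).1 hx
        have e1 : 0 ≤ τ * ω.width e := by positivity
        have e2 : τ * ω.width e ≤ 1 * ω.width e := by gcongr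
        simp only [Prod.snd_add, Prod.smul_snd, smul_eq_mul, mul_zero, zero_add]
        constructor <;> linarith
      · obtain ⟨t, h3, h4⟩ := hex lA rA
        exact ⟨_, (hmem _).2 ⟨0, t, le_rfl, zero_le_one, by simpa using h3, by simpa using h4,
          rfl⟩, by simp⟩
      · obtain ⟨t, h3, h4⟩ := hex lB rB
        exact ⟨_, (hmem _).2 ⟨1, t, zero_le_one, le_rfl, by simpa using h3, by simpa using h4,
          rfl⟩, by simp [hwe]⟩
    obtain ⟨τ, t, hτ0, hτ1, hl, hr, rfl⟩ := (hmem y).1 (intrinsicInterior_subset hy)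
    have hfst : (t • ((g.linearIsometryEquiv d, 0) : Space) +
        (((ω.width e / 2) • g.linearIsometryEquiv n, h A) + τ • (0, ω.width e))).1 =
        g.linearIsometryEquiv (t • d + (ω.width e / 2) • n) := by
      simp
    have hsnd' : (t • ((g.linearIsometryEquiv d, 0) : Space) +
        (((ω.width e / 2) • g.linearIsometryEquiv n, h A) + τ • (0, ω.width e))).2 =
        h A + τ * ω.width e := by
      simp
    rw [hsnd'] at hsnd
    rw [hfst, LinearIsometryEquiv.norm_map, hz]
    obtain ⟨b1, b2⟩ := H ρ ε hρ hρ0 hε hε0 c hfar lA lB rA rB hlA hlB hrA hrB τ t _ hτ0 hτ1 hl hr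
      (f.lower.abs_le_norm t (ω.width e / 2)) ((f.lower.norm_le t (ω.width e / 2)).trans_eq
        (by rw [abs_of_pos (by positivity : 0 < ω.width e / 2)]))
    refine ⟨_, _, b1, b2, hsnd.1, hsnd.2, ?_⟩
    rw [← folded_strip_point ω h e A g u d n]
    module
  · refine ⟨1, one_pos, 1, one_pos, fun ρ ε _ _ _ _ c hc _ y hy => (hz ?_).elim⟩
    obtain ⟨lA, lB, rA, rB, -, -, -, -, s₀, hs₀, K⟩ := f.exists_piece_eq_strip hcor hc
    rw [localPicture_congr hs₀ fun s h0 h1 => (K s h0 h1).2.2.2.2.2] at hy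
    exact exists_eq_of_localPicture_strip_nonempty hL f.norm_folded_direction
      ⟨y, intrinsicInterior_subset hy⟩

end CreaseFrame

/-- One family of trimmings, indexed by the cut-off radius `1 / ε`, serves both the plane and the
folding; each excludes local intersections once `ε` is small. -/
theorem exists_isRefinement (hwrap : S.NonWrapping) (hcor : S.pattern.NoStraightCorner)
    (hh : ω.IsHeight h) : ∃ c : S.Trimming, ω.IsRefinement h c := by
  obtain ⟨Φ⟩ := exists_creaseFrames hh
  have := finite_piece (S := S)
  choose c hb hfar using fun ε : ℝ => exists_farTrimming hcor ω (1 / ε)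
  obtain ⟨ε₁, hε₁, H₁⟩ := exists_trimming_scale (Q := fun ε i s => ω.flatPiece (c ε) s i)
    S.pattern.vertices.finite_toSet (fun i s δ δ' => Φ.outFlat_mono i s δ δ') Φ.disjoint_outFlat
    (fun y => ‖y‖) (by
      rintro z - (C | e)
      · obtain ⟨ρ₀, hρ₀, H⟩ := exists_face_scale ω C z
        refine ⟨ρ₀, hρ₀, fun ρ hρ hρ0 => ⟨1, one_pos, 1, one_pos, fun ε hε hε0 y hy => ?_⟩⟩
        have hz := mem_closure_of_localPicture_nonempty ⟨_, intrinsicInterior_subset hy⟩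
        refine H ρ ε hρ hρ0 hε hε0 (c ε) y ?_
        rwa [← intrinsicInterior_eq_interior_of_nonempty
          (nonempty_interior_localPicture_reducedFace (hb ε) hz)]
      · obtain ⟨ρ₀, hρ₀, ε₀, hε₀, H⟩ := (Φ.frame e).exists_flat_scale hcor z
        exact ⟨ρ₀, hρ₀, fun ρ hρ hρ0 => ⟨ρ / 2, by positivity, ε₀, hε₀, fun ε hε hε0 y hy =>
          H ρ ε hρ hρ0 hε hε0 (c ε) (hb ε) (hfar ε) y (intrinsicInterior_subset hy)⟩⟩)
  obtain ⟨ε₂, hε₂, H₂⟩ := exists_trimming_scale (Q := fun ε i s => ω.foldedPiece h (c ε) s i)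
    (S.pattern.vertices.finite_toSet.image fun v => ((S.fold v, 0) : Space))
    (fun i s δ δ' => Φ.outFolded_mono i s δ δ') (Φ.disjoint_outFolded hwrap hcor hh)
    -- Only the planar part is measured, since the estimate concerns the position along the crease.
    (fun y => ‖y.1‖) (by
      rintro _ ⟨v, -, rfl⟩ (C | e)
      · obtain ⟨ρ₀, hρ₀, H⟩ := exists_folded_face_scale (ω := ω) (h := h) C (S.fold v)
        exact ⟨ρ₀, hρ₀, fun ρ hρ hρ0 => ⟨1, one_pos, 1, one_pos, fun ε hε hε0 y hy =>
          H ρ ε hρ hρ0 hε hε0 (c ε) (hb ε) y hy⟩⟩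
      · obtain ⟨ρ₀, hρ₀, ε₀, hε₀, H⟩ := (Φ.frame e).exists_folded_scale hcor (S.fold v)
        exact ⟨ρ₀, hρ₀, fun ρ hρ hρ0 => ⟨ρ / 2, by positivity, ε₀, hε₀, fun ε hε hε0 y hy =>
          H ρ ε hρ hρ0 hε hε0 (c ε) (hb ε) (hfar ε) y hy⟩⟩)
  have hε : 0 < min ε₁ ε₂ := by positivity
  exact ⟨c (min ε₁ ε₂), hb _, fun v hv => H₁ _ hε (min_le_left _ _) v hv,
    fun v hv => H₂ _ hε (min_le_right _ _) _ ⟨v, hv, rfl⟩⟩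

end FlatFoldedState

theorem theorem1 (S : FlatFoldedState) (hwrap : S.NonWrapping)
    (hcorner : S.pattern.NoStraightCorner) (ω : S.WeightAssignment)
    (h : S.pattern.Face → ℝ) (hh : ω.IsHeight h) :
    (∃ c : S.Trimming, ω.IsRefinement h c) ∧
    ∀ c : S.Trimming, ω.IsRefinement h c →
      ∃ s : ℝ, 0 < s ∧ ω.IsThickening c s ∧
        ∀ i j : S.Piece, i ≠ j →
          ¬ StrictlyIntersect (ω.foldedPiece h c s i) (ω.foldedPiece h c s j) := by
  refine ⟨exists_isRefinement hwrap hcorner hh, fun c hc => ?_⟩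
  obtain ⟨Φ⟩ := exists_creaseFrames hh
  have := S.finite_face
  have := CreasePattern.finite_crease (P := S.pattern)
  have hb : IsBoundedTrimming ω c := hc.bounded
  obtain ⟨s₁, hs₁, H₁⟩ := exists_scale_flat hcorner hh hb hc.flat
  obtain ⟨s₂, hs₂, H₂⟩ := exists_scale_folded hcorner hh hb hwrap hc.folded
  obtain ⟨s₃, hs₃, H₃⟩ := exists_pos_forall_of_finite
    (p := fun (C : S.pattern.Face) r => ∀ s, 0 < s → s < r →
      (interior (ω.reducedFace c s C)).Nonempty)
    (fun C r r' hle H s h0 h1 => H s h0 (h1.trans_le hle))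
    (fun C => interior_reducedFace_nonempty hb)
  obtain ⟨s₄, hs₄, H₄⟩ := exists_pos_forall_of_finite
    (p := fun (e : S.pattern.Crease) r => ∀ s, 0 < s → s < r → ∀ F : S.pattern.Face,
      F.BoundedBy e.carrier → (ω.newCrease c s e F).Nontrivial)
    (fun C r r' hle H s h0 h1 => H s h0 (h1.trans_le hle))
    (fun e => (Φ.frame e).newCrease_nontrivial hcorner hb)
  obtain ⟨s, hs, hss⟩ := exists_between (show 0 < min (min s₁ s₂) (min s₃ s₄) by positivity)
  obtain ⟨h12, h34⟩ := lt_min_iff.1 hss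
  obtain ⟨h1, h2⟩ := lt_min_iff.1 h12
  obtain ⟨h3, h4⟩ := lt_min_iff.1 h34
  exact ⟨s, hs, ⟨fun e F => H₄ e s hs h4 F, fun F => H₃ F s hs h3, H₁ s hs h1⟩, H₂ s hs h2⟩
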